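/- Fix an integer $k>0$. **Partitions and cores.** A partition is drawn with its rows stacked from bottom to top, longest row at the bottom; the cell in row $i$ and column $j$ has residue $j-i \bmod k+1$. A cell of a partition is a *removable corner* if neither the square to its right nor the square above it is in the partition; a removable corner of residue $i$ is called a removable $i$-corner. The hook length of a cell is the number of cells to its right in its row plus the number of cells above it in its column plus one. A *core* is a partition with no cell of hook length $k+1$. Let $\mathcal P^k$ be the set of partitions with all parts at most $k$. The map $\mathfrak p$ that sends a core $\gamma$ to the partition whose $i$-th part is the number of cells of hook length at most $k$ in row $i$ of $\gamma$ is a bijection from cores onto $\mathcal P^k$; let $\mathfrak c=\mathfrak p^{-1}$. For $\beta\subseteq\gamma$, $Res(\gamma/\beta)$ denotes the set of residues of the cells of $\gamma/\beta$; the skew shape $\gamma/\beta$ is a *horizontal strip* if it has at most one cell in each column. **Affine set-valued tableaux.** A set-valued filling of a partition shape puts a nonempty finite set of positive integers in each cell so that $\max X\le\min Y$ if $X$ is west of $Y$ in the same row and $\max X<\min Y$ if $X$ is below $Y$ in the same column. For such a filling $T$, let $T_{\le x}$ be obtained by deleting all letters larger than $x$ (and the cells emptied thereby). $T$ is a *standard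 affine set-valued tableau of degree $n$* if its letters lie in $\{1,\dots,n\}$ and for each $1\le x\le n$ the shape of $T_{\le x}$ is a core and there is a residue $i$ such that this shape has at least one removable $i$-corner and the cells containing $x$ are exactly all its removable $i$-corners. For $\alpha=(\alpha_1,\dots,\alpha_\ell)$ with $\alpha_x\le k$, put $\mathcal A_{\alpha,x}=\{1+\sum_{i<x}\alpha_i,\dots,\sum_{i\le x}\alpha_i\}$. An *affine set-valued tableau of weight $\alpha$* is a standard affine set-valued tableau of degree $|\alpha|$ such that for every $x$: (1) the word obtained by reading the lowest occurrence of each letter of $\mathcal A_{\alpha,x}$, rows from top to bottom, each row from left to right, letters of the same cell in decreasing order, is increasing; (2) the cells containing letters of $\mathcal A_{\alpha,x}$ have exactly $\alpha_x$ distinct residues; (3) these cells form a horizontal strip. Let $\mathcal K^{(k)}_{\mu\alpha}$ be the number of affine set-valued tableaux of shape $\mathfrak c(\mu)$ and weight $\alpha$. **$k$-$K$-Schur functions.** Let $\Lambda$ be the ring of symmetric functions over $\mathbb Z$, $h_r$ the complete homogeneous symmetric functions and $h_\lambda=h_{\lambda_1}h_{\lambda_2}\cdots$. The $k$-$K$-Schur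 functions $g^{(k)}_\mu\in\Lambda$, $\mu\in\mathcal P^k$, are defined by the system $$h_\lambda=\sum_{\mu\in\mathcal P^k,\ |\mu|\le|\lambda|}(-1)^{|\lambda|+|\mu|}\,\mathcal K^{(k)}_{\mu\lambda}\,g^{(k)}_\mu\qquad(\lambda\in\mathcal P^k).$$ **Affine set-valued strips.** For cores $\beta\subseteq\gamma$ and $t\ge 0$, $\gamma/\beta$ is an *affine $t$-strip* if it is a horizontal strip, $|\mathfrak p(\gamma)|-|\mathfrak p(\beta)|=t$ and $|Res(\gamma/\beta)|=t$. For $0\le r\le k$, cores $\beta\subseteq\gamma$ and a partition $\rho\subseteq\beta$, the pair $(\gamma/\beta,\rho)$ is an *affine set-valued $r$-strip* if (i) $\gamma/\rho$ is a horizontal strip; (ii) $\gamma/\beta$ is an affine $(r-m)$-strip, where $m=|Res(\beta/\rho)|\le r$; (iii) every cell of $\beta/\rho$ is a removable corner of $\beta$, and if $\beta/\rho$ contains a cell of residue $i$, then it contains every removable $i$-corner of $\beta$ that does not lie below a cell of $\gamma$. For $\lambda\in\mathcal P^k$ let $$\mathcal H^k_{\lambda,r}=\{(\mu,\rho):\ \mu\in\mathcal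 P^k,\ (\mathfrak c(\mu)/\mathfrak c(\lambda),\rho)\text{ is an affine set-valued } r\text{-strip}\}.$$ **Theorem (row Pieri rule).** The system above has exactly one solution $(g^{(k)}_\mu)_{\mu\in\mathcal P^k}$ in $\Lambda$. For every $\lambda\in\mathcal P^k$ and every integer $0\le r\le k$, the set $\mathcal H^k_{\lambda,r}$ is finite and $$g^{(k)}_r\,g^{(k)}_\lambda=\sum_{(\mu,\rho)\in\mathcal H^k_{\lambda,r}}(-1)^{|\lambda|+r-|\mu|}\,g^{(k)}_\mu ,$$ where $g^{(k)}_r=g^{(k)}_{(r)}$ and $(0)$ is the empty partition. -/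

import Mathlib

namespace KKSchur

/-! Partitions are Young diagrams: `(i, j) ∈ γ` means that the `j`-th cell of the `i`-th row
belongs to `γ`, both indices starting from `0`.  Row `0` is the longest row and is regarded as
the bottom row, so that "above" means "larger row index". -/

section Partitions

/-- Hook length of a cell `c` of `γ`: the number of cells to the right of `c` in its row, plus
the number of cells above `c` in its column, plus one. -/
def hookLength (γ : YoungDiagram) (c : ℕ × ℕ) : ℕ :=
  (γ.rowLen c.1 - (c.2 + 1)) + (γ.colLen c.2 - (c.1 + 1)) + 1

/-- A `p`-core is a partition none of whose cells has hook length `p`. -/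
def IsCore (p : ℕ) (γ : YoungDiagram) : Prop :=
  ∀ c ∈ γ, hookLength γ c ≠ p

/-- The `(k+1)`-residue `j - i mod k+1` of the square `(i, j)`. -/
def residue (k : ℕ) (c : ℕ × ℕ) : ZMod (k + 1) :=
  (c.2 : ZMod (k + 1)) - (c.1 : ZMod (k + 1))

/-- The cell `c` is a removable corner of `γ`. -/
def IsRemovable (γ : YoungDiagram) (c : ℕ × ℕ) : Prop :=
  c ∈ γ ∧ (c.1, c.2 + 1) ∉ γ ∧ (c.1 + 1, c.2) ∉ γ

/-- The set of residues of the cells of the skew shape `γ / β`. -/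
def residues (k : ℕ) (γ β : YoungDiagram) : Finset (ZMod (k + 1)) :=
  (γ.cells \ β.cells).image (residue k)

/-- The set of `k`-bounded partitions: all parts are at most `k`. -/
abbrev BddPartition (k : ℕ) : Type := {μ : YoungDiagram // μ.rowLen 0 ≤ k}

/-- The `i`-th row of the `k`-bounded partition `𝔭(γ)` of a `(k+1)`-core `γ`: the number of cells
in row `i` of `γ` that remain when the cells with hook length larger than `k` are deleted. -/
def boundedRow (k : ℕ) (γ : YoungDiagram) (i : ℕ) : ℕ :=
  ((γ.row i).filter (fun c => hookLength γ c ≤ k)).card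

/-- The degree `|𝔭(γ)|`: the number of cells of `γ` with hook length at most `k`. -/
def boundedSize (k : ℕ) (γ : YoungDiagram) : ℕ :=
  (γ.cells.filter (fun c => hookLength γ c ≤ k)).card

/-- The map `𝔠 = 𝔭⁻¹` from `k`-bounded partitions to `(k+1)`-cores: `𝔠(μ)` is the (unique)
`(k+1)`-core `γ` with `𝔭(γ) = μ`. -/
noncomputable def coreOf (k : ℕ) (μ : BddPartition k) : YoungDiagram :=
  Classical.epsilon fun γ : YoungDiagram =>
    IsCore (k + 1) γ ∧ ∀ i, boundedRow k γ i = μ.1.rowLen i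

/-- The one-row partition `(r)`; it is the empty partition for `r = 0`. -/
def rowDiagram (r : ℕ) : YoungDiagram where
  cells := Finset.range 1 ×ˢ Finset.range r
  isLowerSet := by
    rintro ⟨a, b⟩ ⟨c, d⟩ ⟨h1, h2⟩ hab
    simp only [Finset.coe_product, Set.mem_prod, Finset.mem_coe, Finset.mem_range] at hab ⊢
    simp only at h1 h2
    omega

theorem rowLen_rowDiagram (r : ℕ) : (rowDiagram r).rowLen 0 = r := by
  rw [YoungDiagram.rowLen_eq_card]
  have h : (rowDiagram r).row 0 = Finset.range 1 ×ˢ Finset.range r := by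
    ext ⟨a, b⟩
    rw [YoungDiagram.mem_row_iff, ← YoungDiagram.mem_cells]
    simp only [rowDiagram, Finset.mem_product, Finset.mem_range]
    omega
  rw [h]
  simp

/-- The partition `(r)` as a `k`-bounded partition, for `r ≤ k`. -/
def rowPartition {k : ℕ} (r : ℕ) (hr : r ≤ k) : BddPartition k :=
  ⟨rowDiagram r, (rowLen_rowDiagram r).trans_le hr⟩

theorem finite_card_le (k n : ℕ) : {μ : BddPartition k | μ.1.card ≤ n}.Finite := by
  have hinj : Function.Injective (fun μ : BddPartition k => μ.1.cells) := by
    intro μ ν h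
    exact Subtype.ext (YoungDiagram.ext h)
  refine Set.Finite.of_finite_image (f := fun μ : BddPartition k => μ.1.cells) ?_ hinj.injOn
  refine (Finset.finite_toSet (Finset.range n ×ˢ Finset.range n).powerset).subset ?_
  rintro _ ⟨μ, hμ, rfl⟩
  simp only [Set.mem_ofPred_eq] at hμ
  simp only [Finset.coe_powerset, Set.mem_preimage, Set.mem_powerset_iff, Finset.coe_subset]
  rintro ⟨i, j⟩ hc
  rw [YoungDiagram.mem_cells] at hc
  have h1 : (Finset.range (i + 1)).card ≤ μ.1.card := by
    refine Finset.card_le_card_of_injOn (fun a => (a, j)) ?_ ?_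
    · intro a ha
      simp only [Finset.coe_range, Set.mem_Iio] at ha
      exact Finset.mem_coe.2 (μ.1.mem_cells _ |>.2 (μ.1.up_left_mem (by omega) le_rfl hc))
    · intro a _ b _ h
      exact (Prod.mk.inj h).1
  have h2 : (Finset.range (j + 1)).card ≤ μ.1.card := by
    refine Finset.card_le_card_of_injOn (fun a => (i, a)) ?_ ?_
    · intro a ha
      simp only [Finset.coe_range, Set.mem_Iio] at ha
      exact Finset.mem_coe.2 (μ.1.mem_cells _ |>.2 (μ.1.up_left_mem le_rfl (by omega) hc))
    · intro a _ b _ h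
      exact (Prod.mk.inj h).2
  simp only [Finset.card_range] at h1 h2
  simp only [Finset.mem_product, Finset.mem_range]
  omega

/-- The finite set of all `k`-bounded partitions of degree at most `n`. -/
noncomputable def partitionsUpTo (k n : ℕ) : Finset (BddPartition k) :=
  (finite_card_le k n).toFinset

end Partitions

section Tableaux

/-- A set-valued filling of a partition shape: the cells of the shape, and only these, hold a
nonempty finite set of letters, and `max X ≤ min Y` when `X` is west of `Y`,
`max X < min Y` when `X` is below `Y`. -/
structure SetValuedTableau where
  shape : YoungDiagram
  entry : ℕ × ℕ → Finset ℕ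
  nonempty_iff : ∀ c, (entry c).Nonempty ↔ c ∈ shape
  row_weak : ∀ i j j', j < j' → ∀ a ∈ entry (i, j), ∀ b ∈ entry (i, j'), a ≤ b
  col_strict : ∀ i i' j, i < i' → ∀ a ∈ entry (i, j), ∀ b ∈ entry (i', j), a < b

/-- The shape of `T_{≤ x}`, the subtableau of `T` obtained by deleting all letters larger
than `x`: its cells are those holding some letter `a ≤ x`. -/
def SetValuedTableau.shapeLE (T : SetValuedTableau) (x : ℕ) : YoungDiagram where
  cells := T.shape.cells.filter (fun c => ∃ a ∈ T.entry c, a ≤ x)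
  isLowerSet := by
    rintro ⟨i, j⟩ ⟨i', j'⟩ ⟨hi, hj⟩ h
    simp only at hi hj
    simp only [Finset.coe_filter, Set.mem_ofPred_eq, YoungDiagram.mem_cells] at h ⊢
    obtain ⟨hc, a, ha, hax⟩ := h
    have h1 : (i, j') ∈ T.shape := T.shape.up_left_mem le_rfl hj hc
    have h2 : (i', j') ∈ T.shape := T.shape.up_left_mem hi le_rfl h1
    have step1 : ∃ b ∈ T.entry (i, j'), b ≤ x := by
      rcases hj.eq_or_lt with rfl | hlt
      · exact ⟨a, ha, hax⟩
      · obtain ⟨b, hb⟩ := (T.nonempty_iff _).2 h1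
        exact ⟨b, hb, (T.row_weak i j' j hlt b hb a ha).trans hax⟩
    obtain ⟨b, hb, hbx⟩ := step1
    refine ⟨h2, ?_⟩
    rcases hi.eq_or_lt with rfl | hlt
    · exact ⟨b, hb, hbx⟩
    · obtain ⟨d, hd⟩ := (T.nonempty_iff _).2 h2
      exact ⟨d, hd, (T.col_strict i' i j' hlt d hd b hb).le.trans hbx⟩

/-- Standard affine set-valued tableau of degree `n`: the letters are among `1, …, n` and, for each
`1 ≤ x ≤ n`, the shape of `T_{≤ x}` is a `(k+1)`-core and the cells holding `x` are exactly all the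
removable corners of `T_{≤ x}` of some residue `i` (of which there is at least one). -/
def IsStandardAffineSV (k n : ℕ) (T : SetValuedTableau) : Prop :=
  (∀ c, T.entry c ⊆ Finset.Icc 1 n) ∧
  ∀ x ∈ Finset.Icc 1 n,
    IsCore (k + 1) (T.shapeLE x) ∧
    ∃ i : ZMod (k + 1),
      (∃ c, IsRemovable (T.shapeLE x) c ∧ residue k c = i) ∧
      ∀ c, x ∈ T.entry c ↔ IsRemovable (T.shapeLE x) c ∧ residue k c = i

/-- The alphabet `𝒜_{α,x} = [1 + α_1 + ⋯ + α_{x-1}, α_1 + ⋯ + α_x]`; here the parts of `α` are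
numbered from `0`, so this is the alphabet of the part `α[x]`. -/
def alphabet (α : List ℕ) (x : ℕ) : Finset ℕ :=
  Finset.Icc (1 + (α.take x).sum) (α.take (x + 1)).sum

/-- `c` is the lowest cell of `T` holding the letter `a`. -/
def IsLowestOccurrence (T : SetValuedTableau) (a : ℕ) (c : ℕ × ℕ) : Prop :=
  a ∈ T.entry c ∧ ∀ d, a ∈ T.entry d → c.1 ≤ d.1

/-- The letter `a` in cell `c` is read before the letter `b` in cell `d`: the rows are read from top
to bottom, each row from left to right, and the letters of one cell in decreasing order. -/
def ReadBefore (a : ℕ) (c : ℕ × ℕ) (b : ℕ) (d : ℕ × ℕ) : Prop :=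
  d.1 < c.1 ∨ (c.1 = d.1 ∧ (c.2 < d.2 ∨ (c.2 = d.2 ∧ b < a)))

/-- Affine set-valued tableau of weight `α`: a standard affine set-valued tableau of degree `|α|`
such that, for each part `α_x`, (1) the lowest reading word in the letters of `𝒜_{α,x}` is
increasing, (2) these letters occupy `α_x` distinct residues, (3) they form a
horizontal strip (no two of their cells lie in one column). -/
def IsAffineSV (k : ℕ) (α : List ℕ) (T : SetValuedTableau) : Prop :=
  IsStandardAffineSV k α.sum T ∧
  ∀ x : Fin α.length,
    (∀ a ∈ alphabet α x, ∀ b ∈ alphabet α x, a < b →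
      ∀ c d, IsLowestOccurrence T a c → IsLowestOccurrence T b d → ReadBefore a c b d) ∧
    ((T.shape.cells.filter (fun c => ∃ a ∈ alphabet α x, a ∈ T.entry c)).image
      (residue k)).card = α[x] ∧
    (∀ c d, (∃ a ∈ alphabet α x, a ∈ T.entry c) → (∃ b ∈ alphabet α x, b ∈ T.entry d) →
      c.2 = d.2 → c = d)

/-- `𝒦^{(k)}_{μα}`: the number of affine set-valued tableaux of shape `𝔠(μ)` and weight `α`. -/
noncomputable def svKostka (k : ℕ) (μ : BddPartition k) (α : List ℕ) : ℕ :=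
  Set.ncard {T : SetValuedTableau | T.shape = coreOf k μ ∧ IsAffineSV k α T}

end Tableaux

section SymmetricFunctions

/-- The complete homogeneous symmetric function `h_r` in the variables `x_0, x_1, x_2, …`: the sum
of all monomials of degree `r`. -/
noncomputable def completeSeries (r : ℕ) : MvPowerSeries ℕ ℤ :=
  fun d => if d.degree = r then 1 else 0

/-- The ring `Λ` of symmetric functions over `ℤ`, generated by the `h_r`. -/
noncomputable abbrev SymFun : Subalgebra ℤ (MvPowerSeries ℕ ℤ) :=
  Algebra.adjoin ℤ (Set.range completeSeries)

/-- `h_r` as an element of `Λ`. -/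
noncomputable def hSym (r : ℕ) : SymFun :=
  ⟨completeSeries r, Algebra.subset_adjoin ⟨r, rfl⟩⟩

/-- `h_μ = h_{μ_1} h_{μ_2} ⋯` for a partition `μ`. -/
noncomputable def hPart (μ : YoungDiagram) : SymFun :=
  (μ.rowLens.map hSym).prod

/-- The system of equations that defines the `k`-`K`-Schur functions:
`h_μ = ∑_{|ν| ≤ |μ|} (-1)^{|μ|+|ν|} 𝒦^{(k)}_{νμ} g_ν` for every `k`-bounded partition `μ`,
where `ν` runs over the `k`-bounded partitions. -/
def IsKKSchurFamily (k : ℕ) (g : BddPartition k → SymFun) : Prop :=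
  ∀ μ : BddPartition k,
    hPart μ.1 = ∑ ν ∈ partitionsUpTo k μ.1.card,
      ((-1 : ℤ) ^ (μ.1.card + ν.1.card) * (svKostka k ν μ.1.rowLens : ℤ)) • g ν

/-- The `k`-`K`-Schur functions `g_μ^{(k)}`: the solution of the system `IsKKSchurFamily`. -/
noncomputable def kkSchur (k : ℕ) : BddPartition k → SymFun :=
  Classical.epsilon (IsKKSchurFamily k)

end SymmetricFunctions

section Strips

/-- `γ / ρ` is a horizontal strip: `ρ ⊆ γ` and each column contains at most one cell
of `γ / ρ`. -/
def IsHorizontalStrip (γ ρ : YoungDiagram) : Prop :=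
  ρ ≤ γ ∧ ∀ c d, c ∈ γ → c ∉ ρ → d ∈ γ → d ∉ ρ → c.2 = d.2 → c = d

/-- `γ / β` is an affine `t`-strip: a horizontal strip, where `γ` and `β` are `(k+1)`-cores,
`|𝔭(γ)| - |𝔭(β)| = t`, and `γ / β` occupies `t` distinct residues. -/
def IsAffineStrip (k t : ℕ) (γ β : YoungDiagram) : Prop :=
  IsHorizontalStrip γ β ∧
  IsCore (k + 1) γ ∧ IsCore (k + 1) β ∧
  boundedSize k γ = boundedSize k β + t ∧
  (residues k γ β).card = t

/-- `(γ / β, ρ)` is an affine set-valued `r`-strip (`r ≤ k`):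
`γ / ρ` is a horizontal strip; `γ / β` is an affine `(r - m)`-strip, where `m` is the number of
residues of `β / ρ`; and `β / ρ` is a set of removable corners of `β` such that if it contains a
cell `c` of residue `i`, then it contains each `β`-removable `i`-corner `d` that is
not `γ`-blocked, i.e. does not lie below a cell of `γ`. -/
def IsAffineSVStrip (k r : ℕ) (γ β ρ : YoungDiagram) : Prop :=
  IsHorizontalStrip γ ρ ∧
  (∃ t, t + (residues k β ρ).card = r ∧ IsAffineStrip k t γ β) ∧
  ρ ≤ β ∧
  (∀ c, c ∈ β → c ∉ ρ → IsRemovable β c) ∧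
  (∀ c, c ∈ β → c ∉ ρ → ∀ d, IsRemovable β d → residue k d = residue k c →
    (d.1 + 1, d.2) ∉ γ → d ∉ ρ)

/-- The set `ℋ^k_{μ,r}` of pairs `(ν, ρ)` such that `(𝔠(ν) / 𝔠(μ), ρ)` is an affine
set-valued `r`-strip. -/
def pieriSet (k : ℕ) (μ : BddPartition k) (r : ℕ) : Set (BddPartition k × YoungDiagram) :=
  {p | IsAffineSVStrip k r (coreOf k p.1) (coreOf k μ) p.2}

end Strips

end KKSchur

namespace KKSchur

/-! ### Diagonals of Young diagrams and their bead sequences -/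

/-! A partition is recorded by its beads, the integers `rowLen i - i`. Hook lengths are the
distances from beads down to gaps, so a core is a diagram whose set of beads is closed under
subtracting `k + 1` (`isCore_iff`). It therefore amounts to a code: a function `f` with `f (x + (k +
1)) = f x - 1`, nonnegative exactly at the beads.

In terms of codes, an affine set-valued `r`-strip is a row transition along a set `A` of `r`
residues (`IsRow`). A value is carried from left to right. Off `A` it is put down and the next value
`f (x + 1)` is picked up; on `A` the two values must differ, the smaller is left behind and the
larger is carried on. Residues of `A` where the carried value is the larger one give `γ / β`, the
others give `β / ρ`. This is a bijection (`IsRow.exists_isAffineSVStrip`, `IsAffineSVStrip.step`). A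
block of letters of an affine set-valued tableau is again a row transition, its letters being the
residues of `A` sorted by the content of their lowest cell (`IsChain.blockCond_iff`). Hence the
numbers of tableaux are the coefficients of products of the operators `rowOp k r` applied to the
empty partition (`weightVec_apply`).

These operators commute. Two consecutive rows form a vertex model whose local moves, sortings of
adjacent entries that vanish on equal entries, satisfy the 0-Hecke relations. These give a
Yang-Baxter equation, and comparing twisted traces over one period yields commutation
(`card_pairs_comm`, `rowOp_comm`). So the number of tableaux does not depend on the order of the
weight.

The matrix of these numbers is unitriangular (`svKostka_map_range`), so the defining system has
exactly one solution. A weight `λ` followed by `r` may be re-sorted into a partition; hence `rowOp k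
r` corresponds to multiplication by `h_r`, up to signs (`signedMap_rowOp`). On the empty partition
`rowOp k r` produces only `(r)`, so `g_r = h_r`, and the Pieri rule is the expansion of `rowOp k r`
with its transitions read as strips (`finsum_pieriSet`). -/

theorem exists_rowLen_sub_le (γ : YoungDiagram) (x : ℤ) : ∃ i : ℕ, (γ.rowLen i : ℤ) - i ≤ x := by
  refine ⟨γ.rowLen 0 + x.natAbs, ?_⟩
  have := γ.rowLen_anti 0 (γ.rowLen 0 + x.natAbs) (Nat.zero_le _)
  omega

/-- The number of rows `i` with `rowLen i - i > x`; up to a correction by `max 0 (-x)` this is the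
number of cells of content `x`. -/
noncomputable def diag (γ : YoungDiagram) (x : ℤ) : ℕ := Nat.find (exists_rowLen_sub_le γ x)

/-- The numbers `rowLen i - i` strictly decrease in `i`, so the rows with a bead beyond `x` form an
initial segment. -/
theorem lt_diag {γ : YoungDiagram} {x : ℤ} {i : ℕ} :
    i < diag γ x ↔ x < (γ.rowLen i : ℤ) - i := by
  rw [diag, Nat.lt_find_iff]
  constructor
  · intro h
    have := h i le_rfl
    omega
  · intro h m hm
    have := γ.rowLen_anti m i hm
    omega

theorem mem_iff_lt_diag {γ : YoungDiagram} {i j : ℕ} : (i, j) ∈ γ ↔ i < diag γ ((j : ℤ) - i) := by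
  rw [YoungDiagram.mem_iff_lt_rowLen, lt_diag]
  omega

theorem diag_succ_le (γ : YoungDiagram) (x : ℤ) : diag γ (x + 1) ≤ diag γ x := by
  by_contra! h
  have h1 := lt_diag.1 h
  have h2 := mt (lt_diag (γ := γ) (x := x) (i := diag γ x)).2 (lt_irrefl _)
  omega

theorem diag_le_succ (γ : YoungDiagram) (x : ℤ) : diag γ x ≤ diag γ (x + 1) + 1 := by
  by_contra! h
  have h1 := lt_diag.1 h
  have h2 := mt (lt_diag (γ := γ) (x := x + 1) (i := diag γ (x + 1))).2 (lt_irrefl _)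
  have := γ.rowLen_anti _ _ (Nat.le_succ (diag γ (x + 1)))
  simp only [Nat.succ_eq_add_one] at this
  push_cast at h1
  omega

theorem diag_anti (γ : YoungDiagram) {x y : ℤ} (h : x ≤ y) : diag γ y ≤ diag γ x := by
  induction y, h using Int.leInduction with
  | base => exact le_rfl
  | succ y _ ih => exact (diag_succ_le γ y).trans ih

theorem diag_le_add (γ : YoungDiagram) {x y : ℤ} (h : x ≤ y) : (diag γ x : ℤ) ≤ diag γ y + (y - x) := by
  induction y, h using Int.leInduction with
  | base => simp
  | succ y _ ih =>
    have := diag_le_succ γ y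
    omega

theorem neg_le_diag (γ : YoungDiagram) (x : ℤ) : -x ≤ diag γ x := by
  by_contra! h
  have h2 := mt (lt_diag (γ := γ) (x := x) (i := diag γ x)).2 (lt_irrefl _)
  omega

theorem diag_eq_zero {γ : YoungDiagram} {x : ℤ} (h : (γ.rowLen 0 : ℤ) ≤ x) : diag γ x = 0 := by
  by_contra h0
  have := lt_diag.1 (Nat.pos_of_ne_zero h0)
  omega

theorem diag_eq_neg {γ : YoungDiagram} {x : ℤ} (h : x ≤ -(γ.colLen 0 : ℤ)) :
    (diag γ x : ℤ) = -x := by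
  refine le_antisymm ?_ (neg_le_diag γ x)
  by_contra! h1
  have h2 : (-x).toNat < diag γ x := by omega
  rw [lt_diag] at h2
  have h3 : γ.rowLen (-x).toNat = 0 := by
    by_contra h4
    have := YoungDiagram.mem_iff_lt_rowLen.2 (Nat.pos_of_ne_zero h4)
    rw [YoungDiagram.mem_iff_lt_colLen] at this
    omega
  omega

theorem diag_le_iff {β γ : YoungDiagram} : β ≤ γ ↔ ∀ x, diag β x ≤ diag γ x := by
  constructor
  · intro h x
    by_contra! hx
    have h1 := neg_le_diag γ x
    -- The first square of content `x` outside `γ`; `neg_le_diag` makes its column index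
    -- nonnegative.
    obtain ⟨j, hj⟩ : ∃ j : ℕ, (j : ℤ) - (diag γ x : ℕ) = x := ⟨(x + diag γ x).toNat, by omega⟩
    have h2 : (diag γ x, j) ∈ β := by rw [mem_iff_lt_diag, hj]; exact hx
    have h3 := h h2
    rw [mem_iff_lt_diag, hj] at h3
    omega
  · rintro h ⟨i, j⟩ hc
    exact mem_iff_lt_diag.2 ((mem_iff_lt_diag.1 hc).trans_le (h _))

theorem diag_injective {β γ : YoungDiagram} (h : ∀ x, diag β x = diag γ x) : β = γ :=
  le_antisymm (diag_le_iff.2 fun x => (h x).le) (diag_le_iff.2 fun x => (h x).ge)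

/-- A Young diagram with prescribed diagonals. -/
noncomputable def ofDiag (D : ℤ → ℕ) (h1 : ∀ x, D (x + 1) ≤ D x) (h2 : ∀ x, D x ≤ D (x + 1) + 1)
    (N : ℕ) (_h3 : ∀ x, (N : ℤ) ≤ x → D x = 0) (_h4 : ∀ x, x ≤ -(N : ℤ) → (D x : ℤ) = -x) :
    YoungDiagram where
  cells := (Finset.range N ×ˢ Finset.range N).filter (fun c => c.1 < D ((c.2 : ℤ) - c.1))
  isLowerSet := by
    have anti : ∀ x y, x ≤ y → D y ≤ D x := by
      intro x y h
      induction y, h using Int.leInduction with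
      | base => exact le_rfl
      | succ y _ ih => exact (h1 y).trans ih
    have add : ∀ x y, x ≤ y → (D x : ℤ) ≤ D y + (y - x) := by
      intro x y h
      induction y, h using Int.leInduction with
      | base => simp
      | succ y _ ih =>
        have := h2 y
        omega
    rintro ⟨i, j⟩ ⟨i', j'⟩ ⟨hi, hj⟩ h
    simp only [Finset.coe_filter, Finset.mem_product, Finset.mem_range, Set.mem_ofPred_eq] at h ⊢
    simp only at hi hj
    refine ⟨by omega, ?_⟩
    have e1 := anti ((j' : ℤ) - i) ((j : ℤ) - i) (by omega)
    have e2 := add ((j' : ℤ) - i) ((j' : ℤ) - i') (by omega)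
    omega

theorem diag_ofDiag (D : ℤ → ℕ) (h1 : ∀ x, D (x + 1) ≤ D x) (h2 : ∀ x, D x ≤ D (x + 1) + 1)
    (N : ℕ) (h3 : ∀ x, (N : ℤ) ≤ x → D x = 0) (h4 : ∀ x, x ≤ -(N : ℤ) → (D x : ℤ) = -x) (x : ℤ) :
    diag (ofDiag D h1 h2 N h3 h4) x = D x := by
  have anti : ∀ x y, x ≤ y → D y ≤ D x := by
    intro x y h
    induction y, h using Int.leInduction with
    | base => exact le_rfl
    | succ y _ ih => exact (h1 y).trans ih
  have add : ∀ x y, x ≤ y → (D x : ℤ) ≤ D y + (y - x) := by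
    intro x y h
    induction y, h using Int.leInduction with
    | base => simp
    | succ y _ ih =>
      have := h2 y
      omega
  have lower : ∀ x, -x ≤ D x := by
    intro x
    rcases le_total x (-(N : ℤ)) with h | h
    · exact (h4 x h).ge
    · have := add (-(N : ℤ)) x h
      have := h4 _ (le_refl (-(N : ℤ)))
      omega
  set γ := ofDiag D h1 h2 N h3 h4 with hγ
  have key : ∀ i j : ℕ, (i, j) ∈ γ ↔ i < D ((j : ℤ) - i) := by
    intro i j
    rw [← YoungDiagram.mem_cells]
    simp only [hγ, ofDiag, Finset.mem_filter, Finset.mem_product, Finset.mem_range,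
      and_iff_right_iff_imp]
    intro h
    constructor
    · by_contra! hi
      have e1 := anti (-(i : ℤ)) ((j : ℤ) - i) (by omega)
      have e2 := h4 (-(i : ℤ)) (by omega)
      omega
    · by_contra! hj
      have e1 := add ((j : ℤ) - i) (j : ℤ) (by omega)
      have e2 := h3 (j : ℤ) (by omega)
      omega
  have key2 : ∀ i : ℕ, i < diag γ x ↔ i < D x := by
    intro i
    -- Row `i` has no square of content `x` when `i < -x`; such rows are counted by both sides in
    -- any case.
    rcases lt_or_ge (i : ℤ) (-x) with h | h
    · have := lower x
      have := neg_le_diag γ x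
      omega
    · obtain ⟨j, hj⟩ : ∃ j : ℕ, (j : ℤ) - i = x := ⟨(x + i).toNat, by omega⟩
      rw [← hj, ← mem_iff_lt_diag, key]
  exact le_antisymm (le_of_forall_lt fun i hi => (key2 i).1 hi)
    (le_of_forall_lt fun i hi => (key2 i).2 hi)

/-- The integer `x` is of the form `rowLen i - i`. -/
def bead (γ : YoungDiagram) (x : ℤ) : Prop := diag γ (x - 1) = diag γ x + 1

noncomputable instance (γ : YoungDiagram) (x : ℤ) : Decidable (bead γ x) :=
  inferInstanceAs (Decidable (_ = _))

theorem not_bead_iff {γ : YoungDiagram} {x : ℤ} : ¬ bead γ x ↔ diag γ (x - 1) = diag γ x := by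
  have h1 := diag_succ_le γ (x - 1)
  have h2 := diag_le_succ γ (x - 1)
  rw [sub_add_cancel] at h1 h2
  unfold bead
  omega

theorem diag_rowLen_sub (γ : YoungDiagram) (i : ℕ) : diag γ ((γ.rowLen i : ℤ) - i) = i := by
  refine le_antisymm ?_ ?_
  · by_contra! h
    rw [lt_diag] at h
    omega
  · by_contra! h
    have h2 := mt (lt_diag (γ := γ) (x := (γ.rowLen i : ℤ) - i)
      (i := diag γ ((γ.rowLen i : ℤ) - i))).2 (lt_irrefl _)
    have := γ.rowLen_anti _ _ h.le
    omega

theorem diag_rowLen_sub_sub_one (γ : YoungDiagram) (i : ℕ) :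
    diag γ ((γ.rowLen i : ℤ) - i - 1) = i + 1 := by
  have h1 := diag_le_succ γ ((γ.rowLen i : ℤ) - i - 1)
  rw [sub_add_cancel, diag_rowLen_sub] at h1
  have h2 : i < diag γ ((γ.rowLen i : ℤ) - i - 1) := by rw [lt_diag]; omega
  omega

theorem bead_rowLen_sub (γ : YoungDiagram) (i : ℕ) : bead γ ((γ.rowLen i : ℤ) - i) := by
  rw [bead, diag_rowLen_sub, diag_rowLen_sub_sub_one]

theorem bead.eq_rowLen_sub {γ : YoungDiagram} {x : ℤ} (h : bead γ x) :
    (γ.rowLen (diag γ x) : ℤ) - diag γ x = x := by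
  have h1 : diag γ x < diag γ (x - 1) := by rw [h]; omega
  rw [lt_diag] at h1
  have h2 := mt (lt_diag (γ := γ) (x := x) (i := diag γ x)).2 (lt_irrefl _)
  omega

/-- Along the boundary of the diagram the beads are the steps closing rows and the gaps are the
steps closing columns; column `j` closes at `j + 1 - colLen j`. -/
theorem not_bead_iff_exists {γ : YoungDiagram} {x : ℤ} :
    ¬ bead γ x ↔ ∃ j : ℕ, x = (j : ℤ) + 1 - γ.colLen j := by
  constructor
  · intro h
    rw [not_bead_iff] at h
    have h0 := neg_le_diag γ (x - 1)
    obtain ⟨j, hj⟩ : ∃ j : ℕ, (j : ℤ) = x - 1 + diag γ x := ⟨(x - 1 + diag γ x).toNat, by omega⟩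
    refine ⟨j, ?_⟩
    have h1 : ¬ diag γ x < γ.colLen j := by
      rw [← YoungDiagram.mem_iff_lt_colLen, mem_iff_lt_diag, hj, ← h]
      simp [h]
    have h2 : γ.colLen j = diag γ x := by
      refine le_antisymm (not_lt.1 h1) ?_
      by_contra! h3
      have h4 : (γ.colLen j, j) ∈ γ := by
        rw [mem_iff_lt_diag]
        have h5 := diag_le_add γ (x := x) (y := (j : ℤ) - γ.colLen j) (by omega)
        omega
      rw [YoungDiagram.mem_iff_lt_colLen] at h4
      omega
    omega
  · rintro ⟨j, rfl⟩
    rw [not_bead_iff]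
    have h1 : ¬ (γ.colLen j, j) ∈ γ := by rw [YoungDiagram.mem_iff_lt_colLen]; omega
    rw [mem_iff_lt_diag, not_lt] at h1
    have e : (j : ℤ) + 1 - γ.colLen j - 1 = (j : ℤ) - γ.colLen j := by ring
    rw [e]
    refine le_antisymm ?_ (diag_anti γ (by omega))
    rcases Nat.eq_zero_or_pos (γ.colLen j) with h0 | h0
    · rw [h0] at h1 ⊢
      omega
    · have h2 : (γ.colLen j - 1, j) ∈ γ := by rw [YoungDiagram.mem_iff_lt_colLen]; omega
      rw [mem_iff_lt_diag] at h2
      have e2 : (j : ℤ) - (γ.colLen j - 1 : ℕ) = (j : ℤ) + 1 - γ.colLen j := by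
        rw [Nat.cast_sub h0]; push_cast; ring
      rw [e2] at h2
      omega

/-- The hook length of `(i, j)` is the bead of row `i` minus the gap of column `j`. A cell of hook
length `k + 1` is thus a bead with a gap exactly `k + 1` below it. -/
theorem isCore_iff {k : ℕ} {γ : YoungDiagram} :
    IsCore (k + 1) γ ↔ ∀ x, bead γ x → bead γ (x - (k + 1)) := by
  constructor
  · intro h x hx
    by_contra h1
    obtain ⟨j, hj⟩ := not_bead_iff_exists.1 h1
    have h2 := hx.eq_rowLen_sub
    set i := diag γ x
    have hc : (i, j) ∈ γ := by
      by_contra hc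
      have a1 := mt YoungDiagram.mem_iff_lt_rowLen.2 hc
      have a2 := mt YoungDiagram.mem_iff_lt_colLen.2 hc
      omega
    refine h (i, j) hc ?_
    rw [hookLength]
    have a1 := YoungDiagram.mem_iff_lt_rowLen.1 hc
    have a2 := YoungDiagram.mem_iff_lt_colLen.1 hc
    dsimp only
    omega
  · rintro h ⟨i, j⟩ hc he
    have a1 := YoungDiagram.mem_iff_lt_rowLen.1 hc
    have a2 := YoungDiagram.mem_iff_lt_colLen.1 hc
    refine not_bead_iff_exists.2 ⟨j, ?_⟩ (h _ (bead_rowLen_sub γ i))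
    rw [hookLength] at he
    dsimp only at he
    omega

/-! ### Codes of cores -/

/-- `f (x + (k + 1)) = f x - 1` for all `x`. -/
def Quasi (k : ℕ) (f : ℤ → ℤ) : Prop := ∀ x, f (x + (k + 1)) = f x - 1

theorem Quasi.add_mul {k : ℕ} {f : ℤ → ℤ} (h : Quasi k f) (x t : ℤ) :
    f (x + (k + 1) * t) = f x - t := by
  induction t using Int.induction_on with
  | zero => simp
  | succ i ih =>
    have := h (x + (k + 1) * i)
    rw [show x + ((k : ℤ) + 1) * (i + 1) = x + (k + 1) * i + (k + 1) by ring, this, ih]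
    ring
  | pred i ih =>
    have := h (x + (k + 1) * (-i - 1))
    rw [show x + ((k : ℤ) + 1) * (-i - 1) + (k + 1) = x + (k + 1) * (-i) by ring, ih] at this
    linarith

theorem Quasi.sub {k : ℕ} {f : ℤ → ℤ} (h : Quasi k f) (x : ℤ) : f (x - (k + 1)) = f x + 1 := by
  have := h (x - (k + 1))
  rw [sub_add_cancel] at this
  omega

/-- The code of a core: a quasi-periodic function whose nonnegativity set is the set of beads. -/
structure IsCode (k : ℕ) (γ : YoungDiagram) (f : ℤ → ℤ) : Prop where
  quasi : Quasi k f
  bead_iff : ∀ x, bead γ x ↔ 0 ≤ f x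

/-- The value `f x` is the level of the last bead among the positions congruent to `x`, which makes
the code unique. -/
theorem IsCode.le_iff {k : ℕ} {γ : YoungDiagram} {f : ℤ → ℤ} (h : IsCode k γ f) (x t : ℤ) :
    t ≤ f x ↔ bead γ (x + (k + 1) * t) := by
  rw [h.bead_iff, h.quasi.add_mul]
  omega

theorem IsCode.isCore {k : ℕ} {γ : YoungDiagram} {f : ℤ → ℤ} (h : IsCode k γ f) :
    IsCore (k + 1) γ := by
  rw [isCore_iff]
  intro x hx
  rw [h.bead_iff] at hx ⊢
  rw [h.quasi.sub]
  omega

theorem IsCode.unique {k : ℕ} {γ : YoungDiagram} {f g : ℤ → ℤ} (hf : IsCode k γ f)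
    (hg : IsCode k γ g) : f = g := by
  funext x
  apply eq_of_forall_le_iff
  intro t
  rw [hf.le_iff, hg.le_iff]

/-- In each class modulo `k + 1` the beads are closed downwards; they are bounded above by `rowLen
0`, and every position up to `-colLen 0` is a bead. So each class has a last bead, whose level is
the code. -/
theorem exists_isCode {k : ℕ} {γ : YoungDiagram} (h : IsCore (k + 1) γ) : ∃ f, IsCode k γ f := by
  rw [isCore_iff] at h
  have down : ∀ (x : ℤ) (m : ℕ), bead γ x → bead γ (x - (k + 1) * m) := by
    intro x m hx
    induction m with
    | zero => simpa using hx
    | succ m ih =>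
      have := h _ ih
      rw [show x - ((k : ℤ) + 1) * m - (k + 1) = x - (k + 1) * ((m + 1 : ℕ) : ℤ) by
        push_cast; ring] at this
      exact this
  have ex : ∀ x : ℤ, ∃ t : ℤ, ∀ s : ℤ, s ≤ t ↔ bead γ (x + (k + 1) * s) := by
    intro x
    obtain ⟨t, ht1, ht2⟩ := Int.exists_greatest_of_bdd
      (P := fun t => bead γ (x + (k + 1) * t)) ⟨γ.rowLen 0 + |x|, by
        intro t ht
        by_contra! hlt
        have h0 : (γ.rowLen 0 : ℤ) + 1 ≤ x + (k + 1) * t := by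
          have := neg_abs_le x
          have : t ≤ (k + 1) * t := by nlinarith [abs_nonneg x]
          omega
        have h1 := diag_eq_zero (γ := γ) (x := x + (k + 1) * t) (by omega)
        have h2 := diag_eq_zero (γ := γ) (x := x + (k + 1) * t - 1) (by omega)
        rw [bead, h1, h2] at ht
        omega⟩ ⟨-(γ.colLen 0 + |x|), by
        have h0 : x + (k + 1) * -((γ.colLen 0 : ℤ) + |x|) ≤ -(γ.colLen 0 : ℤ) := by
          have := le_abs_self x
          nlinarith [abs_nonneg x]
        have h1 := diag_eq_neg h0
        have h2 := diag_eq_neg (γ := γ) (x := x + (k + 1) * -((γ.colLen 0 : ℤ) + |x|) - 1) (by omega)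
        rw [bead]
        omega⟩
    refine ⟨t, fun s => ⟨fun hs => ?_, ht2 s⟩⟩
    have := down _ (t - s).toNat ht1
    rw [Int.toNat_of_nonneg (by omega)] at this
    convert this using 1
    ring
  choose f hf using ex
  refine ⟨f, ?_, fun x => ?_⟩
  · intro x
    apply eq_of_forall_le_iff
    intro t
    rw [hf, show x + ((k : ℤ) + 1) + (k + 1) * t = x + (k + 1) * (t + 1) by ring, ← hf]
    omega
  · rw [hf]
    simp

theorem diag_sub_eq {γ : YoungDiagram} {x : ℤ} :
    (diag γ (x - 1) : ℤ) = diag γ x + (if bead γ x then 1 else 0) := by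
  split_ifs with h
  · rw [h]; push_cast; rfl
  · rw [not_bead_iff.1 h]; simp

/-- The beads give the increments of `diag`, and `diag` vanishes far to the right, so descending
induction from there determines it. -/
theorem diag_eq_of_sub {γ : YoungDiagram} {E : ℤ → ℤ} (N : ℤ) (h0 : ∀ x, N ≤ x → E x = 0)
    (h : ∀ x, E (x - 1) = E x + (if bead γ x then 1 else 0)) (x : ℤ) :
    (diag γ x : ℤ) = E x := by
  have key : ∀ m : ℕ, ∀ x, max N (γ.rowLen 0) - m ≤ x → (diag γ x : ℤ) = E x := by
    intro m
    induction m with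
    | zero =>
      intro x hx
      rw [h0 x (by omega), diag_eq_zero (by omega)]
      rfl
    | succ m ih =>
      intro x hx
      have e1 := ih (x + 1) (by push_cast at hx; omega)
      have e2 := h (x + 1)
      have e3 := diag_sub_eq (γ := γ) (x := x + 1)
      rw [add_sub_cancel_right] at e2 e3
      rw [e2, e3, e1]
  exact key (max N (γ.rowLen 0) - x).toNat x (by omega)

theorem bead_injective {β γ : YoungDiagram} (h : ∀ x, bead β x ↔ bead γ x) : β = γ := by
  apply diag_injective
  intro x
  have := diag_eq_of_sub (γ := β) (E := fun x => (diag γ x : ℤ)) (γ.rowLen 0)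
    (fun x hx => by simp [diag_eq_zero hx]) (fun x => by
      rw [diag_sub_eq, if_congr (h x) rfl rfl]) x
  exact_mod_cast this

theorem IsCode.injective {k : ℕ} {β γ : YoungDiagram} {f : ℤ → ℤ} (hβ : IsCode k β f)
    (hγ : IsCode k γ f) : β = γ :=
  bead_injective fun x => by rw [hβ.bead_iff, hγ.bead_iff]

/-! ### The bijection between cores and bounded partitions -/

/-- Let `y` be the position `k + 1` below the bead of row `i`. The hook is at most `k` exactly when
the gap of column `j` lies beyond `y`, and `y + diag γ y` is the number of gaps up to `y`, that is,
the first such column. -/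
theorem hookLength_le_iff {k : ℕ} {γ : YoungDiagram} {i j : ℕ} (h : j < γ.rowLen i) :
    hookLength γ (i, j) ≤ k ↔
      (γ.rowLen i : ℤ) - i - (k + 1) + diag γ ((γ.rowLen i : ℤ) - i - (k + 1)) ≤ j := by
  have hc := YoungDiagram.mem_iff_lt_colLen.1 (YoungDiagram.mem_iff_lt_rowLen.2 h)
  rw [hookLength]
  dsimp only
  set y := (γ.rowLen i : ℤ) - i - (k + 1) with hy
  have h1 : ((γ.rowLen i - (j + 1)) + (γ.colLen j - (i + 1)) + 1 ≤ k) ↔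
      (γ.colLen j : ℤ) ≤ j - y := by omega
  rw [h1]
  rcases lt_or_ge ((j : ℤ) - y) 0 with h2 | h2
  · omega
  · obtain ⟨a, ha⟩ := Int.eq_ofNat_of_zero_le h2
    have h3 : (a, j) ∈ γ ↔ a < γ.colLen j := YoungDiagram.mem_iff_lt_colLen
    rw [mem_iff_lt_diag, show (j : ℤ) - a = y by omega] at h3
    omega

/-- The difference `diag γ y - i` counts the beads in the window of length `k + 1` ending at the
bead of row `i`; the bounded row counts the gaps of that window. -/
theorem boundedRow_eq (k : ℕ) (γ : YoungDiagram) (i : ℕ) :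
    (boundedRow k γ i : ℤ) = i + (k + 1) - diag γ ((γ.rowLen i : ℤ) - i - (k + 1)) := by
  set y := (γ.rowLen i : ℤ) - i - (k + 1) with hy
  have h0 := neg_le_diag γ y
  have h1 : (diag γ y : ℤ) ≤ i + (k + 1) := by
    have := diag_le_add γ (x := y) (y := (γ.rowLen i : ℤ) - i) (by omega)
    rw [diag_rowLen_sub] at this
    omega
  obtain ⟨a, ha⟩ : ∃ a : ℕ, (a : ℤ) = y + diag γ y := ⟨(y + diag γ y).toNat, by omega⟩
  have h2 : (γ.row i).filter (fun c => hookLength γ c ≤ k) =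
      (Finset.Ico a (γ.rowLen i)).image (fun j => (i, j)) := by
    ext ⟨i', j⟩
    simp only [Finset.mem_filter, YoungDiagram.mem_row_iff, Finset.mem_image, Finset.mem_Ico,
      Prod.mk.injEq]
    constructor
    · rintro ⟨⟨h3, rfl⟩, h4⟩
      have h5 := YoungDiagram.mem_iff_lt_rowLen.1 h3
      rw [hookLength_le_iff h5, ← hy] at h4
      exact ⟨j, ⟨by omega, h5⟩, rfl, rfl⟩
    · rintro ⟨j', ⟨h3, h4⟩, rfl, rfl⟩
      refine ⟨⟨YoungDiagram.mem_iff_lt_rowLen.2 h4, rfl⟩, ?_⟩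
      rw [hookLength_le_iff h4, ← hy]
      omega
  rw [boundedRow, h2, Finset.card_image_of_injective _ (fun a b h => (Prod.mk.inj h).2),
    Nat.card_Ico]
  omega

theorem boundedRow_le (k : ℕ) (γ : YoungDiagram) (i : ℕ) : boundedRow k γ i ≤ k := by
  have h := boundedRow_eq k γ i
  have : i < diag γ ((γ.rowLen i : ℤ) - i - (k + 1)) := by rw [lt_diag]; omega
  omega

theorem rowLen_eq_zero {γ : YoungDiagram} {i : ℕ} (h : γ.colLen 0 ≤ i) : γ.rowLen i = 0 := by
  by_contra h1
  have := YoungDiagram.mem_iff_lt_colLen.1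
    (YoungDiagram.mem_iff_lt_rowLen.2 (Nat.pos_of_ne_zero h1))
  omega

theorem boundedRow_le_rowLen (k : ℕ) (γ : YoungDiagram) (i : ℕ) :
    boundedRow k γ i ≤ γ.rowLen i := by
  rw [boundedRow, YoungDiagram.rowLen_eq_card]
  exact Finset.card_filter_le _ _

theorem boundedRow_succ_le {k : ℕ} {γ : YoungDiagram} (h : IsCore (k + 1) γ) (i : ℕ) :
    boundedRow k γ (i + 1) ≤ boundedRow k γ i := by
  have h1 := boundedRow_eq k γ i
  have h2 := boundedRow_eq k γ (i + 1)
  have h3 := isCore_iff.1 h _ (bead_rowLen_sub γ i)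
  rw [bead] at h3
  have h4 := γ.rowLen_anti i (i + 1) (Nat.le_succ i)
  have h5 := diag_anti γ (x := (γ.rowLen (i + 1) : ℤ) - (i + 1 : ℕ) - (k + 1))
    (y := (γ.rowLen i : ℤ) - i - (k + 1) - 1) (by push_cast; omega)
  push_cast at h2 h5
  omega

/-- In a core the rows satisfy `γ_i = γ_{i + k + 1 - μ_i} + μ_i` where `μ = 𝔭(γ)`. -/
theorem rowLen_eq_of_isCore {k : ℕ} {γ : YoungDiagram} (h : IsCore (k + 1) γ) (i : ℕ) :
    γ.rowLen i = γ.rowLen (i + 1 + (k - boundedRow k γ i)) + boundedRow k γ i := by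
  have h1 := boundedRow_eq k γ i
  have h2 := boundedRow_le k γ i
  have h3 := (isCore_iff.1 h _ (bead_rowLen_sub γ i)).eq_rowLen_sub
  have h4 : diag γ ((γ.rowLen i : ℤ) - i - (k + 1)) = i + 1 + (k - boundedRow k γ i) := by omega
  rw [h4] at h3
  omega

/-- The relation `rowLen_eq_of_isCore` recovers each row from higher rows, and rows far up are
empty. -/
theorem IsCore.ext_boundedRow {k : ℕ} {β γ : YoungDiagram} (hβ : IsCore (k + 1) β)
    (hγ : IsCore (k + 1) γ) (h : ∀ i, boundedRow k β i = boundedRow k γ i) : β = γ := by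
  have key : ∀ m i, β.colLen 0 + γ.colLen 0 - m ≤ i → β.rowLen i = γ.rowLen i := by
    intro m
    induction m with
    | zero =>
      intro i hi
      rw [rowLen_eq_zero (by omega), rowLen_eq_zero (by omega)]
    | succ m ih =>
      intro i hi
      rw [rowLen_eq_of_isCore hβ, rowLen_eq_of_isCore hγ, h i, ih _ (by omega)]
  apply YoungDiagram.ext
  ext ⟨i, j⟩
  rw [YoungDiagram.mem_cells, YoungDiagram.mem_cells, YoungDiagram.mem_iff_lt_rowLen,
    YoungDiagram.mem_iff_lt_rowLen, key (β.colLen 0 + γ.colLen 0) i (by omega)]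

/-- The Young diagram with given row lengths. -/
def ofRows (R : ℕ → ℕ) (hR : Antitone R) (N : ℕ) (_hN : ∀ i, N ≤ i → R i = 0) : YoungDiagram where
  cells := (Finset.range N ×ˢ Finset.range (R 0)).filter (fun c => c.2 < R c.1)
  isLowerSet := by
    rintro ⟨i, j⟩ ⟨i', j'⟩ ⟨hi, hj⟩ h
    simp only [Finset.coe_filter, Finset.mem_product, Finset.mem_range, Set.mem_ofPred_eq] at h ⊢
    simp only at hi hj
    have := hR hi
    omega

theorem rowLen_ofRows (R : ℕ → ℕ) (hR : Antitone R) (N : ℕ) (hN : ∀ i, N ≤ i → R i = 0) (i : ℕ) :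
    (ofRows R hR N hN).rowLen i = R i := by
  have key : ∀ j, j < (ofRows R hR N hN).rowLen i ↔ j < R i := by
    intro j
    rw [← YoungDiagram.mem_iff_lt_rowLen, ← YoungDiagram.mem_cells]
    simp only [ofRows, Finset.mem_filter, Finset.mem_product, Finset.mem_range,
      and_iff_right_iff_imp]
    intro h
    have := hR (Nat.zero_le i)
    refine ⟨?_, by omega⟩
    by_contra! h1
    have := hN i h1
    omega
  exact le_antisymm (le_of_forall_lt fun i hi => (key i).1 hi)
    (le_of_forall_lt fun i hi => (key i).2 hi)

/-- The row lengths of the core with `k`-bounded partition `μ`. -/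
def coreRow (k : ℕ) (μ : ℕ → ℕ) (N : ℕ) (i : ℕ) : ℕ :=
  if i < N then coreRow k μ N (i + 1 + (k - μ i)) + μ i else 0
termination_by N - i

theorem coreRow_eq (k : ℕ) (μ : ℕ → ℕ) (N : ℕ) (hN : ∀ i, N ≤ i → μ i = 0) (i : ℕ) :
    coreRow k μ N i = coreRow k μ N (i + 1 + (k - μ i)) + μ i := by
  rcases lt_or_ge i N with h | h
  · rw [coreRow, if_pos h]
  · rw [coreRow, if_neg (by omega), coreRow, if_neg (by omega), hN i h]

theorem coreRow_antitone (k : ℕ) (μ : ℕ → ℕ) (N : ℕ) (hN : ∀ i, N ≤ i → μ i = 0)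
    (hμ : Antitone μ) (hk : μ 0 ≤ k) : Antitone (coreRow k μ N) := by
  have key : ∀ m i j, N - m ≤ i → i ≤ j → coreRow k μ N j ≤ coreRow k μ N i := by
    intro m
    induction m with
    | zero =>
      intro i j hi hj
      rw [coreRow, if_neg (by omega), coreRow, if_neg (by omega)]
    | succ m ih =>
      intro i j hi hj
      rcases hj.eq_or_lt with rfl | hj
      · exact le_rfl
      rw [coreRow_eq k μ N hN i, coreRow_eq k μ N hN j]
      have h1 := hμ hj.le
      have h2 := hμ (Nat.zero_le i)
      exact Nat.add_le_add (ih _ _ (by omega) (by omega)) h1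
  exact fun i j h => key N i j (by omega) h

/-- By the recursion for the rows, the bead of row `i` lowered by `k + 1` is the bead of row `i + 1
+ (k - μ_i)`. This gives the core condition, and the index of that row gives the bounded row length.
-/
theorem exists_core (k : ℕ) (μ : BddPartition k) :
    ∃ γ : YoungDiagram, IsCore (k + 1) γ ∧ ∀ i, boundedRow k γ i = μ.1.rowLen i := by
  have hN : ∀ i, μ.1.colLen 0 ≤ i → μ.1.rowLen i = 0 := fun i => rowLen_eq_zero
  have hanti : Antitone μ.1.rowLen := fun i j h => μ.1.rowLen_anti i j h
  set N := μ.1.colLen 0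
  set γ := ofRows (coreRow k μ.1.rowLen N) (coreRow_antitone k _ N hN hanti μ.2) N
    (fun i hi => by rw [coreRow, if_neg (by omega)]) with hγ
  have hrow : ∀ i, γ.rowLen i = γ.rowLen (i + 1 + (k - μ.1.rowLen i)) + μ.1.rowLen i := by
    intro i
    rw [hγ, rowLen_ofRows, rowLen_ofRows]
    exact coreRow_eq k _ N hN i
  have hle : ∀ i, μ.1.rowLen i ≤ k := fun i => (hanti (Nat.zero_le i)).trans μ.2
  have hbead : ∀ i, (γ.rowLen i : ℤ) - i - (k + 1) =
      γ.rowLen (i + 1 + (k - μ.1.rowLen i)) - ((i + 1 + (k - μ.1.rowLen i) : ℕ) : ℤ) := by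
    intro i
    have := hrow i
    have := hle i
    omega
  refine ⟨γ, ?_, fun i => ?_⟩
  · rw [isCore_iff]
    intro x hx
    rw [← hx.eq_rowLen_sub, hbead]
    exact bead_rowLen_sub _ _
  · have h := boundedRow_eq k γ i
    rw [hbead, diag_rowLen_sub] at h
    have := hle i
    omega

theorem coreOf_spec (k : ℕ) (μ : BddPartition k) :
    IsCore (k + 1) (coreOf k μ) ∧ ∀ i, boundedRow k (coreOf k μ) i = μ.1.rowLen i :=
  Classical.epsilon_spec (exists_core k μ)

theorem ext_rowLen {μ ν : YoungDiagram} (h : ∀ i, μ.rowLen i = ν.rowLen i) : μ = ν := by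
  apply YoungDiagram.ext
  ext ⟨i, j⟩
  rw [YoungDiagram.mem_cells, YoungDiagram.mem_cells, YoungDiagram.mem_iff_lt_rowLen,
    YoungDiagram.mem_iff_lt_rowLen, h]

theorem coreOf_injective (k : ℕ) : Function.Injective (coreOf k) := by
  intro μ ν h
  apply Subtype.ext
  apply ext_rowLen
  intro i
  rw [← (coreOf_spec k μ).2, ← (coreOf_spec k ν).2, h]

theorem exists_coreOf_eq {k : ℕ} {γ : YoungDiagram} (h : IsCore (k + 1) γ) :
    ∃ μ : BddPartition k, coreOf k μ = γ := by
  have hanti : Antitone (boundedRow k γ) := antitone_nat_of_succ_le (boundedRow_succ_le h)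
  have hN : ∀ i, γ.colLen 0 ≤ i → boundedRow k γ i = 0 := by
    intro i hi
    have h1 := boundedRow_le_rowLen k γ i
    rw [rowLen_eq_zero hi] at h1
    omega
  refine ⟨⟨ofRows (boundedRow k γ) hanti (γ.colLen 0) hN, by
    rw [rowLen_ofRows]; exact boundedRow_le k γ 0⟩, ?_⟩
  apply IsCore.ext_boundedRow (coreOf_spec k _).1 h
  intro i
  rw [(coreOf_spec k _).2]
  exact rowLen_ofRows _ hanti _ hN i

theorem card_filter_eq_sum_rows (γ : YoungDiagram) (p : ℕ × ℕ → Prop) [DecidablePred p] (N : ℕ)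
    (hN : γ.colLen 0 ≤ N) :
    (γ.cells.filter p).card = ∑ i ∈ Finset.range N, ((γ.row i).filter p).card := by
  rw [Finset.card_eq_sum_card_fiberwise (f := Prod.fst) (t := Finset.range N)]
  · refine Finset.sum_congr rfl fun i _ => ?_
    congr 1
    ext c
    simp only [Finset.mem_filter, YoungDiagram.mem_row_iff, YoungDiagram.mem_cells]
    tauto
  · intro c hc
    simp only [Finset.coe_filter, Set.mem_ofPred_eq, YoungDiagram.mem_cells] at hc
    obtain ⟨i, j⟩ := c
    have := YoungDiagram.mem_iff_lt_colLen.1 hc.1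
    have := γ.colLen_anti 0 j (Nat.zero_le _)
    simp only [Finset.coe_range, Set.mem_Iio]
    omega

theorem card_eq_sum_rowLen (γ : YoungDiagram) (N : ℕ) (hN : γ.colLen 0 ≤ N) :
    γ.card = ∑ i ∈ Finset.range N, γ.rowLen i := by
  have := card_filter_eq_sum_rows γ (fun _ => True) N hN
  simpa [YoungDiagram.rowLen_eq_card] using this

theorem boundedSize_eq_sum (k : ℕ) (γ : YoungDiagram) (N : ℕ) (hN : γ.colLen 0 ≤ N) :
    boundedSize k γ = ∑ i ∈ Finset.range N, boundedRow k γ i :=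
  card_filter_eq_sum_rows γ _ N hN

theorem boundedSize_coreOf (k : ℕ) (μ : BddPartition k) : boundedSize k (coreOf k μ) = μ.1.card := by
  rw [boundedSize_eq_sum k _ (max ((coreOf k μ).colLen 0) (μ.1.colLen 0)) (le_max_left _ _),
    card_eq_sum_rowLen μ.1 _ (le_max_right _ _)]
  exact Finset.sum_congr rfl fun i _ => (coreOf_spec k μ).2 i

/-- The code of the core `𝔠(μ)`. -/
noncomputable def code {k : ℕ} (μ : BddPartition k) : ℤ → ℤ :=
  (exists_isCode (coreOf_spec k μ).1).choose

theorem isCode_code {k : ℕ} (μ : BddPartition k) : IsCode k (coreOf k μ) (code μ) :=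
  (exists_isCode (coreOf_spec k μ).1).choose_spec

theorem code_injective {k : ℕ} : Function.Injective (code (k := k)) := by
  intro μ ν h
  apply coreOf_injective
  have h1 := isCode_code μ
  rw [h] at h1
  exact h1.injective (isCode_code ν)

/-! ### Horizontal strips of cores -/

/-- The content of a cell. -/
def cont (c : ℕ × ℕ) : ℤ := (c.2 : ℤ) - c.1

theorem residue_eq (k : ℕ) (c : ℕ × ℕ) : residue k c = ((cont c : ℤ) : ZMod (k + 1)) := by
  simp [residue, cont]

theorem mem_iff_lt_diag_cont {γ : YoungDiagram} {c : ℕ × ℕ} : c ∈ γ ↔ c.1 < diag γ (cont c) :=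
  mem_iff_lt_diag

theorem exists_cell (γ : YoungDiagram) (x : ℤ) : ∃ c : ℕ × ℕ, c.1 = diag γ x ∧ cont c = x := by
  have := neg_le_diag γ x
  exact ⟨(diag γ x, (x + diag γ x).toNat), rfl, by simp only [cont]; omega⟩

theorem intCast_eq_iff {k : ℕ} {x y : ℤ} :
    (x : ZMod (k + 1)) = (y : ZMod (k + 1)) ↔ ∃ t : ℤ, y = x + (k + 1) * t := by
  rw [ZMod.intCast_eq_intCast_iff_dvd_sub]
  constructor
  · rintro ⟨t, ht⟩
    exact ⟨t, by push_cast at ht; linarith⟩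
  · rintro ⟨t, ht⟩
    exact ⟨t, by push_cast; linarith⟩

theorem intCast_add_mul {k : ℕ} (x t : ℤ) :
    ((x + (k + 1) * t : ℤ) : ZMod (k + 1)) = (x : ZMod (k + 1)) :=
  (intCast_eq_iff.2 ⟨t, rfl⟩).symm

/-- The square above a square of content `x` has content `x - 1`, so having no two cells in a column
is a condition on neighbouring diagonals. -/
theorem isHorizontalStrip_iff {γ ρ : YoungDiagram} :
    IsHorizontalStrip γ ρ ↔ ρ ≤ γ ∧ ∀ x, diag γ (x - 1) ≤ diag ρ x + 1 := by
  constructor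
  · rintro ⟨h1, h2⟩
    refine ⟨h1, fun x => ?_⟩
    by_contra! h
    have h0 := neg_le_diag ρ x
    obtain ⟨j, hj⟩ : ∃ j : ℕ, (j : ℤ) = x + diag ρ x := ⟨(x + diag ρ x).toNat, by omega⟩
    have a1 : (diag ρ x + 1, j) ∈ γ := by
      rw [mem_iff_lt_diag, show (j : ℤ) - (diag ρ x + 1 : ℕ) = x - 1 by push_cast; omega]
      omega
    have a2 : (diag ρ x, j) ∈ γ := γ.up_left_mem (Nat.le_succ _) le_rfl a1
    have a3 : (diag ρ x, j) ∉ ρ := by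
      rw [mem_iff_lt_diag, show (j : ℤ) - (diag ρ x : ℕ) = x by omega]
      omega
    have a4 : (diag ρ x + 1, j) ∉ ρ := fun h => a3 (ρ.up_left_mem (Nat.le_succ _) le_rfl h)
    have := h2 _ _ a1 a4 a2 a3 rfl
    simp at this
  · rintro ⟨h1, h2⟩
    refine ⟨h1, ?_⟩
    have key : ∀ i i' j, i < i' → (i', j) ∈ γ → (i, j) ∈ ρ := by
      intro i i' j hi hc
      have a1 := γ.up_left_mem (show i + 1 ≤ i' by omega) (le_refl j) hc
      rw [mem_iff_lt_diag] at a1 ⊢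
      have := h2 ((j : ℤ) - i)
      rw [show (j : ℤ) - (i + 1 : ℕ) = (j : ℤ) - i - 1 by push_cast; ring] at a1
      omega
    rintro ⟨i, j⟩ ⟨i', j'⟩ c1 c2 d1 d2 h
    obtain rfl : j = j' := h
    rcases lt_trichotomy i i' with hi | rfl | hi
    · exact absurd (key _ _ _ hi d1) c2
    · rfl
    · exact absurd (key _ _ _ hi c1) d2

theorem IsHorizontalStrip.diag_eq {γ β : YoungDiagram} (h : IsHorizontalStrip γ β) {x : ℤ}
    (hx : diag β x < diag γ x) : diag γ x = diag β x + 1 := by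
  have h1 := (isHorizontalStrip_iff.1 h).2 x
  have h2 := diag_anti γ (x := x - 1) (y := x) (by omega)
  omega

/-- Adding a horizontal strip moves beads to the right, each staying strictly left of the former
place of the next bead. When one crosses from at most `x` to beyond `x`, no bead ends at `x` and
none started at `x + 1`. -/
theorem IsHorizontalStrip.not_bead {γ β : YoungDiagram} (h : IsHorizontalStrip γ β) {x : ℤ}
    (hx : diag β x < diag γ x) : ¬ bead γ x := by
  have h1 := (isHorizontalStrip_iff.1 h).2 x
  rw [bead]
  omega

theorem IsHorizontalStrip.not_bead_succ {γ β : YoungDiagram} (h : IsHorizontalStrip γ β) {x : ℤ}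
    (hx : diag β x < diag γ x) : ¬ bead β (x + 1) := by
  have h1 := (isHorizontalStrip_iff.1 h).2 (x + 1)
  rw [bead]
  rw [add_sub_cancel_right] at *
  omega

theorem mem_residues {k : ℕ} {γ β : YoungDiagram} {i : ZMod (k + 1)} :
    i ∈ residues k γ β ↔ ∃ x : ℤ, (x : ZMod (k + 1)) = i ∧ diag β x < diag γ x := by
  simp only [residues, Finset.mem_image, Finset.mem_sdiff, YoungDiagram.mem_cells]
  constructor
  · rintro ⟨c, ⟨h1, h2⟩, rfl⟩
    refine ⟨cont c, (residue_eq k c).symm, ?_⟩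
    rw [mem_iff_lt_diag_cont] at h1 h2
    omega
  · rintro ⟨x, rfl, hx⟩
    obtain ⟨c, hc1, hc2⟩ := exists_cell β x
    refine ⟨c, ?_, by rw [residue_eq, hc2]⟩
    rw [mem_iff_lt_diag_cont, mem_iff_lt_diag_cont, hc1, hc2]
    omega

theorem card_filter_bead (γ : YoungDiagram) {a b : ℤ} (h : a ≤ b) :
    ((Finset.Ioc a b).filter (bead γ)).card + diag γ b = diag γ a := by
  induction b, h using Int.leInduction with
  | base => simp
  | succ b hb ih =>
    have e : Finset.Ioc a (b + 1) = insert (b + 1) (Finset.Ioc a b) := by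
      ext x
      simp only [Finset.mem_Ioc, Finset.mem_insert]
      omega
    have h1 := diag_sub_eq (γ := γ) (x := b + 1)
    rw [add_sub_cancel_right] at h1
    rw [e, Finset.filter_insert]
    split_ifs at h1 ⊢ with h2
    · rw [Finset.card_insert_of_notMem (by simp)]
      omega
    · omega

/-- The window of `boundedRow_eq` moves right with the bead of row `i`. Its new lower end is a bead
of the core `γ`, hence a diagonal on which `β` and `γ` agree, so the row grows by the number of
beads of `β` that the lower end has passed, one for each marked new cell. -/
theorem boundedRow_of_strip {k : ℕ} {γ β : YoungDiagram} (h : IsHorizontalStrip γ β)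
    (hγ : IsCore (k + 1) γ) (i : ℕ) :
    boundedRow k γ i = boundedRow k β i +
      ((γ.cells \ β.cells).filter (fun c => bead β (cont c - k) ∧ c.1 = i)).card := by
  have h1 := boundedRow_eq k γ i
  have h2 := boundedRow_eq k β i
  have hlen : β.rowLen i ≤ γ.rowLen i := by
    by_contra! hlt
    have := h.1 (YoungDiagram.mem_iff_lt_rowLen.2 hlt)
    exact lt_irrefl _ (YoungDiagram.mem_iff_lt_rowLen.1 this)
  have h3 : diag γ ((γ.rowLen i : ℤ) - i - (k + 1)) = diag β ((γ.rowLen i : ℤ) - i - (k + 1)) := by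
    refine le_antisymm ?_ (diag_le_iff.1 h.1 _)
    by_contra! hlt
    exact h.not_bead hlt (isCore_iff.1 hγ _ (bead_rowLen_sub γ i))
  have h4 := card_filter_bead β (a := (β.rowLen i : ℤ) - i - (k + 1))
    (b := (γ.rowLen i : ℤ) - i - (k + 1)) (by omega)
  have h5 : (γ.cells \ β.cells).filter (fun c => bead β (cont c - k) ∧ c.1 = i) =
      ((Finset.Ioc ((β.rowLen i : ℤ) - i - (k + 1)) ((γ.rowLen i : ℤ) - i - (k + 1))).filter
        (bead β)).image (fun y : ℤ => (i, (y + k + i).toNat)) := by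
    ext ⟨i', j⟩
    simp only [Finset.mem_filter, Finset.mem_sdiff, YoungDiagram.mem_cells, Finset.mem_image,
      Finset.mem_Ioc, Prod.mk.injEq]
    simp only [YoungDiagram.mem_iff_lt_rowLen, cont]
    constructor
    · rintro ⟨⟨a1, a2⟩, a3, rfl⟩
      exact ⟨(j : ℤ) - i' - k, ⟨by omega, a3⟩, rfl, by omega⟩
    · rintro ⟨y, ⟨a1, a2⟩, rfl, rfl⟩
      refine ⟨by omega, ?_, rfl⟩
      convert a2 using 1
      omega
  rw [h5, Finset.card_image_of_injOn]
  · omega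
  · intro y hy y' hy' he
    simp only [Finset.coe_filter, Finset.mem_Ioc, Set.mem_ofPred_eq, Prod.mk.injEq, true_and] at *
    omega

theorem boundedSize_of_strip {k : ℕ} {γ β : YoungDiagram} (h : IsHorizontalStrip γ β)
    (hγ : IsCore (k + 1) γ) :
    boundedSize k γ = boundedSize k β +
      ((γ.cells \ β.cells).filter (fun c => bead β (cont c - k))).card := by
  obtain ⟨N, hN1, hN2⟩ : ∃ N, γ.colLen 0 ≤ N ∧ β.colLen 0 ≤ N :=
    ⟨_, le_max_left _ _, le_max_right _ _⟩
  rw [boundedSize_eq_sum k γ N hN1, boundedSize_eq_sum k β N hN2,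
    Finset.card_eq_sum_card_fiberwise (f := Prod.fst) (t := Finset.range N),
    ← Finset.sum_add_distrib]
  · refine Finset.sum_congr rfl fun i _ => ?_
    rw [boundedRow_of_strip h hγ i, Finset.filter_filter]
  · rintro ⟨i, j⟩ hc
    simp only [Finset.coe_filter, Set.mem_ofPred_eq, Finset.mem_sdiff, YoungDiagram.mem_cells] at hc
    have := YoungDiagram.mem_iff_lt_colLen.1 hc.1.1
    have := γ.colLen_anti 0 j (Nat.zero_le _)
    simp only [Finset.coe_range, Set.mem_Iio]
    omega

theorem IsHorizontalStrip.eq_of_cont_eq {γ β : YoungDiagram} (h : IsHorizontalStrip γ β)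
    {c d : ℕ × ℕ} (hc : c ∈ γ) (hc' : c ∉ β) (hd : d ∈ γ) (hd' : d ∉ β) (he : cont c = cont d) :
    c = d := by
  rw [mem_iff_lt_diag_cont] at hc hc' hd hd'
  have h1 := h.diag_eq (x := cont c) (by omega)
  rw [← he] at hd hd'
  obtain ⟨i, j⟩ := c
  obtain ⟨i', j'⟩ := d
  simp only [cont] at *
  simp only [Prod.mk.injEq]
  omega

open Classical in
/-- The size of a strip of cores is the number of residues whose lowest-level addable cell is
added. -/
theorem boundedSize_of_strip_code {k : ℕ} {γ β : YoungDiagram} (h : IsHorizontalStrip γ β)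
    (hγ : IsCore (k + 1) γ) {f : ℤ → ℤ} (hβ : IsCode k β f) :
    boundedSize k γ = boundedSize k β + ((residues k γ β).filter (fun i =>
      ∃ x : ℤ, (x : ZMod (k + 1)) = i ∧ diag β x < diag γ x ∧ f (x + 1) = -1)).card := by
  rw [boundedSize_of_strip h hγ]
  congr 1
  -- A gap at `cont c + 1` with a bead `k + 1` below it is the lowest gap of its class, so the code
  -- is `-1` there. Each residue has only one such position.
  have hcell : ∀ c : ℕ × ℕ, c ∈ γ → c ∉ β → bead β (cont c - k) → f (cont c + 1) = -1 := by
    intro c h1 h2 h3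
    rw [mem_iff_lt_diag_cont] at h1 h2
    have h4 := h.not_bead_succ (x := cont c) (by omega)
    rw [hβ.bead_iff] at h3 h4
    have := hβ.quasi.sub (cont c + 1)
    rw [show cont c + 1 - ((k : ℤ) + 1) = cont c - k by ring] at this
    omega
  refine Finset.card_bij (fun c _ => residue k c) ?_ ?_ ?_
  · intro c hc
    simp only [Finset.mem_filter, Finset.mem_sdiff, YoungDiagram.mem_cells] at hc
    obtain ⟨⟨h1, h2⟩, h3⟩ := hc
    have h4 := hcell c h1 h2 h3
    rw [mem_iff_lt_diag_cont] at h1 h2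
    rw [Finset.mem_filter, mem_residues]
    exact ⟨⟨cont c, (residue_eq k c).symm, by omega⟩,
      ⟨cont c, (residue_eq k c).symm, by omega, h4⟩⟩
  · intro c hc d hd he
    simp only [Finset.mem_filter, Finset.mem_sdiff, YoungDiagram.mem_cells] at hc hd
    obtain ⟨⟨h1, h2⟩, h3⟩ := hc
    obtain ⟨⟨h1', h2'⟩, h3'⟩ := hd
    rw [residue_eq, residue_eq, intCast_eq_iff] at he
    obtain ⟨t, ht⟩ := he
    have e1 := hcell c h1 h2 h3
    have e2 := hcell d h1' h2' h3'
    rw [ht, show cont c + (k + 1) * t + 1 = cont c + 1 + (k + 1) * t by ring, hβ.quasi.add_mul] at e2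
    obtain rfl : t = 0 := by omega
    exact h.eq_of_cont_eq h1 h2 h1' h2' (by rw [ht]; ring)
  · intro i hi
    rw [Finset.mem_filter] at hi
    obtain ⟨-, x, rfl, h1, h2⟩ := hi
    obtain ⟨c, hc1, hc2⟩ := exists_cell β x
    refine ⟨c, ?_, by rw [residue_eq, hc2]⟩
    simp only [Finset.mem_filter, Finset.mem_sdiff, YoungDiagram.mem_cells, mem_iff_lt_diag_cont,
      hc1, hc2]
    refine ⟨by omega, ?_⟩
    rw [hβ.bead_iff, show x - (k : ℤ) = x + 1 - (k + 1) by ring, hβ.quasi.sub]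
    omega

/-! ### Row transitions -/

/-- The local rule of a row transition: the carried value `a` meets the value `b`; the value `a'`
is left behind and `b'` is carried on. -/
def Site (p : Prop) (a b a' b' : ℤ) : Prop :=
  (¬ p → a' = a ∧ b' = b) ∧ (p → a ≠ b ∧ a' = min a b ∧ b' = max a b)

/-- The row transition from `f` to `g` along the set of residues `A`, with carried values `c`. -/
structure IsRow (k : ℕ) (A : Finset (ZMod (k + 1))) (f g c : ℤ → ℤ) : Prop where
  quasi : Quasi k c
  site : ∀ x : ℤ, Site ((x : ZMod (k + 1)) ∈ A) (c x) (f (x + 1)) (g x) (c (x + 1))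

/-- There is a row transition from `f` to `g` along `A`. -/
def Step (k : ℕ) (A : Finset (ZMod (k + 1))) (f g : ℤ → ℤ) : Prop := ∃ c, IsRow k A f g c

/-- The carried value at `x` is the last level at which a bead of `β` sits, or a moving bead
arrives, in the class of `x`. Levels crossed from `x` to `x + 1` are those above `g x` up to the
carried value. By `hlow` the crossing includes the lowest free level of the class of `x + 1`, which
forces `g x = f (x + 1)`. Off the strip the carried value is read off from `f`, so induction to the
right can start at `z`. -/
theorem exists_carry {k : ℕ} {γ β : YoungDiagram} {f g : ℤ → ℤ} (hβ : IsCode k β f)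
    (hγ : IsCode k γ g) (h : IsHorizontalStrip γ β) (z : ℤ)
    (hz : (z : ZMod (k + 1)) ∉ residues k γ β)
    (hlow : ∀ i ∈ residues k γ β,
      ∃ x : ℤ, (x : ZMod (k + 1)) = i ∧ diag β x < diag γ x ∧ f (x + 1) = -1) :
    ∃ c, Quasi k c ∧ (∀ x, 0 ≤ c x ↔ bead β x ∨ diag β (x - 1) < diag γ (x - 1)) ∧
      ∀ x : ℤ, ((x : ZMod (k + 1)) ∈ residues k γ β →
          f (x + 1) < c x ∧ g x = f (x + 1) ∧ c (x + 1) = c x) ∧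
        ((x : ZMod (k + 1)) ∉ residues k γ β → c (x + 1) = f (x + 1) ∧ g x = c x) := by
  set U : ℤ → Prop := fun y => bead β y ∨ diag β (y - 1) < diag γ (y - 1) with hU
  have hle := diag_le_iff.1 h.1
  have hU' : ∀ y, (U y ↔ bead γ y ∨ diag β y < diag γ y) := by
    intro y
    have e1 := diag_sub_eq (γ := β) (x := y)
    have e2 := diag_sub_eq (γ := γ) (x := y)
    have e3 := hle y
    have e4 := hle (y - 1)
    have e5 := (isHorizontalStrip_iff.1 h).2 y
    have e6 := diag_anti γ (x := y - 1) (y := y) (by omega)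
    simp only [hU]
    by_cases b1 : bead β y <;> by_cases b2 : bead γ y <;>
      simp only [b1, b2, if_true, if_false, true_or, false_or, true_iff, iff_true] at * <;> omega
  have hex : ∀ y, diag β y < diag γ y → ¬ bead γ y := fun y => h.not_bead
  have hcross : ∀ x c, (∀ t, t ≤ c ↔ U (x + (k + 1) * t)) → ∀ t,
      (diag β (x + (k + 1) * t) < diag γ (x + (k + 1) * t) ↔ t ≤ c ∧ g x < t) := by
    intro x c hc t
    have e := (hc t).trans (hU' _)
    have e2 := hγ.le_iff x t
    have e3 := hex (x + (k + 1) * t)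
    have e4 : g x < t ↔ ¬ bead γ (x + (k + 1) * t) := by rw [← e2, not_le]
    rw [e, e4]
    tauto
  have hno : ∀ x c, (∀ t, t ≤ c ↔ U (x + (k + 1) * t)) → (x : ZMod (k + 1)) ∉ residues k γ β →
      g x = c ∧ ∀ t, t ≤ f (x + 1) ↔ U (x + 1 + (k + 1) * t) := by
    intro x c hc hx
    have hx' : ∀ t : ℤ, ¬ diag β (x + (k + 1) * t) < diag γ (x + (k + 1) * t) := fun t ht =>
      hx (mem_residues.2 ⟨_, intCast_add_mul x t, ht⟩)
    refine ⟨?_, fun t => ?_⟩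
    · apply eq_of_forall_le_iff
      intro t
      rw [hc, hU', hγ.le_iff]
      have := hx' t
      tauto
    · have := hx' t
      simp only [hU]
      rw [show x + 1 + (k + 1) * t - 1 = x + (k + 1) * t by ring, hβ.le_iff]
      tauto
  have hyes : ∀ x c, (∀ t, t ≤ c ↔ U (x + (k + 1) * t)) → (x : ZMod (k + 1)) ∈ residues k γ β →
      f (x + 1) < c ∧ g x = f (x + 1) ∧ ∀ t, t ≤ c ↔ U (x + 1 + (k + 1) * t) := by
    intro x c hc hx
    obtain ⟨y, hy1, hy2, hy3⟩ := hlow _ hx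
    obtain ⟨t0, rfl⟩ := intCast_eq_iff.1 hy1.symm
    rw [show x + (k + 1) * t0 + 1 = x + 1 + (k + 1) * t0 by ring, hβ.quasi.add_mul] at hy3
    rw [hcross x c hc] at hy2
    -- Otherwise the level `f (x + 1)` would be crossed and a bead would move onto a place occupied
    -- in `β`.
    have e1 : f (x + 1) ≤ g x := by
      by_contra! hlt
      have := (hcross x c hc (f (x + 1))).2 ⟨by omega, hlt⟩
      have := h.not_bead_succ this
      rw [show x + (k + 1) * f (x + 1) + 1 = x + 1 + (k + 1) * f (x + 1) by ring,
        ← hβ.le_iff] at this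
      exact this le_rfl
    refine ⟨by omega, by omega, fun t => ?_⟩
    simp only [hU]
    rw [show x + 1 + (k + 1) * t - 1 = x + (k + 1) * t by ring, ← hβ.le_iff, hcross x c hc]
    omega
  have hall : ∀ x, ∃ c, ∀ t, t ≤ c ↔ U (x + (k + 1) * t) := by
    have key : ∀ (z : ℤ), (z : ZMod (k + 1)) ∉ residues k γ β → ∀ m : ℕ,
        ∃ c, ∀ t, t ≤ c ↔ U (z + 1 + m + (k + 1) * t) := by
      intro z hz m
      induction m with
      | zero =>
        refine ⟨f (z + 1), fun t => ?_⟩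
        have := mt (fun ht => mem_residues.2 ⟨z + (k + 1) * t, intCast_add_mul z t, ht⟩) hz
        simp only [hU]
        rw [hβ.le_iff, show z + 1 + ((0 : ℕ) : ℤ) + (k + 1) * t = z + 1 + (k + 1) * t by simp,
          show z + 1 + (k + 1) * t - 1 = z + (k + 1) * t by ring]
        tauto
      | succ m ih =>
        obtain ⟨c, hc⟩ := ih
        have e : z + 1 + ((m + 1 : ℕ) : ℤ) = z + 1 + m + 1 := by push_cast; ring
        rw [e]
        by_cases hm : ((z + 1 + m : ℤ) : ZMod (k + 1)) ∈ residues k γ β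
        · exact ⟨c, (hyes _ _ hc hm).2.2⟩
        · exact ⟨_, (hno _ _ hc hm).2⟩
    intro x
    -- Translating `z` by a multiple of `k + 1` puts a starting point to the left of `x`.
    have h1 := key (z + (k + 1) * (-(|x - z| + 1))) (by rwa [intCast_add_mul])
      (x - (z + (k + 1) * (-(|x - z| + 1)) + 1)).toNat
    rw [Int.toNat_of_nonneg (by nlinarith [neg_abs_le (x - z), abs_nonneg (x - z)])] at h1
    rwa [add_sub_cancel] at h1
  choose c hc using hall
  refine ⟨c, ?_, fun x => ?_, fun x => ⟨fun hx => ?_, fun hx => ?_⟩⟩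
  · intro x
    apply eq_of_forall_le_iff
    intro t
    rw [hc, show x + ((k : ℤ) + 1) + (k + 1) * t = x + (k + 1) * (t + 1) by ring, ← hc]
    omega
  · rw [hc]
    simp [hU]
  · obtain ⟨e1, e2, e3⟩ := hyes x _ (hc x) hx
    refine ⟨e1, e2, ?_⟩
    apply eq_of_forall_le_iff
    intro t
    rw [hc, e3]
  · obtain ⟨e1, e2⟩ := hno x _ (hc x) hx
    refine ⟨?_, e1⟩
    apply eq_of_forall_le_iff
    intro t
    rw [hc, e2]

/-! ### Row transitions and affine set-valued strips -/

/-- The function `f x + x / (k + 1)` is periodic, hence bounded by the sum of its absolute values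
over one period. -/
theorem Quasi.exists_bound {k : ℕ} {f : ℤ → ℤ} (h : Quasi k f) :
    ∃ N : ℕ, (∀ x, (N : ℤ) ≤ x → f x < 0) ∧ ∀ x, x ≤ -(N : ℤ) → 0 ≤ f x := by
  set S : ℕ := ∑ j ∈ Finset.range (k + 1), (f j).natAbs with hS
  have key : ∀ x : ℤ, |f x + x / (k + 1)| ≤ S := by
    intro x
    have h1 := h.add_mul (x % (k + 1)) (x / (k + 1))
    rw [Int.emod_add_mul_ediv] at h1
    have h2 := Int.emod_nonneg x (show ((k : ℤ) + 1) ≠ 0 by omega)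
    have h3 := Int.emod_lt_of_pos x (show 0 < ((k : ℤ) + 1) by omega)
    obtain ⟨j, hj⟩ := Int.eq_ofNat_of_zero_le h2
    have h4 : (f j).natAbs ≤ S := Finset.single_le_sum (f := fun j : ℕ => (f j).natAbs)
      (fun _ _ => Nat.zero_le _) (Finset.mem_range.2 (by omega))
    rw [h1, hj, sub_add_cancel, Int.abs_eq_natAbs]
    omega
  refine ⟨(k + 1) * (S + 1), fun x hx => ?_, fun x hx => ?_⟩
  · have h1 : (S : ℤ) + 1 ≤ x / (k + 1) := by
      rw [Int.le_ediv_iff_mul_le (by omega)]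
      push_cast at hx
      linarith
    have := abs_le.1 (key x)
    omega
  · have h1 : x / (k + 1) ≤ -((S : ℤ) + 1) := by
      rw [← Int.lt_add_one_iff, Int.ediv_lt_iff_lt_mul (by omega)]
      push_cast at hx
      nlinarith
    have := abs_le.1 (key x)
    omega

/-- A cell of content `x` is added by the row transition. -/
def Adds (k : ℕ) (A : Finset (ZMod (k + 1))) (f c : ℤ → ℤ) (x : ℤ) : Prop :=
  (x : ZMod (k + 1)) ∈ A ∧ f (x + 1) < 0 ∧ 0 ≤ c x

instance (k : ℕ) (A : Finset (ZMod (k + 1))) (f c : ℤ → ℤ) (x : ℤ) : Decidable (Adds k A f c x) :=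
  inferInstanceAs (Decidable (_ ∧ _ ∧ _))

section

variable {k : ℕ} {A : Finset (ZMod (k + 1))} {f g c : ℤ → ℤ} {β γ : YoungDiagram}

/-- Conservation of beads at level `0`: a bead present at `x` or arriving from `x - 1` either stays
or goes on to `x + 1`. -/
theorem IsRow.balance (h : IsRow k A f g c) (x : ℤ) :
    (if 0 ≤ f x then 1 else 0) + (if Adds k A f c (x - 1) then 1 else 0) =
      (if 0 ≤ g x then 1 else 0) + (if Adds k A f c x then 1 else 0) := by
  obtain ⟨a1, a2⟩ := h.site (x - 1)
  obtain ⟨b1, b2⟩ := h.site x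
  simp only [Adds]
  by_cases h1 : ((x - 1 : ℤ) : ZMod (k + 1)) ∈ A <;> by_cases h2 : (x : ZMod (k + 1)) ∈ A <;>
    simp only [sub_add_cancel, h1, h2, true_and, false_and, if_false, not_true, not_false_eq_true, forall_const,
      false_implies] at * <;> split_ifs <;> omega

/-- By `balance`, adding one cell on every diagonal with `Adds` changes the diagonals of `β` into a
sequence decreasing by `0` or `1` whose bead positions are those of `g`. -/
theorem IsRow.exists_core (h : IsRow k A f g c) (hβ : IsCode k β f) (hg : Quasi k g) :
    ∃ γ, IsCode k γ g := by
  obtain ⟨N1, hN1, -⟩ := h.quasi.exists_bound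
  obtain ⟨N2, -, hN2⟩ := hβ.quasi.exists_bound
  have hsub : ∀ x, diag β (x - 1) + (if Adds k A f c (x - 1) then 1 else 0) =
      diag β x + (if Adds k A f c x then 1 else 0) + if 0 ≤ g x then 1 else 0 := by
    intro x
    have h1 := h.balance x
    have h2 := diag_sub_eq (γ := β) (x := x)
    simp only [hβ.bead_iff] at h2
    split_ifs at * <;> omega
  have hsub' : ∀ x, diag β x + (if Adds k A f c x then 1 else 0) =
      diag β (x + 1) + (if Adds k A f c (x + 1) then 1 else 0) + if 0 ≤ g (x + 1) then 1 else 0 := by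
    intro x
    have := hsub (x + 1)
    rwa [add_sub_cancel_right] at this
  have hD1 : ∀ x, diag β (x + 1) + (if Adds k A f c (x + 1) then 1 else 0) ≤
      diag β x + (if Adds k A f c x then 1 else 0) := by
    intro x
    rw [hsub' x]
    omega
  have hD2 : ∀ x, diag β x + (if Adds k A f c x then 1 else 0) ≤
      diag β (x + 1) + (if Adds k A f c (x + 1) then 1 else 0) + 1 := by
    intro x
    rw [hsub' x]
    split_ifs <;> omega
  let N := N1 + N2 + 1 + β.rowLen 0 + β.colLen 0
  have hD3 : ∀ x, (N : ℤ) ≤ x → diag β x + (if Adds k A f c x then 1 else 0) = 0 := by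
    intro x hx
    rw [diag_eq_zero (by omega), if_neg]
    rintro ⟨-, -, h3⟩
    have := hN1 x (by omega)
    omega
  have hD4 : ∀ x, x ≤ -(N : ℤ) → ((diag β x + (if Adds k A f c x then 1 else 0) : ℕ) : ℤ) = -x := by
    intro x hx
    rw [if_neg, add_zero, diag_eq_neg (by omega)]
    rintro ⟨-, h3, -⟩
    have := hN2 (x + 1) (by omega)
    omega
  refine ⟨ofDiag _ hD1 hD2 N hD3 hD4, hg, fun x => ?_⟩
  rw [bead, diag_ofDiag, diag_ofDiag, hsub x]
  split_ifs <;> omega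

theorem IsRow.diag_eq (h : IsRow k A f g c) (hβ : IsCode k β f) (hγ : IsCode k γ g) (x : ℤ) :
    diag γ x = diag β x + if Adds k A f c x then 1 else 0 := by
  obtain ⟨N1, hN1, -⟩ := h.quasi.exists_bound
  have := diag_eq_of_sub (γ := γ) (E := fun x => diag β x + if Adds k A f c x then 1 else 0)
    (N1 + β.rowLen 0) ?_ ?_ x
  · split_ifs at * <;> omega
  · intro x hx
    rw [diag_eq_zero (by omega), if_neg]
    · simp
    · rintro ⟨-, -, h3⟩
      have := hN1 x (by omega)
      omega
  · intro x
    have h1 := h.balance x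
    have h2 := diag_sub_eq (γ := β) (x := x)
    simp only [hβ.bead_iff] at h2
    simp only [hγ.bead_iff]
    split_ifs at * <;> omega

theorem IsRow.le (h : IsRow k A f g c) (hβ : IsCode k β f) (hγ : IsCode k γ g) : β ≤ γ :=
  diag_le_iff.2 fun x => by rw [h.diag_eq hβ hγ x]; omega

/-- The cells holding the letters of a row transition from `β` to `γ` along `A`. -/
def letterCells (k : ℕ) (A : Finset (ZMod (k + 1))) (β γ : YoungDiagram) : Finset (ℕ × ℕ) :=
  γ.cells.filter fun c => residue k c ∈ A ∧ (c.1, c.2 + 1) ∉ β ∧ (c.1 + 1, c.2) ∉ γ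

theorem mem_letterCells {d : ℕ × ℕ} : d ∈ letterCells k A β γ ↔
    d ∈ γ ∧ residue k d ∈ A ∧ (d.1, d.2 + 1) ∉ β ∧ (d.1 + 1, d.2) ∉ γ := by
  simp [letterCells]

theorem mem_letterCells_iff_diag {d : ℕ × ℕ} : d ∈ letterCells k A β γ ↔
    ((cont d : ℤ) : ZMod (k + 1)) ∈ A ∧ d.1 < diag γ (cont d) ∧ diag β (cont d + 1) ≤ d.1 ∧
      diag γ (cont d - 1) ≤ d.1 + 1 := by
  rw [mem_letterCells, residue_eq, mem_iff_lt_diag_cont, mem_iff_lt_diag, mem_iff_lt_diag,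
    show ((d.2 + 1 : ℕ) : ℤ) - d.1 = cont d + 1 by simp only [cont]; push_cast; ring,
    show (d.2 : ℤ) - (d.1 + 1 : ℕ) = cont d - 1 by simp only [cont]; push_cast; ring]
  simp only [not_lt]
  tauto

/-- On a diagonal of `A` a letter appears exactly when one of the two sorted values is negative and
the other is not. If the carried value is the nonnegative one, its cell is new; otherwise it was
already a corner of `β`. -/
theorem IsRow.mem_letterCells_iff (h : IsRow k A f g c) (hβ : IsCode k β f) (hγ : IsCode k γ g)
    {d : ℕ × ℕ} : d ∈ letterCells k A β γ ↔
      ((cont d : ℤ) : ZMod (k + 1)) ∈ A ∧ d.1 + 1 = diag γ (cont d) ∧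
        (0 ≤ c (cont d) ↔ f (cont d + 1) < 0) := by
  rw [mem_letterCells_iff_diag]
  refine and_congr_right fun hA => ?_
  have e1 := h.diag_eq hβ hγ (cont d)
  have e2 := diag_sub_eq (γ := β) (x := cont d + 1)
  have e3 := diag_sub_eq (γ := γ) (x := cont d)
  have e4 := (h.site (cont d)).2 hA
  rw [add_sub_cancel_right] at e2
  simp only [hβ.bead_iff] at e2
  simp only [hγ.bead_iff] at e3
  simp only [Adds, hA, true_and] at e1
  split_ifs at e1 e2 e3 <;> omega

theorem IsRow.exists_mem_letterCells (h : IsRow k A f g c) (hβ : IsCode k β f)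
    (hγ : IsCode k γ g) {x : ℤ} (hx : (x : ZMod (k + 1)) ∈ A) (hc : 0 ≤ c x ↔ f (x + 1) < 0) :
    ∃ d ∈ letterCells k A β γ, cont d = x := by
  have e1 := h.diag_eq hβ hγ x
  have e2 := diag_sub_eq (γ := β) (x := x + 1)
  have e3 := diag_sub_eq (γ := γ) (x := x)
  have e4 := (h.site x).2 hx
  have e5 := neg_le_diag γ (x - 1)
  rw [add_sub_cancel_right] at e2
  simp only [hβ.bead_iff] at e2
  simp only [hγ.bead_iff] at e3
  simp only [Adds, hx, true_and] at e1
  have e6 : 1 ≤ diag γ x ∧ -x + 1 ≤ diag γ x := by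
    split_ifs at e1 e2 e3 <;> omega
  have e7 : cont (diag γ x - 1, (diag γ x - 1 + x).toNat) = x := by
    simp only [cont]
    omega
  refine ⟨(diag γ x - 1, (diag γ x - 1 + x).toNat), ?_, e7⟩
  rw [h.mem_letterCells_iff hβ hγ, e7]
  exact ⟨hx, by dsimp only; omega, hc⟩

theorem IsRow.mem_letterCells_of_mem_of_notMem (h : IsRow k A f g c) (hβ : IsCode k β f)
    (hγ : IsCode k γ g) {d : ℕ × ℕ} (hd : d ∈ γ) (hd' : d ∉ β) : d ∈ letterCells k A β γ := by
  rw [mem_iff_lt_diag_cont] at hd hd'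
  have e1 := h.diag_eq hβ hγ (cont d)
  split_ifs at e1 with h1
  · rw [h.mem_letterCells_iff hβ hγ]
    refine ⟨h1.1, by omega, ?_⟩
    have := h1.2
    omega
  · omega

/-- The part of `β` without the letters of a row transition. -/
def withoutLetters (k : ℕ) (A : Finset (ZMod (k + 1))) {β γ : YoungDiagram} (hle : β ≤ γ) :
    YoungDiagram where
  cells := β.cells \ letterCells k A β γ
  isLowerSet := by
    rintro ⟨i, j⟩ ⟨i', j'⟩ ⟨hi, hj⟩ h
    simp only [Finset.coe_sdiff, Set.mem_sdiff, Finset.mem_coe, YoungDiagram.mem_cells] at h ⊢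
    simp only at hi hj
    refine ⟨β.up_left_mem hi hj h.1, fun h1 => ?_⟩
    have h2 := mem_letterCells.1 h1
    rcases hj.eq_or_lt with rfl | hj
    · rcases hi.eq_or_lt with rfl | hi
      · exact h.2 h1
      · exact h2.2.2.2 (hle (β.up_left_mem (show i' + 1 ≤ i from hi) le_rfl h.1))
    · exact h2.2.2.1 (β.up_left_mem hi (show j' + 1 ≤ j from hj) h.1)

theorem mem_withoutLetters {hle : β ≤ γ} {d : ℕ × ℕ} :
    d ∈ withoutLetters k A hle ↔ d ∈ β ∧ d ∉ letterCells k A β γ := by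
  rw [← YoungDiagram.mem_cells]
  simp [withoutLetters]

theorem IsRow.lt_iff_of_residue (h : IsRow k A f g c) (hf : Quasi k f) {x y : ℤ}
    (hxy : (x : ZMod (k + 1)) = (y : ZMod (k + 1))) : f (x + 1) < c x ↔ f (y + 1) < c y := by
  obtain ⟨t, rfl⟩ := intCast_eq_iff.1 hxy
  rw [show x + (k + 1) * t + 1 = x + 1 + (k + 1) * t by ring, hf.add_mul, h.quasi.add_mul]
  omega

theorem IsRow.mem_residues_iff (h : IsRow k A f g c) (hβ : IsCode k β f) (hγ : IsCode k γ g)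
    (x : ℤ) : (x : ZMod (k + 1)) ∈ residues k γ β ↔ (x : ZMod (k + 1)) ∈ A ∧ f (x + 1) < c x := by
  rw [mem_residues]
  constructor
  · rintro ⟨y, hy, h1⟩
    rw [h.diag_eq hβ hγ] at h1
    split_ifs at h1 with h2
    · rw [h.lt_iff_of_residue hβ.quasi hy.symm, ← hy]
      exact ⟨h2.1, by have := h2.2; omega⟩
    · omega
  · rintro ⟨h1, h2⟩
    refine ⟨x + (k + 1) * (f (x + 1) + 1), intCast_add_mul _ _, ?_⟩
    rw [h.diag_eq hβ hγ, if_pos]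
    · omega
    · refine ⟨by rwa [intCast_add_mul], ?_, ?_⟩
      · rw [show x + (k + 1) * (f (x + 1) + 1) + 1 = x + 1 + (k + 1) * (f (x + 1) + 1) by ring,
          hβ.quasi.add_mul]
        omega
      · rw [h.quasi.add_mul]
        omega

theorem intCast_val {k : ℕ} (i : ZMod (k + 1)) : ((i.val : ℤ) : ZMod (k + 1)) = i := by
  simp

/-- In every residue of the strip the cell at the lowest free level is added, so all residues are
counted by `boundedSize_of_strip_code`. -/
theorem IsRow.boundedSize_eq (h : IsRow k A f g c) (hβ : IsCode k β f) (hγ : IsCode k γ g)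
    (hs : IsHorizontalStrip γ β) :
    boundedSize k γ = boundedSize k β + (residues k γ β).card := by
  classical
  rw [boundedSize_of_strip_code hs hγ.isCore hβ, Finset.filter_true_of_mem]
  intro i hi
  rw [← intCast_val i, h.mem_residues_iff hβ hγ] at hi
  refine ⟨i.val + (k + 1) * (f (i.val + 1) + 1), by rw [intCast_add_mul, intCast_val], ?_⟩
  have e : f (i.val + (k + 1) * (f (i.val + 1) + 1) + 1) = -1 := by
    rw [show (i.val : ℤ) + (k + 1) * (f (i.val + 1) + 1) + 1 =
      i.val + 1 + (k + 1) * (f (i.val + 1) + 1) by ring, hβ.quasi.add_mul]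
    omega
  refine ⟨?_, e⟩
  rw [h.diag_eq hβ hγ, if_pos]
  · omega
  · refine ⟨by rw [intCast_add_mul]; exact hi.1, by omega, ?_⟩
    rw [h.quasi.add_mul]
    omega

/-- A letter cell has no cell of `γ` above it, so two letter cells never share a column. -/
theorem IsRow.isHorizontalStrip (h : IsRow k A f g c) (hβ : IsCode k β f) (hγ : IsCode k γ g)
    {ρ : YoungDiagram} (hρ : ρ ≤ γ) (hρ' : ∀ d, d ∈ β → d ∉ ρ → d ∈ letterCells k A β γ) :
    IsHorizontalStrip γ ρ := by
  refine ⟨hρ, ?_⟩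
  have key : ∀ d, d ∈ γ → d ∉ ρ → d ∈ letterCells k A β γ := by
    intro d h1 h2
    by_cases h3 : d ∈ β
    · exact hρ' d h3 h2
    · exact h.mem_letterCells_of_mem_of_notMem hβ hγ h1 h3
  rintro ⟨i, j⟩ ⟨i', j'⟩ c1 c2 d1 d2 he
  obtain rfl : j = j' := he
  rcases lt_trichotomy i i' with hi | rfl | hi
  · exact absurd (γ.up_left_mem (show i + 1 ≤ i' from hi) le_rfl d1)
      (mem_letterCells.1 (key _ c1 c2)).2.2.2
  · rfl
  · exact absurd (γ.up_left_mem (show i' + 1 ≤ i from hi) le_rfl c1)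
      (mem_letterCells.1 (key _ d1 d2)).2.2.2

/-- The partition `ρ` is `β` without its letters. At a site of `A` the values differ: a larger
carried value puts the residue in `γ / β`, a smaller one puts it in `β / ρ`, so the two residue sets
partition `A`. -/
theorem IsRow.exists_isAffineSVStrip (h : IsRow k A f g c) (hβ : IsCode k β f)
    (hγ : IsCode k γ g) :
    ∃ ρ, IsAffineSVStrip k A.card γ β ρ ∧ residues k γ β ∪ residues k β ρ = A := by
  have hle := h.le hβ hγ
  refine ⟨withoutLetters k A hle, ?_⟩
  set ρ := withoutLetters k A hle with hρ
  have hmem : ∀ d, d ∈ ρ ↔ d ∈ β ∧ d ∉ letterCells k A β γ := fun d => mem_withoutLetters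
  have hρβ : ρ ≤ β := fun d hd => ((hmem d).1 hd).1
  have hres2 : ∀ x : ℤ, (x : ZMod (k + 1)) ∈ residues k β ρ ↔
      (x : ZMod (k + 1)) ∈ A ∧ c x < f (x + 1) := by
    intro x
    have hne : (x : ZMod (k + 1)) ∈ A → c x ≠ f (x + 1) := fun hx => ((h.site x).2 hx).1
    simp only [residues, Finset.mem_image, Finset.mem_sdiff, YoungDiagram.mem_cells]
    constructor
    · rintro ⟨d, ⟨h1, h2⟩, h3⟩
      have h4 : d ∈ letterCells k A β γ := by
        by_contra h4
        exact h2 ((hmem d).2 ⟨h1, h4⟩)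
      rw [h.mem_letterCells_iff hβ hγ] at h4
      rw [residue_eq] at h3
      rw [mem_iff_lt_diag_cont] at h1
      have h5 := h.diag_eq hβ hγ (cont d)
      have h6 := h.lt_iff_of_residue hβ.quasi h3
      have h7 := hne (h3 ▸ h4.1)
      refine ⟨h3 ▸ h4.1, ?_⟩
      split_ifs at h5 with h8
      · omega
      · rw [Adds] at h8
        have := h4.1
        have := h4.2.2
        by_contra h9
        exact h8 ⟨h4.1, by omega, by omega⟩
    · rintro ⟨h1, h2⟩
      -- The last level with a bead of `β`: there `f` is `0` while the smaller carried value is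
      -- negative, so a letter sits on an old corner.
      have e1 : f (x + (k + 1) * f (x + 1) + 1) = 0 := by
        rw [show x + (k + 1) * f (x + 1) + 1 = x + 1 + (k + 1) * f (x + 1) by ring,
          hβ.quasi.add_mul]
        omega
      have e2 : c (x + (k + 1) * f (x + 1)) < 0 := by
        rw [h.quasi.add_mul]
        omega
      obtain ⟨d, hd1, hd2⟩ := h.exists_mem_letterCells hβ hγ (x := x + (k + 1) * f (x + 1))
        (by rwa [intCast_add_mul]) (by omega)
      refine ⟨d, ⟨?_, fun h3 => ((hmem d).1 h3).2 hd1⟩, by rw [residue_eq, hd2, intCast_add_mul]⟩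
      rw [h.mem_letterCells_iff hβ hγ, hd2] at hd1
      have h5 := h.diag_eq hβ hγ (cont d)
      rw [hd2, if_neg (fun h3 => by have := h3.2; omega)] at h5
      rw [mem_iff_lt_diag_cont, hd2]
      omega
  have hunion : residues k γ β ∪ residues k β ρ = A := by
    ext i
    rw [← intCast_val i, Finset.mem_union, hres2, h.mem_residues_iff hβ hγ]
    have hne : ((i.val : ℤ) : ZMod (k + 1)) ∈ A → c i.val ≠ f (i.val + 1) :=
      fun hx => ((h.site _).2 hx).1
    constructor
    · rintro (h1 | h1) <;> exact h1.1
    · intro h1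
      have := hne h1
      rcases lt_or_gt_of_ne this with h2 | h2
      · exact Or.inr ⟨h1, h2⟩
      · exact Or.inl ⟨h1, h2⟩
  have hdisj : Disjoint (residues k γ β) (residues k β ρ) := by
    rw [Finset.disjoint_left]
    intro i h1 h2
    rw [← intCast_val i] at h1 h2
    rw [hres2] at h2
    rw [h.mem_residues_iff hβ hγ] at h1
    have := h1.2
    have := h2.2
    omega
  have hs : IsHorizontalStrip γ β := h.isHorizontalStrip hβ hγ hle (fun d h1 h2 => absurd h1 h2)
  refine ⟨⟨?_, ⟨(residues k γ β).card, ?_, hs, hγ.isCore, hβ.isCore, ?_, rfl⟩, hρβ, ?_, ?_⟩, hunion⟩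
  · refine h.isHorizontalStrip hβ hγ (hρβ.trans hle) fun d h1 h2 => ?_
    by_contra h4
    exact h2 ((hmem d).2 ⟨h1, h4⟩)
  · rw [← Finset.card_union_of_disjoint hdisj, hunion]
  · exact h.boundedSize_eq hβ hγ hs
  · intro d h1 h2
    have h3 : d ∈ letterCells k A β γ := by
      by_contra h4
      exact h2 ((hmem d).2 ⟨h1, h4⟩)
    rw [mem_letterCells] at h3
    exact ⟨h1, h3.2.2.1, fun h4 => h3.2.2.2 (hle h4)⟩
  · intro d h1 h2 d' h3 h4 h5 h6
    have h7 : d ∈ letterCells k A β γ := by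
      by_contra h4
      exact h2 ((hmem d).2 ⟨h1, h4⟩)
    rw [mem_letterCells] at h7
    exact ((hmem d').1 h6).2 (mem_letterCells.2 ⟨hle h3.1, by rw [h4]; exact h7.2.1, h3.2.1, h5⟩)

/-- The carry is built from `γ / β` alone. A corner of `β` not blocked by `γ` carries a smaller
value than the bead it meets, so the residues of `β / ρ` are allowed sites at which nothing moves.
The last clause recovers `ρ` from the residues, which makes the correspondence injective. -/
theorem IsAffineSVStrip.step {r : ℕ} {ρ : YoungDiagram} (hr : r ≤ k) (hβ : IsCode k β f)
    (hγ : IsCode k γ g) (h : IsAffineSVStrip k r γ β ρ) :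
    (residues k γ β ∪ residues k β ρ).card = r ∧
      Step k (residues k γ β ∪ residues k β ρ) f g ∧
      ∀ d, d ∈ ρ ↔ d ∈ β ∧ d ∉ letterCells k (residues k γ β ∪ residues k β ρ) β γ := by
  obtain ⟨h1, ⟨t, ht, hs, -, -, hsize, hcard⟩, hρβ, hrem, hblock⟩ := h
  set E := residues k γ β with hE
  set M := residues k β ρ with hM
  have hle := hs.1
  -- The strip has at most `r ≤ k` residues out of `k + 1`.
  obtain ⟨z0, hz0⟩ : ∃ z0, z0 ∉ E := by
    by_contra! hall
    have : E = Finset.univ := Finset.eq_univ_iff_forall.2 hall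
    have hc := congrArg Finset.card this
    rw [Finset.card_univ, ZMod.card] at hc
    omega
  -- The growth of the bounded size counts the residues whose lowest free level is filled; as it
  -- equals the number of all residues, none is missing.
  have hlow : ∀ i ∈ E, ∃ x : ℤ, (x : ZMod (k + 1)) = i ∧ diag β x < diag γ x ∧ f (x + 1) = -1 := by
    classical
    rw [boundedSize_of_strip_code hs hγ.isCore hβ, ← hcard] at hsize
    have := Finset.filter_card_eq (s := E) (by rw [hE]; exact Nat.add_left_cancel hsize)
    exact this
  obtain ⟨c, hcq, hcU, hc⟩ := exists_carry hβ hγ hs z0.val (by rwa [intCast_val]) hlow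
  have hlt : ∀ (x y : ℤ), (x : ZMod (k + 1)) = (y : ZMod (k + 1)) → (c x < f (x + 1) ↔
      c y < f (y + 1)) := by
    intro x y hxy
    obtain ⟨t, rfl⟩ := intCast_eq_iff.1 hxy
    rw [show x + (k + 1) * t + 1 = x + 1 + (k + 1) * t by ring, hβ.quasi.add_mul, hcq.add_mul]
    omega
  have hunb : ∀ d, IsRemovable β d → (d.1 + 1, d.2) ∉ γ → c (cont d) < f (cont d + 1) := by
    rintro d ⟨a1, a2, a3⟩ a4
    rw [mem_iff_lt_diag_cont] at a1
    rw [mem_iff_lt_diag, show ((d.2 + 1 : ℕ) : ℤ) - d.1 = cont d + 1 by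
      simp only [cont]; push_cast; ring] at a2
    rw [mem_iff_lt_diag, show (d.2 : ℤ) - (d.1 + 1 : ℕ) = cont d - 1 by
      simp only [cont]; push_cast; ring] at a3 a4
    have e1 := diag_sub_eq (γ := β) (x := cont d + 1)
    have e2 := diag_sub_eq (γ := β) (x := cont d)
    rw [add_sub_cancel_right] at e1
    have e3 : bead β (cont d + 1) := by
      by_contra e3
      rw [if_neg e3] at e1
      omega
    rw [if_pos e3] at e1
    have e4 : ¬ bead β (cont d) := by
      intro e4
      rw [if_pos e4] at e2
      omega
    rw [if_neg e4] at e2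
    rw [hβ.bead_iff] at e3
    have e5 := mt (hcU (cont d)).1 (by
      rintro (e5 | e5)
      · exact e4 e5
      · omega)
    omega
  have hMlt : ∀ x : ℤ, (x : ZMod (k + 1)) ∈ M → c x < f (x + 1) := by
    intro x hx
    simp only [hM, residues, Finset.mem_image, Finset.mem_sdiff, YoungDiagram.mem_cells] at hx
    obtain ⟨d, ⟨b1, b2⟩, b3⟩ := hx
    rw [residue_eq] at b3
    rw [hlt _ _ b3.symm]
    refine hunb d (hrem d b1 b2) fun b4 => ?_
    have := h1.2 _ _ (hle b1) b2 b4 (fun b5 => b2 (ρ.up_left_mem (Nat.le_succ _) le_rfl b5)) rfl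
    have := congrArg Prod.fst this
    simp at this
  have hEgt : ∀ x : ℤ, (x : ZMod (k + 1)) ∈ E → f (x + 1) < c x := fun x hx => ((hc x).1 hx).1
  have hdisj : Disjoint E M := by
    rw [Finset.disjoint_left]
    intro i a1 a2
    rw [← intCast_val i] at a1 a2
    have := hMlt _ a2
    have := hEgt _ a1
    omega
  refine ⟨by rw [Finset.card_union_of_disjoint hdisj]; omega, ⟨c, hcq, fun x => ?_⟩, fun d => ?_⟩
  · by_cases hxE : (x : ZMod (k + 1)) ∈ E
    · have := (hc x).1 hxE
      exact ⟨fun h => absurd (Finset.mem_union_left _ hxE) h, fun _ => by omega⟩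
    · have a1 := (hc x).2 hxE
      refine ⟨fun _ => by omega, fun h => ?_⟩
      have := hMlt x ((Finset.mem_union.1 h).resolve_left hxE)
      omega
  · constructor
    · intro hd
      refine ⟨hρβ hd, fun hd2 => ?_⟩
      rw [mem_letterCells] at hd2
      obtain ⟨a1, a2, a3, a4⟩ := hd2
      have hremd : IsRemovable β d := ⟨hρβ hd, a3, fun h => a4 (hle h)⟩
      rcases Finset.mem_union.1 a2 with a5 | a5
      · rw [residue_eq] at a5
        have := hEgt _ a5
        have := hunb d hremd a4
        omega
      · simp only [hM, residues, Finset.mem_image, Finset.mem_sdiff, YoungDiagram.mem_cells] at a5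
        obtain ⟨d', ⟨b1, b2⟩, b3⟩ := a5
        exact hblock d' b1 b2 d hremd b3.symm a4 hd
    · rintro ⟨a1, a2⟩
      by_contra a3
      apply a2
      have a4 := hrem d a1 a3
      rw [mem_letterCells]
      refine ⟨hle a1, ?_, a4.2.1, fun b4 => ?_⟩
      · rw [Finset.mem_union]
        right
        exact Finset.mem_image_of_mem _ (by simp [a1, a3])
      · have := h1.2 _ _ (hle a1) a3 b4 (fun b5 => a3 (ρ.up_left_mem (Nat.le_succ _) le_rfl b5)) rfl
        have := congrArg Prod.fst this
        simp at this

end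

/-! ### Transfer operators and the Yang-Baxter equation -/

section Operators

variable (R : Type*) [CommRing R] {α α' α'' : Type*}

/-- The basis vector of a partial value, zero if undefined. -/
noncomputable def optVec (o : Option α) : α →₀ R := o.elim 0 (fun a => Finsupp.single a 1)

/-- The linear extension of a partial map. -/
noncomputable def opOf (φ : α → Option α') : (α →₀ R) →ₗ[R] (α' →₀ R) :=
  Finsupp.linearCombination R fun a => optVec R (φ a)

variable {R}

theorem opOf_single (φ : α → Option α') (a : α) :
    opOf R φ (Finsupp.single a 1) = optVec R (φ a) := by
  simp [opOf]

theorem opOf_optVec (φ : α → Option α') (o : Option α) :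
    opOf R φ (optVec R o) = optVec R (o.bind φ) := by
  cases o with
  | none => simp [optVec]
  | some a => simp [optVec, opOf]

theorem opOf_comp (φ : α → Option α') (ψ : α' → Option α'') :
    opOf R ψ ∘ₗ opOf R φ = opOf R fun a => (φ a).bind ψ := by
  refine Finsupp.lhom_ext' fun a => LinearMap.ext_ring ?_
  simp [opOf_single, opOf_optVec]

/-- Sorting of a pair of distinct integers. -/
def sort2 (p : ℤ × ℤ) : Option (ℤ × ℤ) :=
  if p.1 = p.2 then none else some (min p.1 p.2, max p.1 p.2)

/-- Sorting of the first two entries of a triple. -/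
def sortFst (p : ℤ × ℤ × ℤ) : Option (ℤ × ℤ × ℤ) :=
  if p.1 = p.2.1 then none else some (min p.1 p.2.1, max p.1 p.2.1, p.2.2)

/-- Sorting of the last two entries of a triple. -/
def sortLst (p : ℤ × ℤ × ℤ) : Option (ℤ × ℤ × ℤ) :=
  if p.2.1 = p.2.2 then none else some (p.1, min p.2.1 p.2.2, max p.2.1 p.2.2)

/-- Appending a last entry. -/
def insertLst (φ : ℤ) (p : ℤ × ℤ) : Option (ℤ × ℤ × ℤ) := some (p.1, p.2, φ)

/-- Removal of a prescribed first entry. -/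
def removeFst (γ : ℤ) (p : ℤ × ℤ × ℤ) : Option (ℤ × ℤ) := if p.1 = γ then some p.2 else none

theorem sortFst_idem (p : ℤ × ℤ × ℤ) : (sortFst p).bind sortFst = sortFst p := by
  obtain ⟨a, b, c⟩ := p
  rcases lt_trichotomy a b with h | h | h
  · simp [sortFst, h.ne, h.le]
  · simp [sortFst, h]
  · simp [sortFst, h.ne, h.ne', h.le]

theorem sortLst_idem (p : ℤ × ℤ × ℤ) : (sortLst p).bind sortLst = sortLst p := by
  obtain ⟨a, b, c⟩ := p
  rcases lt_trichotomy b c with h | h | h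
  · simp [sortLst, h.ne, h.le]
  · simp [sortLst, h]
  · simp [sortLst, h.ne, h.ne', h.le]

/-- Either product sorts three distinct entries completely, and is undefined as soon as two entries
agree. -/
theorem sort_braid (p : ℤ × ℤ × ℤ) :
    ((sortFst p).bind sortLst).bind sortFst = ((sortLst p).bind sortFst).bind sortLst := by
  obtain ⟨a, b, c⟩ := p
  rcases lt_trichotomy a b with h1 | h1 | h1 <;> rcases lt_trichotomy b c with h2 | h2 | h2 <;>
    rcases lt_trichotomy a c with h3 | h3 | h3 <;> first
    | omega
    | (subst h1; subst h2; simp [sortFst, sortLst])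
    | (subst h1; simp [sortFst, sortLst, h2.ne, h2.ne', h2.le])
    | (subst h2; simp [sortFst, sortLst, h1.ne, h1.ne', h1.le])
    | (subst h3; simp [sortFst, sortLst, h1.ne, h1.ne', h1.le])
    | simp [sortFst, sortLst, h1.ne, h1.ne', h1.le, h2.ne, h2.ne', h2.le, h3.ne, h3.ne', h3.le]

/-- By the 0-Hecke relations both sides reduce to the words `1`, `s`, `t`, `s * t`, `t * s` and the
braid word, whose coefficients agree. -/
theorem yang_baxter {M : Type*} [AddCommGroup M] [Module R M] (x y : R) (s t : Module.End R M)
    (hs : s * s = s)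
    (ht : t * t = t) (hst : s * t * s = t * s * t) :
    (1 + x • s) * (1 + y • t) * ((1 + x) • 1 + (y - x) • s) =
      ((1 + x) • 1 + (y - x) • t) * ((1 + y • s) * (1 + x • t)) := by
  simp only [mul_add, add_mul, one_mul, mul_one, smul_mul_assoc, mul_smul_comm, ← mul_assoc, hs, ht,
    hst]
  have e1 : s * t * t = s * t := by rw [mul_assoc, ht]
  module

/-- The exchange operator on pairs of carried values. -/
noncomputable def exch (x y : R) : (ℤ × ℤ →₀ R) →ₗ[R] (ℤ × ℤ →₀ R) :=
  (1 + x) • LinearMap.id + (y - x) • opOf R sort2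

/-- The local transfer operator of two consecutive rows; the upper row has weight `y`. -/
noncomputable def transfer (x y : R) (φ γ : ℤ) : (ℤ × ℤ →₀ R) →ₗ[R] (ℤ × ℤ →₀ R) :=
  opOf R (removeFst γ) ∘ₗ
    ((1 + x • opOf R sortFst : Module.End R (ℤ × ℤ × ℤ →₀ R)) * (1 + y • opOf R sortLst)) ∘ₗ
    opOf R (insertLst φ)

/-- A pair occupies the first two places after a value is appended and the last two places before
one is removed. This turns the exchange of carried values into the outer factors of the Yang-Baxter
equation on triples. -/
theorem insertLst_comp_exch (x y : R) (φ : ℤ) : opOf R (insertLst φ) ∘ₗ exch x y =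
    ((1 + x) • 1 + (y - x) • opOf R sortFst : Module.End R (ℤ × ℤ × ℤ →₀ R)) ∘ₗ
      opOf R (insertLst φ) := by
  have e : opOf R (insertLst φ) ∘ₗ opOf R sort2 = opOf R sortFst ∘ₗ opOf R (insertLst φ) := by
    rw [opOf_comp, opOf_comp]
    congr 1
    funext ⟨a, b⟩
    simp only [sort2, insertLst, sortFst, Option.bind_some]
    split_ifs <;> rfl
  rw [exch, LinearMap.comp_add, LinearMap.comp_smul, LinearMap.comp_smul, LinearMap.add_comp,
    LinearMap.smul_comp, LinearMap.smul_comp, e, LinearMap.comp_id, Module.End.one_eq_id,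
    LinearMap.id_comp]

theorem exch_comp_removeFst (x y : R) (γ : ℤ) : exch x y ∘ₗ opOf R (removeFst γ) =
    opOf R (removeFst γ) ∘ₗ
      ((1 + x) • 1 + (y - x) • opOf R sortLst : Module.End R (ℤ × ℤ × ℤ →₀ R)) := by
  have e : opOf R sort2 ∘ₗ opOf R (removeFst γ) = opOf R (removeFst γ) ∘ₗ opOf R sortLst := by
    rw [opOf_comp, opOf_comp]
    congr 1
    funext ⟨a, b, c⟩
    by_cases h1 : a = γ <;> by_cases h2 : b = c <;> simp [sort2, removeFst, sortLst, h1, h2]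
  rw [exch, LinearMap.add_comp, LinearMap.smul_comp, LinearMap.smul_comp, LinearMap.comp_add,
    LinearMap.comp_smul, LinearMap.comp_smul, e, LinearMap.id_comp, Module.End.one_eq_id,
    LinearMap.comp_id]

theorem yang_baxter_sort (x y : R) :
    (1 + x • opOf R sortFst) * (1 + y • opOf R sortLst) * ((1 + x) • 1 + (y - x) • opOf R sortFst) =
      (((1 + x) • 1 + (y - x) • opOf R sortLst) *
        ((1 + y • opOf R sortFst) * (1 + x • opOf R sortLst)) :
          Module.End R (ℤ × ℤ × ℤ →₀ R)) := by
  apply yang_baxter x y (opOf R sortFst : Module.End R (ℤ × ℤ × ℤ →₀ R)) (opOf R sortLst)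
  · rw [Module.End.mul_eq_comp, opOf_comp]
    exact congrArg _ (funext sortFst_idem)
  · rw [Module.End.mul_eq_comp, opOf_comp]
    exact congrArg _ (funext sortLst_idem)
  · rw [Module.End.mul_eq_comp, Module.End.mul_eq_comp, Module.End.mul_eq_comp,
      Module.End.mul_eq_comp, opOf_comp, opOf_comp, LinearMap.comp_assoc,
      opOf_comp, opOf_comp]
    refine congrArg _ (funext fun p => ?_)
    have := sort_braid p
    rwa [Option.bind_assoc] at this

theorem transfer_exch (x y : R) (φ γ : ℤ) :
    transfer x y φ γ ∘ₗ exch x y = exch x y ∘ₗ transfer y x φ γ := by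
  refine LinearMap.ext fun v => ?_
  have h1 := LinearMap.congr_fun (insertLst_comp_exch x y φ) v
  have h2 := LinearMap.congr_fun (exch_comp_removeFst x y γ)
  have h3 := LinearMap.congr_fun (yang_baxter_sort x y) (opOf R (insertLst φ) v)
  simp only [LinearMap.comp_apply] at h1 h2
  simp only [transfer, LinearMap.comp_apply]
  rw [h1, h2]
  exact congrArg _ h3

/-- The transfer operator of two rows over `m` consecutive sites. -/
noncomputable def transferPow (x y : R) (F G : ℕ → ℤ) : ℕ → (ℤ × ℤ →₀ R) →ₗ[R] (ℤ × ℤ →₀ R)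
  | 0 => LinearMap.id
  | m + 1 => transfer x y (F m) (G m) ∘ₗ transferPow x y F G m

/-- The exchange operator is pulled through the sites one at a time, swapping the weights of the two
rows. -/
theorem transferPow_exch (x y : R) (F G : ℕ → ℤ) (m : ℕ) :
    transferPow x y F G m ∘ₗ exch x y = exch x y ∘ₗ transferPow y x F G m := by
  induction m with
  | zero => rfl
  | succ m ih =>
    rw [transferPow, transferPow, LinearMap.comp_assoc, ih, ← LinearMap.comp_assoc, transfer_exch,
      LinearMap.comp_assoc]

theorem opOf_sort2_apply (v : ℤ × ℤ →₀ R) (a b : ℤ) :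
    opOf R sort2 v (a, b) = if a < b then v (a, b) + v (b, a) else 0 := by
  induction v using Finsupp.induction_linear with
  | zero => simp
  | add v w hv hw =>
    rw [map_add, Finsupp.add_apply, hv, hw]
    split_ifs
    · simp only [Finsupp.add_apply]; ring
    · simp
  | single p c =>
    obtain ⟨d, e⟩ := p
    rw [← mul_one c, ← smul_eq_mul, ← Finsupp.smul_single, map_smul, opOf_single]
    simp only [Finsupp.smul_apply, sort2, smul_eq_mul]
    rcases lt_trichotomy d e with h | h | h
    · rw [if_neg h.ne]
      simp only [optVec, Option.elim, min_eq_left h.le, max_eq_right h.le, Finsupp.single_apply,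
        Prod.mk.injEq]
      split_ifs <;> first | omega | simp
    · simp only [h, if_true, optVec, Option.elim, Finsupp.single_apply, Finsupp.zero_apply,
        Prod.mk.injEq]
      split_ifs <;> first | omega | simp
    · rw [if_neg h.ne']
      simp only [optVec, Option.elim, min_eq_right h.le, max_eq_left h.le, Finsupp.single_apply,
        Prod.mk.injEq]
      split_ifs <;> first | omega | simp

end Operators

/-! ### Traces of the two-row transfer operator -/

section Trace

variable {R : Type*} [CommRing R] [IsDomain R]

/-- The diagonal matrix entry, shifted by one, of the transfer operator. -/
noncomputable def traceTerm (x y : R) (F G : ℕ → ℤ) (m : ℕ) (c : ℤ × ℤ) : R :=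
  transferPow x y F G m (Finsupp.single c 1) (c.1 - 1, c.2 - 1)

/-- The exchange operator preserves the span of a pair and its swap, where it is triangular with
diagonal entries `1 + x` and `1 + y` when the entries differ. On the corresponding `2 × 2` blocks
the intertwining relation is a conjugation up to this determinant, so the traces of the blocks
agree. -/
theorem traceTerm_add_swap (x y : R) (hx : 1 + x ≠ 0) (hy : 1 + y ≠ 0) (F G : ℕ → ℤ) (m : ℕ)
    (c : ℤ × ℤ) :
    traceTerm x y F G m c + traceTerm x y F G m c.swap =
      traceTerm y x F G m c + traceTerm y x F G m c.swap := by
  have key : ∀ p q : ℤ × ℤ,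
      (1 + x) * transferPow x y F G m (Finsupp.single p 1) q +
        (y - x) * transferPow x y F G m (optVec R (sort2 p)) q =
      (1 + x) * transferPow y x F G m (Finsupp.single p 1) q +
        (y - x) * opOf R sort2 (transferPow y x F G m (Finsupp.single p 1)) q := by
    intro p q
    have h := LinearMap.congr_fun (transferPow_exch x y F G m) (Finsupp.single p 1)
    simp only [LinearMap.comp_apply, exch, LinearMap.add_apply, LinearMap.smul_apply,
      LinearMap.id_apply, map_add, map_smul, opOf_single] at h
    have h2 := DFunLike.congr_fun h q
    simpa only [Finsupp.add_apply, Finsupp.smul_apply, smul_eq_mul] using h2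
  have main : ∀ a b : ℤ, b < a → traceTerm x y F G m (a, b) + traceTerm x y F G m (b, a) =
      traceTerm y x F G m (a, b) + traceTerm y x F G m (b, a) := by
    intro a b hab
    have k1 := key (a, b) (a - 1, b - 1)
    have k2 := key (b, a) (b - 1, a - 1)
    have k3 := key (b, a) (a - 1, b - 1)
    rw [opOf_sort2_apply] at k1 k2 k3
    simp only [sort2, hab.ne, hab.ne', if_false, min_eq_left hab.le, min_eq_right hab.le,
      max_eq_left hab.le, max_eq_right hab.le, optVec, Option.elim] at k1 k2 k3
    rw [if_neg (by omega)] at k1 k3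
    rw [if_pos (by omega)] at k2
    simp only [traceTerm]
    apply mul_left_cancel₀ (mul_ne_zero hx hy)
    -- The factor is the determinant of the exchange block; the combination eliminates the entries
    -- off the diagonal.
    linear_combination (1 + y) * k1 + (1 + x) * k2 - (y - x) * k3
  obtain ⟨a, b⟩ := c
  rcases lt_trichotomy a b with h | rfl | h
  · rw [Prod.swap_prod_mk, add_comm, main b a h, add_comm]
  · have k1 := key (a, a) (a - 1, a - 1)
    rw [opOf_sort2_apply, if_neg (lt_irrefl _)] at k1
    simp only [sort2, if_true, optVec, Option.elim, map_zero, Finsupp.zero_apply, mul_zero,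
      add_zero] at k1
    have := mul_left_cancel₀ hx k1
    simp only [Prod.swap_prod_mk, traceTerm, this]
  · exact main a b h

/-- Doubling the sum pairs each term with its swap; only these paired sums are known to be
symmetric. -/
theorem sum_traceTerm_comm (x y : R) (hx : 1 + x ≠ 0) (hy : 1 + y ≠ 0) (h2 : (2 : R) ≠ 0)
    (F G : ℕ → ℤ) (m : ℕ) (Ω : Finset (ℤ × ℤ)) (hΩ : ∀ c ∈ Ω, c.swap ∈ Ω) :
    ∑ c ∈ Ω, traceTerm x y F G m c = ∑ c ∈ Ω, traceTerm y x F G m c := by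
  have hsw : ∀ u : ℤ × ℤ → R, ∑ c ∈ Ω, u c.swap = ∑ c ∈ Ω, u c := by
    intro u
    refine Finset.sum_bij' (fun c _ => c.swap) (fun c _ => c.swap) hΩ hΩ ?_ ?_ ?_ <;> simp
  apply mul_left_cancel₀ h2
  rw [two_mul, two_mul]
  nth_rewrite 2 [← hsw]
  nth_rewrite 4 [← hsw]
  rw [← Finset.sum_add_distrib, ← Finset.sum_add_distrib]
  exact Finset.sum_congr rfl fun c _ => traceTerm_add_swap x y hx hy F G m c

end Trace

/-! ### Expansion of the transfer operator over sets of sites -/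

section Expansion

/-- One site of two consecutive row transitions. -/
def localStep (p q : Prop) [Decidable p] [Decidable q] (φ γ : ℤ) (d : ℤ × ℤ) : Option (ℤ × ℤ) :=
  (((insertLst φ d).bind (if p then sortLst else some)).bind (if q then sortFst else some)).bind
    (removeFst γ)

theorem ite_sortLst_eq_some {p : Prop} [Decidable p] {d t : ℤ × ℤ × ℤ} :
    (if p then sortLst else some) d = some t ↔ t.1 = d.1 ∧ Site p d.2.1 d.2.2 t.2.1 t.2.2 := by
  obtain ⟨a, b, c⟩ := d
  obtain ⟨a', b', c'⟩ := t
  by_cases hp : p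
  · by_cases h : b = c
    · simp [sortLst, Site, hp, h]
    · simp [sortLst, Site, hp, h, eq_comm]
  · simp [Site, hp, eq_comm]

theorem ite_sortFst_eq_some {p : Prop} [Decidable p] {d t : ℤ × ℤ × ℤ} :
    (if p then sortFst else some) d = some t ↔ t.2.2 = d.2.2 ∧ Site p d.1 d.2.1 t.1 t.2.1 := by
  obtain ⟨a, b, c⟩ := d
  obtain ⟨a', b', c'⟩ := t
  by_cases hp : p
  · by_cases h : a = b
    · simp [sortFst, Site, hp, h]
    · simp [sortFst, Site, hp, h, eq_comm]
      tauto
  · simp [Site, hp, eq_comm]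
    tauto

theorem localStep_eq_some {p q : Prop} [Decidable p] [Decidable q] {φ γ : ℤ} {d e : ℤ × ℤ} :
    localStep p q φ γ d = some e ↔ ∃ h, Site p d.2 φ h e.2 ∧ Site q d.1 h γ e.1 := by
  have hr : ∀ t : ℤ × ℤ × ℤ, removeFst γ t = some e ↔ t.1 = γ ∧ t.2 = e := by
    rintro ⟨a, b⟩
    by_cases h : a = γ <;> simp [removeFst, h]
  simp only [localStep, insertLst, Option.bind_some, Option.bind_eq_some_iff, ite_sortLst_eq_some,
    ite_sortFst_eq_some, hr]
  constructor
  · rintro ⟨⟨a, b, c⟩, ⟨⟨a', b', c'⟩, ⟨rfl, h1⟩, rfl, h2⟩, rfl, rfl⟩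
    exact ⟨b', h1, h2⟩
  · rintro ⟨h, h1, h2⟩
    exact ⟨(γ, e), ⟨(d.1, h, e.2), ⟨rfl, h1⟩, rfl, h2⟩, rfl, rfl⟩

/-- Transport of a pair of carried values over `m` sites. -/
def run (F G : ℕ → ℤ) (A B : Finset ℕ) : ℕ → ℤ × ℤ → Option (ℤ × ℤ)
  | 0, d => some d
  | m + 1, d => (run F G A B m d).bind (localStep (m ∈ A) (m ∈ B) (F m) (G m))

variable {F G : ℕ → ℤ} {A B A' B' : Finset ℕ}

theorem run_congr {m : ℕ} (hA : ∀ j < m, j ∈ A ↔ j ∈ A') (hB : ∀ j < m, j ∈ B ↔ j ∈ B')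
    (d : ℤ × ℤ) : run F G A B m d = run F G A' B' m d := by
  induction m with
  | zero => rfl
  | succ m ih =>
    rw [run, run, ih (fun j hj => hA j (by omega)) (fun j hj => hB j (by omega))]
    congr 1
    funext e
    simp only [localStep, hA m (by omega), hB m (by omega)]

theorem run_eq_some {m : ℕ} {d e : ℤ × ℤ} : run F G A B m d = some e ↔
    ∃ s : ℕ → ℤ × ℤ, s 0 = d ∧ s m = e ∧
      ∀ j < m, localStep (j ∈ A) (j ∈ B) (F j) (G j) (s j) = some (s (j + 1)) := by
  induction m generalizing e with
  | zero =>
    simp only [run, Option.some.injEq, not_lt_zero, false_imp_iff, implies_true, and_true]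
    exact ⟨fun h => ⟨fun _ => d, rfl, h⟩, fun ⟨s, h1, h2⟩ => h1.symm.trans h2⟩
  | succ m ih =>
    simp only [run, Option.bind_eq_some_iff, ih]
    constructor
    · rintro ⟨e', ⟨s, h1, h2, h3⟩, h4⟩
      refine ⟨fun j => if j ≤ m then s j else e, by simpa using h1, by simp, fun j hj => ?_⟩
      rcases Nat.lt_succ_iff_lt_or_eq.1 hj with h | rfl
      · simpa [h.le, Nat.succ_le_iff.2 h] using h3 j h
      · simpa [h2] using h4
    · rintro ⟨s, h1, h2, h3⟩
      exact ⟨s m, ⟨s, h1, rfl, fun j hj => h3 j (by omega)⟩, by rw [h3 m (by omega), h2]⟩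

variable {R : Type*} [CommRing R]

theorem transfer_optVec (x y : R) (φ γ : ℤ) (o : Option (ℤ × ℤ)) :
    transfer x y φ γ (optVec R o) = optVec R (o.bind (localStep False False φ γ)) +
      y • optVec R (o.bind (localStep True False φ γ)) +
      x • optVec R (o.bind (localStep False True φ γ)) +
      (y * x) • optVec R (o.bind (localStep True True φ γ)) := by
  have e : ∀ p q : Prop, ∀ _ : Decidable p, ∀ _ : Decidable q,
      o.bind (localStep p q φ γ) = (((o.bind (insertLst φ)).bind (if p then sortLst else some)).bind
        (if q then sortFst else some)).bind (removeFst γ) := by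
    intro p q _ _
    cases o <;> rfl
  simp only [transfer, LinearMap.comp_apply, Module.End.mul_apply, LinearMap.add_apply,
    Module.End.one_apply, LinearMap.smul_apply, opOf_optVec, map_add, map_smul, e, if_true,
    if_false, Option.bind_fun_some]
  module

/-- At every site each of the two rows either sorts, contributing its weight, or does nothing; the
sets `A` and `B` record where the rows sort. -/
theorem transferPow_single (x y : R) (F G : ℕ → ℤ) (m : ℕ) (d : ℤ × ℤ) :
    transferPow x y F G m (Finsupp.single d 1) =
      ∑ A ∈ (Finset.range m).powerset, ∑ B ∈ (Finset.range m).powerset,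
        (y ^ A.card * x ^ B.card) • optVec R (run F G A B m d) := by
  induction m with
  | zero => simp only [transferPow, run, optVec, Finset.range_zero, Finset.powerset_empty, Finset.sum_singleton,
      Finset.card_empty, pow_zero, one_mul, one_smul]; rfl
  | succ m ih =>
    rw [transferPow, LinearMap.comp_apply, ih, Finset.range_add_one,
      Finset.sum_powerset_insert Finset.notMem_range_self, map_sum, ← Finset.sum_add_distrib]
    refine Finset.sum_congr rfl fun A hA => ?_
    rw [Finset.sum_powerset_insert Finset.notMem_range_self,
      Finset.sum_powerset_insert Finset.notMem_range_self, map_sum, ← Finset.sum_add_distrib,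
      ← Finset.sum_add_distrib, ← Finset.sum_add_distrib]
    refine Finset.sum_congr rfl fun B hB => ?_
    have hA' : m ∉ A := fun h => Finset.notMem_range_self (Finset.mem_powerset.1 hA h)
    have hB' : m ∉ B := fun h => Finset.notMem_range_self (Finset.mem_powerset.1 hB h)
    have hr : ∀ C D : Finset ℕ, (C = A ∨ C = insert m A) → (D = B ∨ D = insert m B) →
        run F G C D m d = run F G A B m d := by
      rintro C D hC hD
      apply run_congr
      · rintro j hj
        rcases hC with rfl | rfl
        · rfl
        · simp [hj.ne]
      · rintro j hj
        rcases hD with rfl | rfl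
        · rfl
        · simp [hj.ne]
    rw [map_smul, transfer_optVec, run, run, run, run, hr _ _ (.inr rfl) (.inl rfl),
      hr _ _ (.inl rfl) (.inr rfl), hr _ _ (.inr rfl) (.inr rfl),
      Finset.card_insert_of_notMem hA', Finset.card_insert_of_notMem hB']
    simp only [hA', hB', Finset.mem_insert_self]
    module

open Polynomial in
-- With independent polynomial variables as weights, the coefficients of the symmetric trace count
-- the closed runs with prescribed sizes of the two sets. The ring `ℤ[X][X]` is a domain in which
-- `2`, `1 + x` and `1 + y` are nonzero.
theorem card_run_comm (F G : ℕ → ℤ) (m r s : ℕ) (Ω : Finset (ℤ × ℤ))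
    (hΩ : ∀ c ∈ Ω, c.swap ∈ Ω) :
    ((Ω ×ˢ (Finset.range m).powerset ×ˢ (Finset.range m).powerset).filter fun q =>
      (q.2.1.card = r ∧ q.2.2.card = s) ∧
        run F G q.2.1 q.2.2 m q.1 = some (q.1.1 - 1, q.1.2 - 1)).card =
    ((Ω ×ˢ (Finset.range m).powerset ×ˢ (Finset.range m).powerset).filter fun q =>
      (q.2.1.card = s ∧ q.2.2.card = r) ∧
        run F G q.2.1 q.2.2 m q.1 = some (q.1.1 - 1, q.1.2 - 1)).card := by
  have hne : ∀ p : ℤ[X][X], p.coeff 0 ≠ 0 → p ≠ 0 := by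
    rintro p hp rfl
    simp at hp
  have hx : (1 + C X : ℤ[X][X]) ≠ 0 := by
    intro h
    have := congrArg (fun p => (p.coeff 0).coeff 0) h
    simp at this
  have hy : (1 + X : ℤ[X][X]) ≠ 0 := by
    intro h
    have := congrArg (fun p => (p.coeff 0).coeff 0) h
    simp at this
  have h := sum_traceTerm_comm (C X : ℤ[X][X]) X hx hy two_ne_zero F G m Ω hΩ
  have key : ∀ (x y : ℤ[X][X]), ∑ c ∈ Ω, traceTerm x y F G m c =
      ∑ q ∈ Ω ×ˢ (Finset.range m).powerset ×ˢ (Finset.range m).powerset,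
        if run F G q.2.1 q.2.2 m q.1 = some (q.1.1 - 1, q.1.2 - 1) then
          y ^ q.2.1.card * x ^ q.2.2.card else 0 := by
    intro x y
    rw [Finset.sum_product]
    refine Finset.sum_congr rfl fun c _ => ?_
    rw [traceTerm, transferPow_single, Finset.sum_product, Finsupp.finsetSum_apply]
    refine Finset.sum_congr rfl fun A _ => ?_
    rw [Finsupp.finsetSum_apply]
    refine Finset.sum_congr rfl fun B _ => ?_
    rw [Finsupp.smul_apply, smul_eq_mul]
    cases hrun : run F G A B m c with
    | none => simp [optVec]
    | some e =>
      simp only [optVec, Option.elim, Finsupp.single_apply, Option.some.injEq]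
      split_ifs <;> simp
  rw [key, key] at h
  have h' := congrArg (fun p : ℤ[X][X] => (p.coeff r).coeff s) h
  simp only [finsetSum_coeff] at h'
  have e1 : ∀ (P : Prop) [Decidable P] (a b : ℕ),
      ((if P then (X : ℤ[X][X]) ^ a * C X ^ b else 0).coeff r).coeff s =
        if (a = r ∧ b = s) ∧ P then 1 else 0 := by
    intro P _ a b
    by_cases hP : P
    · rw [if_pos hP, ← C_pow, mul_comm, coeff_C_mul_X_pow]
      by_cases h1 : r = a
      · by_cases h2 : s = b
        · simp [h1, h2, hP]
        · simp [h1, h2, coeff_X_pow, Ne.symm h2, hP]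
      · simp [h1, Ne.symm h1]
    · simp [hP]
  have e2 : ∀ (P : Prop) [Decidable P] (a b : ℕ),
      ((if P then (C X : ℤ[X][X]) ^ a * X ^ b else 0).coeff r).coeff s =
        if (a = s ∧ b = r) ∧ P then 1 else 0 := by
    intro P _ a b
    rw [mul_comm, e1]
    simp only [and_comm]
  simp only [e1, e2, Finset.sum_boole] at h'
  exact_mod_cast h'

end Expansion

/-! ### Periodic transport and pairs of row transitions -/

section Link

variable {k : ℕ} {A B : Finset (ZMod (k + 1))} {f g h c cA cB : ℤ → ℤ}

theorem Site.sub {p : Prop} {a b a' b' : ℤ} (h : Site p a b a' b') (q : ℤ) :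
    Site p (a - q) (b - q) (a' - q) (b' - q) := by
  refine ⟨fun hp => ?_, fun hp => ?_⟩
  · have := h.1 hp
    omega
  · have := h.2 hp
    omega

/-- The quasi-periodic extension of a finite sequence. -/
def extend (k : ℕ) (u : ℕ → ℤ) (x : ℤ) : ℤ := u (x % (k + 1)).toNat - x / (k + 1)

theorem extend_quasi (u : ℕ → ℤ) : Quasi k (extend k u) := by
  intro x
  have : ((k : ℤ) + 1) ≠ 0 := by omega
  rw [extend, extend, Int.add_emod_right, Int.add_ediv_of_dvd_right dvd_rfl, Int.ediv_self this]
  ring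

theorem extend_apply (u : ℕ → ℤ) {j : ℕ} (hj : j < k + 1) (q : ℤ) :
    extend k u (j + (k + 1) * q) = u j - q := by
  have h0 : (j : ℤ) / (k + 1) = 0 := Int.ediv_eq_zero_of_lt (by omega) (by omega)
  rw [extend, Int.add_mul_emod_self_left, Int.emod_eq_of_lt (by omega) (by omega),
    Int.toNat_natCast, Int.add_mul_ediv_left _ _ (by omega), h0, zero_add]

theorem extend_apply_succ {u : ℕ → ℤ} (hu : u (k + 1) = u 0 - 1) {j : ℕ} (hj : j < k + 1) (q : ℤ) :
    extend k u (j + (k + 1) * q + 1) = u (j + 1) - q := by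
  rcases Nat.lt_succ_iff_lt_or_eq.1 hj with h | rfl
  · have := extend_apply (k := k) u (show j + 1 < k + 1 by omega) q
    push_cast at this
    rw [← this]
    congr 1
    ring
  · have := extend_apply (k := j) u (show 0 < j + 1 by omega) (q + 1)
    push_cast at this
    rw [hu, show u 0 - 1 - q = u 0 - (q + 1) by ring, ← this]
    congr 1
    ring

theorem exists_eq_add_mul (k : ℕ) (x : ℤ) : ∃ (j : ℕ) (q : ℤ), j < k + 1 ∧ x = j + (k + 1) * q := by
  have h1 := Int.emod_nonneg x (show ((k : ℤ) + 1) ≠ 0 by omega)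
  have h2 := Int.emod_lt_of_pos x (show 0 < ((k : ℤ) + 1) by omega)
  refine ⟨(x % (k + 1)).toNat, x / (k + 1), by omega, ?_⟩
  rw [Int.toNat_of_nonneg h1, Int.emod_add_mul_ediv]

/-- The second row runs one site behind the first, since it needs the value `h` that the first row
leaves; hence the shifts in `g` and `B'` and the pair `(cB (-1), cA 0)`. Returning both carried
values lowered by one after `k + 1` sites is quasi-periodicity of the two carries. -/
theorem run_eq_some_iff_isRow (hf : Quasi k f) (hg : Quasi k g) {A' B' : Finset ℕ}
    (hA : ∀ j < k + 1, j ∈ A' ↔ ((j : ℤ) : ZMod (k + 1)) ∈ A)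
    (hB : ∀ j < k + 1, j ∈ B' ↔ ((j - 1 : ℤ) : ZMod (k + 1)) ∈ B) (c : ℤ × ℤ) :
    run (fun m => f (m + 1)) (fun m => g (m - 1)) A' B' (k + 1) c = some (c.1 - 1, c.2 - 1) ↔
      ∃ h cA cB, IsRow k A f h cA ∧ IsRow k B h g cB ∧ c = (cB (-1), cA 0) := by
  rw [run_eq_some]
  constructor
  · rintro ⟨s, h0, hn, hs⟩
    have hs' : ∀ j : ℕ, ∃ h, j < k + 1 →
        Site (((j : ℤ) : ZMod (k + 1)) ∈ A) (s j).2 (f (j + 1)) h (s (j + 1)).2 ∧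
        Site (((j - 1 : ℤ) : ZMod (k + 1)) ∈ B) (s j).1 h (g (j - 1)) (s (j + 1)).1 := by
      intro j
      by_cases hj : j < k + 1
      · obtain ⟨h, h1, h2⟩ := localStep_eq_some.1 (hs j hj)
        simp only [hA j hj, hB j hj] at h1 h2
        exact ⟨h, fun _ => ⟨h1, h2⟩⟩
      · exact ⟨0, fun h => absurd h hj⟩
    choose h hh using hs'
    have e1 : (fun j => (s j).1) (k + 1) = (fun j => (s j).1) 0 - 1 := by simp [h0, hn]
    have e2 : (fun j => (s j).2) (k + 1) = (fun j => (s j).2) 0 - 1 := by simp [h0, hn]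
    refine ⟨extend k h, extend k fun j => (s j).2, fun y => extend k (fun j => (s j).1) (y + 1),
      ⟨extend_quasi _, fun x => ?_⟩, ⟨fun x => ?_, fun x => ?_⟩, ?_⟩
    · obtain ⟨j, q, hj, rfl⟩ := exists_eq_add_mul k x
      rw [extend_apply _ hj, extend_apply _ hj, extend_apply_succ e2 hj, intCast_add_mul,
        show (j : ℤ) + (k + 1) * q + 1 = j + 1 + (k + 1) * q by ring, hf.add_mul]
      exact (hh j hj).1.sub q
    · rw [← extend_quasi]
      congr 1
      ring
    · obtain ⟨j, q, hj, hx⟩ := exists_eq_add_mul k (x + 1)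
      obtain rfl : x = j - 1 + (k + 1) * q := by linarith
      rw [hx, extend_apply _ hj, extend_apply _ hj, extend_apply_succ e1 hj, intCast_add_mul,
        hg.add_mul]
      exact (hh j hj).2.sub q
    · have a1 := extend_apply (k := k) (fun j => (s j).1) (show 0 < k + 1 by omega) 0
      have a2 := extend_apply (k := k) (fun j => (s j).2) (show 0 < k + 1 by omega) 0
      simp only [Nat.cast_zero, mul_zero, add_zero, sub_zero] at a1 a2
      simp only [neg_add_cancel, a1, a2, h0]
  · rintro ⟨h, cA, cB, rA, rB, rfl⟩
    refine ⟨fun j => (cB (j - 1), cA j), by simp, ?_, fun j hj => ?_⟩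
    · have a1 := rA.quasi 0
      have a2 := rB.quasi (-1)
      simp only [zero_add] at a1
      push_cast
      rw [← a1, ← a2]
      simp only [Prod.mk.injEq, and_true]
      ring_nf
    · rw [localStep_eq_some]
      simp only [hA j hj, hB j hj]
      refine ⟨h j, by simpa using rA.site j, ?_⟩
      have := rB.site (j - 1)
      simpa using this

/-- Along sites of `A` the carried value never decreases, whereas over a full period it drops by
one. -/
theorem IsRow.exists_notMem (h : IsRow k A f g c) : ∃ z : ℤ, (z : ZMod (k + 1)) ∉ A := by
  by_contra! hall
  have hmono : ∀ m : ℕ, c 0 ≤ c m := by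
    intro m
    induction m with
    | zero => simp
    | succ m ih =>
      have := (h.site m).2 (hall m)
      push_cast
      omega
  have h1 := hmono (k + 1)
  have h2 := h.quasi 0
  push_cast at h1
  rw [zero_add] at h2
  omega

theorem IsRow.quasi_target (h : IsRow k A f g c) (hf : Quasi k f) : Quasi k g := by
  intro x
  have e1 := h.site x
  have e2 := h.site (x + (k + 1))
  have e3 := h.quasi x
  have e4 := hf (x + 1)
  have e5 := intCast_add_mul (k := k) x 1
  rw [mul_one] at e5
  rw [e5, show x + ((k : ℤ) + 1) + 1 = x + 1 + (k + 1) by ring] at e2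
  by_cases hx : (x : ZMod (k + 1)) ∈ A
  · have := e1.2 hx
    have := e2.2 hx
    omega
  · have := e1.1 hx
    have := e2.1 hx
    omega

/-- Just after a site outside `A` the carried value is read off from `f`; the local rule then
determines everything to the right, and such sites occur arbitrarily far left. -/
theorem IsRow.unique {g' c' : ℤ → ℤ} (h : IsRow k A f g c) (h' : IsRow k A f g' c') :
    c = c' ∧ g = g' := by
  have hc : c = c' := by
    obtain ⟨z, hz⟩ := h.exists_notMem
    have key : ∀ (z : ℤ), (z : ZMod (k + 1)) ∉ A → ∀ m : ℕ, c (z + 1 + m) = c' (z + 1 + m) := by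
      intro z hz m
      induction m with
      | zero =>
        have := (h.site z).1 hz
        have := (h'.site z).1 hz
        simp only [Nat.cast_zero, add_zero]
        omega
      | succ m ih =>
        have e1 := h.site (z + 1 + m)
        have e2 := h'.site (z + 1 + m)
        rw [ih] at e1
        push_cast
        rw [← add_assoc]
        by_cases hx : ((z + 1 + m : ℤ) : ZMod (k + 1)) ∈ A
        · have := e1.2 hx
          have := e2.2 hx
          omega
        · have := e1.1 hx
          have := e2.1 hx
          omega
    funext x
    have h1 := key (z + (k + 1) * (-(|x - z| + 1))) (by rwa [intCast_add_mul])
      (x - (z + (k + 1) * (-(|x - z| + 1)) + 1)).toNat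
    rw [Int.toNat_of_nonneg (by nlinarith [neg_abs_le (x - z), abs_nonneg (x - z)])] at h1
    rwa [add_sub_cancel] at h1
  subst hc
  refine ⟨rfl, funext fun x => ?_⟩
  have e1 := h.site x
  have e2 := h'.site x
  by_cases hx : (x : ZMod (k + 1)) ∈ A
  · have := e1.2 hx
    have := e2.2 hx
    omega
  · have := e1.1 hx
    have := e2.1 hx
    omega

open Classical in
theorem card_pairs_comm (hf : Quasi k f) (hg : Quasi k g) (r s : ℕ) :
    (Finset.univ.filter fun p : Finset (ZMod (k + 1)) × Finset (ZMod (k + 1)) =>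
      (p.1.card = r ∧ p.2.card = s) ∧ ∃ h, Step k p.1 f h ∧ Step k p.2 h g).card =
    (Finset.univ.filter fun p : Finset (ZMod (k + 1)) × Finset (ZMod (k + 1)) =>
      (p.1.card = s ∧ p.2.card = r) ∧ ∃ h, Step k p.1 f h ∧ Step k p.2 h g).card := by
  set F : ℕ → ℤ := fun m => f (m + 1) with hF
  set G : ℕ → ℤ := fun m => g (m - 1) with hG
  set W : Finset (Finset ℕ) := (Finset.range (k + 1)).powerset with hW
  set a : Finset ℕ → Finset (ZMod (k + 1)) := fun A' => A'.image fun j : ℕ => ((j : ℤ) : ZMod (k + 1))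
    with ha
  set b : Finset ℕ → Finset (ZMod (k + 1)) :=
    fun B' => B'.image fun j : ℕ => ((j - 1 : ℤ) : ZMod (k + 1)) with hb
  have hinj : ∀ i j : ℕ, i < k + 1 → j < k + 1 → ∀ e : ℤ,
      ((i + e : ℤ) : ZMod (k + 1)) = ((j + e : ℤ) : ZMod (k + 1)) → i = j := by
    intro i j hi hj e he
    push_cast at he
    have := (ZMod.natCast_eq_natCast_iff' _ _ _).1 (add_right_cancel he)
    rwa [Nat.mod_eq_of_lt hi, Nat.mod_eq_of_lt hj] at this
  have hW' : ∀ A' ∈ W, ∀ j ∈ A', j < k + 1 := fun A' hA' j hj =>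
    Finset.mem_range.1 (Finset.mem_powerset.1 hA' hj)
  have ha' : ∀ A' ∈ W, ∀ j < k + 1, j ∈ A' ↔ ((j : ℤ) : ZMod (k + 1)) ∈ a A' := by
    intro A' hA' j hj
    rw [ha, Finset.mem_image]
    refine ⟨fun h => ⟨j, h, rfl⟩, ?_⟩
    rintro ⟨i, hi, hij⟩
    rwa [← hinj i j (hW' A' hA' i hi) hj 0 (by simpa using hij)]
  have hb' : ∀ B' ∈ W, ∀ j < k + 1, j ∈ B' ↔ ((j - 1 : ℤ) : ZMod (k + 1)) ∈ b B' := by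
    intro A' hA' j hj
    rw [hb, Finset.mem_image]
    refine ⟨fun h => ⟨j, h, rfl⟩, ?_⟩
    rintro ⟨i, hi, hij⟩
    rwa [← hinj i j (hW' A' hA' i hi) hj (-1) (by simpa using hij)]
  have hac : ∀ A' ∈ W, (a A').card = A'.card := fun A' hA' =>
    Finset.card_image_of_injOn fun i hi j hj hij =>
      hinj i j (hW' A' hA' i hi) (hW' A' hA' j hj) 0 (by simpa using hij)
  have hbc : ∀ B' ∈ W, (b B').card = B'.card := fun A' hA' =>
    Finset.card_image_of_injOn fun i hi j hj hij =>
      hinj i j (hW' A' hA' i hi) (hW' A' hA' j hj) (-1) (by simpa using hij)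
  have key : ∀ A' ∈ W, ∀ B' ∈ W, ∀ c : ℤ × ℤ, run F G A' B' (k + 1) c = some (c.1 - 1, c.2 - 1) ↔
      ∃ h cA cB, IsRow k (a A') f h cA ∧ IsRow k (b B') h g cB ∧ c = (cB (-1), cA 0) :=
    fun A' hA' B' hB' c => run_eq_some_iff_isRow hf hg (ha' A' hA') (hb' B' hB') c
  -- A pair of residue sets admits at most one closed run, so closed runs are counted by the pairs
  -- of sets alone.
  have huniq : ∀ A' ∈ W, ∀ B' ∈ W, ∀ c d : ℤ × ℤ,
      run F G A' B' (k + 1) c = some (c.1 - 1, c.2 - 1) →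
      run F G A' B' (k + 1) d = some (d.1 - 1, d.2 - 1) → c = d := by
    intro A' hA' B' hB' c d hc hd
    obtain ⟨h, cA, cB, r1, r2, rfl⟩ := (key A' hA' B' hB' c).1 hc
    obtain ⟨h', cA', cB', r1', r2', rfl⟩ := (key A' hA' B' hB' d).1 hd
    obtain ⟨rfl, rfl⟩ := r1.unique r1'
    rw [(r2.unique r2').1]
  have hfin : (⋃ A' ∈ W, ⋃ B' ∈ W,
      {c : ℤ × ℤ | run F G A' B' (k + 1) c = some (c.1 - 1, c.2 - 1)}).Finite := by
    refine W.finite_toSet.biUnion fun A' hA' => W.finite_toSet.biUnion fun B' hB' => ?_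
    exact Set.Subsingleton.finite fun c hc d hd => huniq A' hA' B' hB' c d hc hd
  -- A finite set of initial values containing those of all closed runs, enlarged to be stable under
  -- the swap as the trace identity requires.
  set Ω : Finset (ℤ × ℤ) := hfin.toFinset ∪ hfin.toFinset.image Prod.swap with hΩ
  have hmem : ∀ A' ∈ W, ∀ B' ∈ W, ∀ c : ℤ × ℤ,
      run F G A' B' (k + 1) c = some (c.1 - 1, c.2 - 1) → c ∈ Ω := by
    intro A' hA' B' hB' c hc
    refine Finset.mem_union_left _ (hfin.mem_toFinset.2 ?_)
    simp only [Set.mem_iUnion]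
    exact ⟨A', hA', B', hB', hc⟩
  have hswap : ∀ c ∈ Ω, c.swap ∈ Ω := by
    intro c hc
    rcases Finset.mem_union.1 hc with h | h
    · exact Finset.mem_union_right _ (Finset.mem_image_of_mem _ h)
    · obtain ⟨d, hd, rfl⟩ := Finset.mem_image.1 h
      exact Finset.mem_union_left _ (by rwa [Prod.swap_swap])
  have count : ∀ r s, ((Ω ×ˢ W ×ˢ W).filter fun q => (q.2.1.card = r ∧ q.2.2.card = s) ∧
      run F G q.2.1 q.2.2 (k + 1) q.1 = some (q.1.1 - 1, q.1.2 - 1)).card =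
      (Finset.univ.filter fun p : Finset (ZMod (k + 1)) × Finset (ZMod (k + 1)) =>
        (p.1.card = r ∧ p.2.card = s) ∧ ∃ h, Step k p.1 f h ∧ Step k p.2 h g).card := by
    intro r s
    refine Finset.card_bij (fun q _ => (a q.2.1, b q.2.2)) ?_ ?_ ?_
    · rintro ⟨c, A', B'⟩ hq
      simp only [Finset.mem_filter, Finset.mem_product] at hq
      obtain ⟨⟨-, hA', hB'⟩, ⟨h1, h2⟩, h3⟩ := hq
      obtain ⟨h, cA, cB, r1, r2, -⟩ := (key A' hA' B' hB' c).1 h3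
      simp only [Finset.mem_filter, Finset.mem_univ, true_and]
      exact ⟨⟨(hac A' hA').trans h1, (hbc B' hB').trans h2⟩, h, ⟨cA, r1⟩, ⟨cB, r2⟩⟩
    · rintro ⟨c, A', B'⟩ hq ⟨d, C', D'⟩ hq' heq
      simp only [Finset.mem_filter, Finset.mem_product] at hq hq'
      obtain ⟨⟨-, hA', hB'⟩, -, h3⟩ := hq
      obtain ⟨⟨-, hC', hD'⟩, -, h3'⟩ := hq'
      simp only [Prod.mk.injEq] at heq
      have e1 : A' = C' := by
        ext j
        by_cases hj : j < k + 1
        · rw [ha' A' hA' j hj, ha' C' hC' j hj, heq.1]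
        · exact ⟨fun h => absurd (hW' _ hA' j h) hj, fun h => absurd (hW' _ hC' j h) hj⟩
      have e2 : B' = D' := by
        ext j
        by_cases hj : j < k + 1
        · rw [hb' B' hB' j hj, hb' D' hD' j hj, heq.2]
        · exact ⟨fun h => absurd (hW' _ hB' j h) hj, fun h => absurd (hW' _ hD' j h) hj⟩
      subst e1 e2
      rw [huniq A' hA' B' hB' c d h3 h3']
    · rintro ⟨A, B⟩ hp
      simp only [Finset.mem_filter, Finset.mem_univ, true_and] at hp
      obtain ⟨⟨h1, h2⟩, h, ⟨cA, r1⟩, ⟨cB, r2⟩⟩ := hp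
      have hex : ∀ (A : Finset (ZMod (k + 1))) (e : ℤ), ∃ A' ∈ W,
          (A'.image fun j : ℕ => ((j + e : ℤ) : ZMod (k + 1))) = A := by
        intro A e
        refine ⟨A.image fun i => (i - (e : ZMod (k + 1))).val, ?_, ?_⟩
        · rw [hW, Finset.mem_powerset]
          intro j hj
          obtain ⟨i, -, rfl⟩ := Finset.mem_image.1 hj
          exact Finset.mem_range.2 (ZMod.val_lt _)
        · rw [Finset.image_image]
          have : ((fun j : ℕ => ((j + e : ℤ) : ZMod (k + 1))) ∘
              fun i : ZMod (k + 1) => (i - (e : ZMod (k + 1))).val) = id := by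
            funext i
            simp
          rw [this, Finset.image_id]
      obtain ⟨A', hA', eA⟩ := hex A 0
      obtain ⟨B', hB', eB⟩ := hex B (-1)
      have eA' : a A' = A := by simpa [ha] using eA
      have eB' : b B' = B := by simpa [hb, sub_eq_add_neg] using eB
      have hrun := (key A' hA' B' hB' (cB (-1), cA 0)).2
        ⟨h, cA, cB, by rwa [eA'], by rwa [eB'], rfl⟩
      refine ⟨((cB (-1), cA 0), A', B'), ?_, by simp only [eA', eB']⟩
      simp only [Finset.mem_filter, Finset.mem_product]
      exact ⟨⟨hmem A' hA' B' hB' _ hrun, hA', hB'⟩, ⟨by rw [← hac A' hA', eA', h1],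
        by rw [← hbc B' hB', eB', h2]⟩, hrun⟩
  rw [← count r s, ← count s r]
  exact card_run_comm F G (k + 1) r s Ω hswap

end Link

/-! ### Transitions by a single letter -/

section Exch

variable {k : ℕ} {A : Finset (ZMod (k + 1))} {i : ZMod (k + 1)} {f g h c : ℤ → ℤ}
  {β γ : YoungDiagram}

/-- The transition by a letter of residue `i`. -/
def Exch (k : ℕ) (i : ZMod (k + 1)) (f g : ℤ → ℤ) : Prop :=
  ∀ x : ℤ, ((x : ZMod (k + 1)) = i →
      f x ≠ f (x + 1) ∧ g x = min (f x) (f (x + 1)) ∧ g (x + 1) = max (f x) (f (x + 1))) ∧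
    ((x : ZMod (k + 1)) ≠ i → (x : ZMod (k + 1)) ≠ i + 1 → g x = f x)

theorem add_one_ne (hk : 0 < k) (i : ZMod (k + 1)) : i + 1 ≠ i := by
  have : Fact (1 < k + 1) := ⟨by omega⟩
  intro h
  exact one_ne_zero (add_eq_left.1 h)

theorem intCast_add_one (k : ℕ) (x : ℤ) :
    ((x + 1 : ℤ) : ZMod (k + 1)) = (x : ZMod (k + 1)) + 1 := by
  push_cast
  rfl

theorem intCast_sub_one_eq {x : ℤ} (h : (x : ZMod (k + 1)) = i + 1) :
    ((x - 1 : ℤ) : ZMod (k + 1)) = i := by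
  push_cast
  rw [h, add_sub_cancel_right]

theorem intCast_add_period (k : ℕ) (x : ℤ) :
    ((x + (k + 1) : ℤ) : ZMod (k + 1)) = (x : ZMod (k + 1)) := by
  have := intCast_add_mul (k := k) x 1
  rwa [mul_one] at this

theorem Exch.quasi (h : Exch k i f g) (hf : Quasi k f) : Quasi k g := by
  intro x
  have e := intCast_add_period k x
  by_cases h1 : (x : ZMod (k + 1)) = i
  · have a1 := (h x).1 h1
    have a2 := (h (x + (k + 1))).1 (e.trans h1)
    rw [show x + ((k : ℤ) + 1) + 1 = x + 1 + (k + 1) by ring, hf, hf] at a2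
    omega
  · by_cases h2 : (x : ZMod (k + 1)) = i + 1
    · have e' := intCast_sub_one_eq h2
      have a1 := (h (x - 1)).1 e'
      have a2 := (h (x - 1 + (k + 1))).1 ((intCast_add_period k _).trans e')
      rw [show x - 1 + ((k : ℤ) + 1) + 1 = x - 1 + 1 + (k + 1) by ring, hf, hf] at a2
      rw [sub_add_cancel] at a1 a2
      omega
    · rw [(h x).2 h1 h2, (h (x + (k + 1))).2 (by rwa [e]) (by rwa [e]), hf]

/-- With a single site per period the carry is `f` itself except just after that site, where it is
the larger value. Here `0 < k` separates the residues `i` and `i + 1`. -/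
theorem Exch.isRow (hk : 0 < k) (h : Exch k i f g) (hf : Quasi k f) :
    IsRow k {i} f g fun x => if (x : ZMod (k + 1)) = i + 1 then g x else f x := by
  refine ⟨fun x => ?_, fun x => ⟨fun hx => ?_, fun hx => ?_⟩⟩
  · simp only [intCast_add_period, hf x, h.quasi hf x]
    split_ifs <;> rfl
  · rw [Finset.mem_singleton] at hx
    simp only [intCast_add_one, add_left_inj, hx, if_false, and_true]
    split_ifs with h1
    · rfl
    · exact (h x).2 hx h1
  · rw [Finset.mem_singleton] at hx
    simp only [intCast_add_one, hx, if_true, (add_one_ne hk i).symm, if_false]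
    exact (h x).1 hx

/-- As neither `i` nor `i + 1` is in `A`, at `x` of residue `i` the values `g x` and `g (x + 1)` are
`c x` and `f (x + 1)`, the very pair that the site `x` of the enlarged row sorts. -/
theorem IsRow.insert_letter (hk : 0 < k) (h : IsRow k A f g c) {g' : ℤ → ℤ} (hf : Quasi k f)
    (hi : i ∉ A) (hi' : i + 1 ∉ A) (e : Exch k i g g') :
    IsRow k (insert i A) f g' fun x => if (x : ZMod (k + 1)) = i + 1 then g' x else c x := by
  have hg := h.quasi_target hf
  refine ⟨fun x => ?_, fun x => ?_⟩
  · simp only [intCast_add_period, h.quasi x, e.quasi hg x]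
    split_ifs <;> rfl
  · have s := h.site x
    have s' := h.site (x + 1)
    have ex := e x
    simp only [intCast_add_one, add_left_inj, Finset.mem_insert] at s' ⊢
    by_cases h1 : (x : ZMod (k + 1)) = i
    · rw [h1] at s s' ⊢
      have s1 := s.1 hi
      have s2 := s'.1 hi'
      have ex1 := ex.1 h1
      simp only [(add_one_ne hk i).symm, if_true, if_false, true_or]
      refine ⟨fun h => absurd trivial h, fun _ => ?_⟩
      omega
    · simp only [h1, if_false, false_or]
      by_cases h2 : (x : ZMod (k + 1)) = i + 1
      · simp only [h2, if_true, hi']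
        rw [h2] at s
        exact ⟨fun _ => ⟨rfl, (s.1 hi').2⟩, fun h => h.elim⟩
      · simp only [h2, if_false]
        rwa [ex.2 h1 h2]

theorem IsRow.exists_of_insert (hk : 0 < k) {g' c' : ℤ → ℤ} (h : IsRow k (Insert.insert i A) f g' c')
    (hf : Quasi k f) (hi : i ∉ A) (hi' : i + 1 ∉ A) :
    ∃ g c, IsRow k A f g c ∧ Exch k i g g' ∧
      ∀ x : ℤ, (x : ZMod (k + 1)) ≠ i + 1 → c x = c' x := by
  have hg := h.quasi_target hf
  have hne := add_one_ne hk i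
  have hi'' : i + 1 ∉ Insert.insert i A := by
    simp [hi', hne]
  refine ⟨fun x => if (x : ZMod (k + 1)) = i then c' x else
      if (x : ZMod (k + 1)) = i + 1 then f x else g' x,
    fun x => if (x : ZMod (k + 1)) = i + 1 then f x else c' x, ⟨fun x => ?_, fun x => ?_⟩,
    fun x => ⟨fun h1 => ?_, fun h1 h2 => ?_⟩, fun x hx => if_neg hx⟩
  · simp only [intCast_add_period, h.quasi x, hf x]
    split_ifs <;> rfl
  · have s := h.site x
    simp only [intCast_add_one, add_left_inj]
    by_cases h1 : (x : ZMod (k + 1)) = i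
    · simp [h1, hne.symm, hi, Site]
    · rw [Finset.mem_insert] at s
      simp only [h1, false_or, if_false] at s ⊢
      by_cases h2 : (x : ZMod (k + 1)) = i + 1
      · simp only [h2, if_true, hi', Site] at s ⊢
        have := s.1 (by simp)
        simp [this.2]
      · simpa only [h2, if_false] using s
  · have s := (h.site x).2 (by simp [h1])
    have s' := (h.site (x + 1)).1 (by rwa [intCast_add_one, h1])
    simp only [intCast_add_one, h1, if_true, hne, if_false]
    omega
  · simp only [h1, h2, if_false]

/-- A corner is the last cell of its diagonal, with a gap at its content followed by a bead. -/
theorem isRemovable_iff (hγ : IsCode k γ g) {d : ℕ × ℕ} : IsRemovable γ d ↔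
    d.1 + 1 = diag γ (cont d) ∧ g (cont d) < 0 ∧ 0 ≤ g (cont d + 1) := by
  have e1 := diag_sub_eq (γ := γ) (x := cont d)
  have e2 := diag_sub_eq (γ := γ) (x := cont d + 1)
  rw [add_sub_cancel_right] at e2
  have b1 := hγ.bead_iff (cont d)
  have b2 := hγ.bead_iff (cont d + 1)
  rw [IsRemovable, mem_iff_lt_diag_cont, mem_iff_lt_diag, mem_iff_lt_diag,
    show ((d.2 + 1 : ℕ) : ℤ) - d.1 = cont d + 1 by simp only [cont]; push_cast; ring,
    show (d.2 : ℤ) - (d.1 + 1 : ℕ) = cont d - 1 by simp only [cont]; push_cast; ring]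
  simp only [b1, b2] at e1 e2
  split_ifs at e1 e2 <;> omega

theorem diag_eq_of_residue_ne (hle : β ≤ γ) (hres : ∀ d, d ∈ γ → d ∉ β → residue k d = i) {x : ℤ}
    (hx : (x : ZMod (k + 1)) ≠ i) : diag γ x = diag β x := by
  refine le_antisymm ?_ (diag_le_iff.1 hle x)
  by_contra! h
  obtain ⟨d, hd, rfl⟩ := exists_cell β x
  exact hx (residue_eq k d ▸ hres d (mem_iff_lt_diag_cont.2 (by omega))
    (mt mem_iff_lt_diag_cont.1 (by omega)))

/-- Counting the entries above every threshold determines a pair up to order. -/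
theorem sorted_of_count {a b a' b' : ℤ}
    (key : ∀ t : ℤ, ((if t ≤ a then 1 else 0) + (if t ≤ b then 1 else 0) : ℤ) =
      (if t ≤ a' then 1 else 0) + (if t ≤ b' then 1 else 0)) (hlt : a' < b') :
    a ≠ b ∧ a' = min a b ∧ b' = max a b := by
  have k1 := key (max a b)
  have k2 := key (min a b)
  have k3 := key a'
  have k4 := key b'
  rw [if_pos le_rfl, if_pos hlt.le] at k3
  rw [if_neg (not_le.2 hlt), if_pos le_rfl] at k4
  rw [if_pos (min_le_left _ _), if_pos (min_le_right _ _)] at k2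
  have h1 : a' ≤ a ∧ a' ≤ b := by
    split_ifs at k3 <;> omega
  have h2 : min a b ≤ a' := by
    split_ifs at k2 <;> omega
  have h3 : b' ≤ max a b := by
    split_ifs at k4 <;> omega
  have h4 : max a b ≤ b' := by
    rcases le_total a b with h | h
    · rw [max_eq_right h, if_pos le_rfl] at k1
      split_ifs at k1 <;> omega
    · rw [max_eq_left h, if_pos le_rfl] at k1
      split_ifs at k1 <;> omega
  omega

/-- Only diagonals of residue `i` change, so beads move only within pairs `x`, `x + 1` with `x` of
residue `i`, and each pair keeps its number of beads. A removable `i`-corner of `γ` forces `g x < g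
(x + 1)`, so the new pair is the strictly sorted old one. -/
theorem exch_of_residue_eq (hk : 0 < k) (hβ : IsCode k β f) (hγ : IsCode k γ g) (hle : β ≤ γ)
    (hres : ∀ d, d ∈ γ → d ∉ β → residue k d = i)
    (hex : ∃ d, IsRemovable γ d ∧ residue k d = i) : Exch k i f g := by
  have hne := add_one_ne hk i
  have hd : ∀ x : ℤ, (x : ZMod (k + 1)) ≠ i → diag γ x = diag β x :=
    fun x => diag_eq_of_residue_ne hle hres
  intro x
  refine ⟨fun hx => ?_, fun h1 h2 => ?_⟩
  · have hlt : g x < g (x + 1) := by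
      obtain ⟨d, hd, hdi⟩ := hex
      rw [isRemovable_iff hγ] at hd
      rw [residue_eq] at hdi
      obtain ⟨t, ht⟩ := intCast_eq_iff.1 (hx.trans hdi.symm)
      rw [ht, show x + (k + 1) * t + 1 = x + 1 + (k + 1) * t by ring, hγ.quasi.add_mul,
        hγ.quasi.add_mul] at hd
      omega
    have key : ∀ t : ℤ, ((if t ≤ f x then 1 else 0) + (if t ≤ f (x + 1) then 1 else 0) : ℤ) =
        (if t ≤ g x then 1 else 0) + (if t ≤ g (x + 1) then 1 else 0) := by
      intro t
      have r0 := (intCast_add_mul (k := k) x t).trans hx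
      have e1 := diag_sub_eq (γ := β) (x := x + (k + 1) * t)
      have e2 := diag_sub_eq (γ := β) (x := x + 1 + (k + 1) * t)
      have e3 := diag_sub_eq (γ := γ) (x := x + (k + 1) * t)
      have e4 := diag_sub_eq (γ := γ) (x := x + 1 + (k + 1) * t)
      rw [show x + 1 + (k + 1) * t - 1 = x + (k + 1) * t by ring] at e2 e4
      have d1 := hd (x + (k + 1) * t - 1) (by
        intro h
        apply hne
        rw [← h, ← intCast_add_one, sub_add_cancel, r0, h])
      have d2 := hd (x + 1 + (k + 1) * t) (by
        rw [show x + 1 + (k + 1) * t = x + (k + 1) * t + 1 by ring, intCast_add_one, r0]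
        exact hne)
      rw [d1] at e3
      rw [d2] at e4
      simp only [hβ.le_iff x t, hγ.le_iff x t, hβ.le_iff (x + 1) t, hγ.le_iff (x + 1) t]
      linarith
    exact sorted_of_count key hlt
  · apply eq_of_forall_le_iff
    intro t
    rw [hβ.le_iff, hγ.le_iff]
    have r0 := intCast_add_mul (k := k) x t
    have d1 := hd (x + (k + 1) * t) (by rwa [r0])
    have d2 := hd (x + (k + 1) * t - 1) (by
      intro h
      apply h2
      rw [← h, ← intCast_add_one, sub_add_cancel, r0])
    rw [bead, bead, d1, d2]

theorem Exch.lt (h : Exch k i f g) {x : ℤ} (hx : (x : ZMod (k + 1)) = i) : g x < g (x + 1) := by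
  have := (h x).1 hx
  omega

theorem Exch.exists_core (hk : 0 < k) (h : Exch k i f g) (hβ : IsCode k β f) :
    ∃ γ, IsCode k γ g ∧ β ≤ γ ∧
      (∀ d, d ∈ γ → d ∉ β → IsRemovable γ d ∧ residue k d = i) ∧
      ∃ d, IsRemovable γ d ∧ residue k d = i := by
  have hrow := h.isRow hk hβ.quasi
  obtain ⟨γ, hγ⟩ := hrow.exists_core hβ (h.quasi hβ.quasi)
  have hle := hrow.le hβ hγ
  have hres : ∀ d, d ∈ γ → d ∉ β → residue k d = i := fun d h1 h2 =>
    Finset.mem_singleton.1 (mem_letterCells.1 (hrow.mem_letterCells_of_mem_of_notMem hβ hγ h1 h2)).2.1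
  have hlet : ∀ d, d ∈ letterCells k {i} β γ → IsRemovable γ d ∧ residue k d = i := by
    intro d hd
    rw [mem_letterCells, Finset.mem_singleton] at hd
    obtain ⟨h1, h2, h3, h4⟩ := hd
    refine ⟨⟨h1, fun h5 => ?_, h4⟩, h2⟩
    have h6 := hres _ h5 h3
    rw [residue_eq, show cont (d.1, d.2 + 1) = cont d + 1 by simp only [cont]; push_cast; ring,
      intCast_add_one, ← residue_eq, h2] at h6
    exact add_one_ne hk i h6
  refine ⟨γ, hγ, hle, fun d h1 h2 =>
    hlet d (hrow.mem_letterCells_of_mem_of_notMem hβ hγ h1 h2), ?_⟩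
  -- A level separating the two exchanged values; the letter has a cell there.
  obtain ⟨t, ht1, ht2⟩ : ∃ t : ℤ, min (f i.val) (f (i.val + 1)) < t ∧
      t ≤ max (f i.val) (f (i.val + 1)) := by
    have := ((h i.val).1 (intCast_val i)).1
    exact ⟨max (f i.val) (f (i.val + 1)), by omega, le_rfl⟩
  have r0 : (((i.val : ℤ) + (k + 1) * t : ℤ) : ZMod (k + 1)) = i :=
    (intCast_add_mul _ t).trans (intCast_val i)
  obtain ⟨d, hd, -⟩ := hrow.exists_mem_letterCells hβ hγ (x := i.val + (k + 1) * t)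
    (by rw [r0]; simp) (by
      simp only [r0, (add_one_ne hk i).symm, if_false]
      rw [show (i.val : ℤ) + (k + 1) * t + 1 = i.val + 1 + (k + 1) * t by ring, hβ.quasi.add_mul,
        hβ.quasi.add_mul]
      omega)
  exact ⟨d, hlet d hd⟩

end Exch

/-! ### Standard tableaux as chains of cores -/

section Chains

namespace SetValuedTableau

theorem mem_shapeLE {T : SetValuedTableau} {x : ℕ} {c : ℕ × ℕ} :
    c ∈ T.shapeLE x ↔ ∃ a ∈ T.entry c, a ≤ x := by
  rw [← YoungDiagram.mem_cells]
  simp only [shapeLE, Finset.mem_filter, YoungDiagram.mem_cells, and_iff_right_iff_imp]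
  rintro ⟨a, ha, -⟩
  exact (T.nonempty_iff c).1 ⟨a, ha⟩

theorem ext_entry {T T' : SetValuedTableau} (h : T.entry = T'.entry) : T = T' := by
  have hs : T.shape = T'.shape := by
    apply YoungDiagram.ext
    ext c
    rw [YoungDiagram.mem_cells, YoungDiagram.mem_cells, ← T.nonempty_iff, ← T'.nonempty_iff, h]
  cases T
  cases T'
  simp only at h hs
  subst h hs
  rfl

theorem shapeLE_mono (T : SetValuedTableau) {x y : ℕ} (h : x ≤ y) : T.shapeLE x ≤ T.shapeLE y := by
  intro c hc
  obtain ⟨a, ha, hax⟩ := mem_shapeLE.1 hc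
  exact mem_shapeLE.2 ⟨a, ha, hax.trans h⟩

/-- The subtableau of the letters at most `N`. -/
def restrict (T : SetValuedTableau) (N : ℕ) : SetValuedTableau where
  shape := T.shapeLE N
  entry c := (T.entry c).filter (· ≤ N)
  nonempty_iff c := by
    rw [mem_shapeLE]
    simp only [Finset.Nonempty, Finset.mem_filter]
  row_weak i j j' hj a ha b hb :=
    T.row_weak i j j' hj a (Finset.mem_filter.1 ha).1 b (Finset.mem_filter.1 hb).1
  col_strict i i' j hi a ha b hb :=
    T.col_strict i i' j hi a (Finset.mem_filter.1 ha).1 b (Finset.mem_filter.1 hb).1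

theorem mem_entry_restrict {T : SetValuedTableau} {N a : ℕ} {c : ℕ × ℕ} :
    a ∈ (T.restrict N).entry c ↔ a ∈ T.entry c ∧ a ≤ N := Finset.mem_filter

theorem shapeLE_restrict (T : SetValuedTableau) {x N : ℕ} (h : x ≤ N) :
    (T.restrict N).shapeLE x = T.shapeLE x := by
  ext c
  rw [YoungDiagram.mem_cells, YoungDiagram.mem_cells, mem_shapeLE, mem_shapeLE]
  simp only [mem_entry_restrict, and_assoc]
  exact ⟨fun ⟨a, h1, h2, h3⟩ => ⟨a, h1, h3⟩, fun ⟨a, h1, h3⟩ => ⟨a, h1, h3.trans h, h3⟩⟩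

theorem shapeLE_eq_shape {T : SetValuedTableau} {n : ℕ} (h : ∀ c, T.entry c ⊆ Finset.Icc 1 n) :
    T.shapeLE n = T.shape := by
  ext c
  rw [YoungDiagram.mem_cells, YoungDiagram.mem_cells, mem_shapeLE, ← T.nonempty_iff]
  exact ⟨fun ⟨a, h1, _⟩ => ⟨a, h1⟩, fun ⟨a, h1⟩ => ⟨a, h1, (Finset.mem_Icc.1 (h c h1)).2⟩⟩

theorem shapeLE_zero {T : SetValuedTableau} {n : ℕ} (h : ∀ c, T.entry c ⊆ Finset.Icc 1 n) :
    T.shapeLE 0 = ⊥ := by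
  ext c
  rw [YoungDiagram.mem_cells, mem_shapeLE]
  simp only [YoungDiagram.cells_bot, Finset.notMem_empty, iff_false, not_exists, not_and]
  intro a ha h0
  have := (Finset.mem_Icc.1 (h c ha)).1
  omega

end SetValuedTableau

open SetValuedTableau

theorem isCore_bot (p : ℕ) : IsCore p ⊥ := fun _ hc => absurd hc (YoungDiagram.notMem_bot _)

/-- The codes `F x` of the shapes of the tableaux `T_{≤ x}` and the residues `w x` of the letters of
a standard tableau. -/
structure IsChain (k n : ℕ) (T : SetValuedTableau) (F : ℕ → ℤ → ℤ) (w : ℕ → ZMod (k + 1)) :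
    Prop where
  code : ∀ x ≤ n, IsCode k (T.shapeLE x) (F x)
  exch : ∀ x < n, Exch k (w (x + 1)) (F x) (F (x + 1))
  mem_iff : ∀ x < n, ∀ c, x + 1 ∈ T.entry c ↔
    IsRemovable (T.shapeLE (x + 1)) c ∧ residue k c = w (x + 1)

variable {k n : ℕ} {T : SetValuedTableau} {F : ℕ → ℤ → ℤ} {w : ℕ → ZMod (k + 1)}

theorem mem_entry_of_mem_shapeLE {x : ℕ} {c : ℕ × ℕ} (h1 : c ∈ T.shapeLE (x + 1))
    (h2 : c ∉ T.shapeLE x) : x + 1 ∈ T.entry c := by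
  rw [mem_shapeLE] at h1 h2
  obtain ⟨a, ha, hax⟩ := h1
  push Not at h2
  have := h2 a ha
  obtain rfl : a = x + 1 := by omega
  exact ha

theorem IsStandardAffineSV.exists_chain (hk : 0 < k) (h : IsStandardAffineSV k n T) :
    ∃ F w, IsChain k n T F w := by
  have hc : ∀ x ≤ n, IsCore (k + 1) (T.shapeLE x) := by
    intro x hx
    rcases Nat.eq_zero_or_pos x with rfl | h0
    · rw [shapeLE_zero h.1]
      exact isCore_bot _
    · exact (h.2 x (Finset.mem_Icc.2 ⟨h0, hx⟩)).1
  have hF : ∀ x, ∃ f, x ≤ n → IsCode k (T.shapeLE x) f := by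
    intro x
    by_cases hx : x ≤ n
    · obtain ⟨f, hf⟩ := exists_isCode (hc x hx)
      exact ⟨f, fun _ => hf⟩
    · exact ⟨0, fun h => absurd h hx⟩
  have hw : ∀ x, ∃ i : ZMod (k + 1), x ∈ Finset.Icc 1 n →
      (∃ c, IsRemovable (T.shapeLE x) c ∧ residue k c = i) ∧
      ∀ c, x ∈ T.entry c ↔ IsRemovable (T.shapeLE x) c ∧ residue k c = i := by
    intro x
    by_cases hx : x ∈ Finset.Icc 1 n
    · obtain ⟨i, hi⟩ := (h.2 x hx).2
      exact ⟨i, fun _ => hi⟩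
    · exact ⟨0, fun h => absurd h hx⟩
  choose F hF using hF
  choose w hw using hw
  refine ⟨F, w, hF, fun x hx => ?_, fun x hx c => (hw (x + 1) (by simp; omega)).2 c⟩
  obtain ⟨h1, h2⟩ := hw (x + 1) (by simp; omega)
  exact exch_of_residue_eq hk (hF x hx.le) (hF (x + 1) hx) (T.shapeLE_mono (Nat.le_succ x))
    (fun d hd hd' => ((h2 d).1 (mem_entry_of_mem_shapeLE hd hd')).2) h1

theorem IsChain.diag_eq (h : IsChain k n T F w) {a b : ℕ} (hab : a ≤ b) (hb : b ≤ n) {x : ℤ}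
    (hw : ∀ y, a < y → y ≤ b → (x : ZMod (k + 1)) ≠ w y) :
    diag (T.shapeLE b) x = diag (T.shapeLE a) x := by
  induction b, hab using Nat.le_induction with
  | base => rfl
  | succ b hab ih =>
    rw [← ih (by omega) fun y h1 h2 => hw y h1 (by omega)]
    exact diag_eq_of_residue_ne (T.shapeLE_mono (Nat.le_succ b))
      (fun d hd hd' => ((h.mem_iff b hb d).1 (mem_entry_of_mem_shapeLE hd hd')).2)
      (hw (b + 1) (by omega) le_rfl)

theorem IsChain.code_eq (h : IsChain k n T F w) {a b : ℕ} (hab : a ≤ b) (hb : b ≤ n) {x : ℤ}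
    (hw : ∀ y, a < y → y ≤ b → (x : ZMod (k + 1)) ≠ w y)
    (hw' : ∀ y, a < y → y ≤ b → (x : ZMod (k + 1)) ≠ w y + 1) : F b x = F a x := by
  induction b, hab using Nat.le_induction with
  | base => rfl
  | succ b hab ih =>
    rw [← ih (by omega) (fun y h1 h2 => hw y h1 (by omega)) fun y h1 h2 => hw' y h1 (by omega)]
    exact (h.exch b hb x).2 (hw (b + 1) (by omega) le_rfl) (hw' (b + 1) (by omega) le_rfl)

theorem IsRow.refl {f : ℤ → ℤ} (hf : Quasi k f) : IsRow k ∅ f f f :=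
  ⟨hf, fun _ => ⟨fun _ => ⟨rfl, rfl⟩, fun h => absurd h (Finset.notMem_empty _)⟩⟩

/-- The letters are inserted one by one with `IsRow.insert_letter`. The two hypotheses say that the
residue of a new letter and its successor have not been used before. -/
theorem IsChain.exists_isRow (hk : 0 < k) (h : IsChain k n T F w) {a b : ℕ} (hab : a ≤ b)
    (hb : b ≤ n) (hdist : ∀ x y, a < x → x < y → y ≤ b → w x ≠ w y)
    (hord : ∀ x y, a < x → x < y → y ≤ b → w x ≠ w y + 1) :
    ∃ c, IsRow k ((Finset.Ioc a b).image w) (F a) (F b) c ∧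
      ∀ y, a < y → y ≤ b → ∀ x : ℤ, (x : ZMod (k + 1)) = w y →
        F y x = min (c x) (F a (x + 1)) ∧ F y (x + 1) = max (c x) (F a (x + 1)) := by
  have hq : Quasi k (F a) := (h.code a (by omega)).quasi
  induction b, hab using Nat.le_induction with
  | base => exact ⟨F a, by simpa using IsRow.refl hq, fun y h1 h2 => absurd h2 (by omega)⟩
  | succ b hab ih =>
    obtain ⟨c, hc, hy⟩ := ih (by omega) (fun x y h1 h2 h3 => hdist x y h1 h2 (by omega))
      fun x y h1 h2 h3 => hord x y h1 h2 (by omega)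
    have hi : w (b + 1) ∉ (Finset.Ioc a b).image w := by
      rw [Finset.mem_image]
      rintro ⟨x, hx, hxw⟩
      rw [Finset.mem_Ioc] at hx
      exact hdist x (b + 1) hx.1 (by omega) le_rfl hxw
    have hi' : w (b + 1) + 1 ∉ (Finset.Ioc a b).image w := by
      rw [Finset.mem_image]
      rintro ⟨x, hx, hxw⟩
      rw [Finset.mem_Ioc] at hx
      exact hord x (b + 1) hx.1 (by omega) le_rfl hxw
    have he := h.exch b (by omega)
    have hrow := hc.insert_letter hk hq hi hi' he
    have hIoc : (Finset.Ioc a (b + 1)).image w = insert (w (b + 1)) ((Finset.Ioc a b).image w) := by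
      rw [← Finset.image_insert]
      congr 1
      ext x
      simp only [Finset.mem_Ioc, Finset.mem_insert]
      omega
    refine ⟨_, by rw [hIoc]; exact hrow, fun y h1 h2 x hx => ?_⟩
    rcases Nat.le_succ_iff.1 h2 with h3 | rfl
    · have hn1 : (x : ZMod (k + 1)) ≠ w (b + 1) + 1 := by
        rw [hx]
        exact hord y (b + 1) h1 (by omega) le_rfl
      rw [if_neg hn1]
      exact hy y h1 h3 x hx
    · have hn1 : (x : ZMod (k + 1)) ≠ w (b + 1) + 1 := by
        rw [hx]
        exact (add_one_ne hk _).symm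
      rw [if_neg hn1]
      have s1 := (hc.site x).1 (by rwa [hx])
      have s2 := (hc.site (x + 1)).1 (by rwa [intCast_add_one, hx])
      have e1 := (he x).1 hx
      rw [← s1.1, ← s1.2, ← s2.1]
      exact ⟨e1.2.1, e1.2.2⟩

/-- After the letter `y` no later letter of the block has its residue, so its diagonals no longer
change and its cells can be read off at the end of the block. -/
theorem IsChain.mem_iff_letterCells (h : IsChain k n T F w) {a b : ℕ}
    (hb : b ≤ n) {c : ℤ → ℤ} (hdist : ∀ x y, a < x → x < y → y ≤ b → w x ≠ w y)
    (hrow : IsRow k ((Finset.Ioc a b).image w) (F a) (F b) c)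
    (hc : ∀ y, a < y → y ≤ b → ∀ x : ℤ, (x : ZMod (k + 1)) = w y →
        F y x = min (c x) (F a (x + 1)) ∧ F y (x + 1) = max (c x) (F a (x + 1)))
    {y : ℕ} (h1 : a < y) (h2 : y ≤ b) (d : ℕ × ℕ) : y ∈ T.entry d ↔
      residue k d = w y ∧
        d ∈ letterCells k ((Finset.Ioc a b).image w) (T.shapeLE a) (T.shapeLE b) := by
  rw [hrow.mem_letterCells_iff (h.code a (by omega)) (h.code b hb)]
  obtain ⟨y, rfl⟩ := Nat.exists_eq_add_of_le' (show 1 ≤ y by omega)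
  rw [h.mem_iff y (by omega), isRemovable_iff (h.code (y + 1) (by omega)), residue_eq]
  rw [and_comm, and_congr_right_iff]
  intro hd
  have hmem : ((cont d : ℤ) : ZMod (k + 1)) ∈ (Finset.Ioc a b).image w := by
    rw [hd]
    exact Finset.mem_image_of_mem _ (Finset.mem_Ioc.2 ⟨h1, h2⟩)
  have s := (hrow.site (cont d)).2 hmem
  have e := hc _ h1 h2 _ hd
  rw [h.diag_eq h2 hb (x := cont d) fun z hz1 hz2 => by
    rw [hd]; exact hdist _ _ h1 hz1 hz2]
  simp only [hmem, true_and]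
  rw [e.1, e.2]
  refine and_congr_right fun _ => ?_
  omega

theorem exists_removable {γ : YoungDiagram} {g : ℤ → ℤ} (hγ : IsCode k γ g) {y : ℤ} (h1 : g y < 0)
    (h2 : 0 ≤ g (y + 1)) : ∃ d, IsRemovable γ d ∧ cont d = y := by
  have b1 : diag γ (y - 1) = diag γ y := not_bead_iff.1 (by rw [hγ.bead_iff]; omega)
  have b2 : diag γ (y + 1 - 1) = diag γ (y + 1) + 1 := (hγ.bead_iff (y + 1)).2 h2
  rw [add_sub_cancel_right] at b2
  have b3 := neg_le_diag γ (y - 1)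
  have hc : cont (diag γ y - 1, (y + diag γ y - 1).toNat) = y := by
    simp only [cont]
    omega
  refine ⟨(diag γ y - 1, (y + diag γ y - 1).toNat), ?_, hc⟩
  rw [isRemovable_iff hγ, hc]
  exact ⟨by simp only; omega, h1, h2⟩

/-- The letter occupies the levels `t` with `F x z < t ≤ F x (z + 1)`. Among corners a larger
content means a lower row, so the lowest cell is at the last of these levels. -/
theorem IsChain.exists_lowest (h : IsChain k n T F w) {x : ℕ} (h0 : 0 < x) (hx : x ≤ n) {z : ℤ}
    (hz : (z : ZMod (k + 1)) = w x) :
    (∃ d, IsLowestOccurrence T x d) ∧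
      ∀ d, IsLowestOccurrence T x d → cont d = z + (k + 1) * F x (z + 1) := by
  obtain ⟨x, rfl⟩ := Nat.exists_eq_add_of_le' (show 1 ≤ x by omega)
  have hγ := h.code (x + 1) hx
  have hlt := (h.exch x hx).lt hz
  obtain ⟨d0, hd0, hc0⟩ := exists_removable hγ (y := z + (k + 1) * F (x + 1) (z + 1))
    (by rw [hγ.quasi.add_mul]; omega)
    (by rw [show z + (k + 1) * F (x + 1) (z + 1) + 1 = z + 1 + (k + 1) * F (x + 1) (z + 1) by ring,
      hγ.quasi.add_mul]; omega)
  have hm0 : x + 1 ∈ T.entry d0 := by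
    rw [h.mem_iff x hx, residue_eq, hc0, intCast_add_mul]
    exact ⟨hd0, hz⟩
  have hle : ∀ d, x + 1 ∈ T.entry d → cont d ≤ cont d0 := by
    intro d hd
    rw [h.mem_iff x hx, isRemovable_iff hγ, residue_eq] at hd
    obtain ⟨⟨-, -, h3⟩, h4⟩ := hd
    obtain ⟨t, ht⟩ := intCast_eq_iff.1 (hz.trans h4.symm)
    rw [ht, show z + (k + 1) * t + 1 = z + 1 + (k + 1) * t by ring, hγ.quasi.add_mul] at h3
    rw [ht, hc0]
    have : (0 : ℤ) ≤ (k + 1) * (F (x + 1) (z + 1) - t) := mul_nonneg (by omega) (by omega)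
    linarith
  have hrow : ∀ d, x + 1 ∈ T.entry d → d0.1 ≤ d.1 := by
    intro d hd
    have := diag_anti (T.shapeLE (x + 1)) (hle d hd)
    rw [h.mem_iff x hx, isRemovable_iff hγ] at hd
    rw [isRemovable_iff hγ] at hd0
    omega
  refine ⟨⟨d0, hm0, hrow⟩, fun d hd => ?_⟩
  rw [← hc0]
  have e1 := hrow d hd.1
  have e2 := hd.2 d0 hm0
  have e3 := hle d hd.1
  have e4 := ((h.mem_iff x hx d).1 hd.1).1.2.1
  refine le_antisymm e3 ?_
  by_contra! hlt'
  apply e4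
  simp only [cont] at hlt'
  exact (T.shapeLE (x + 1)).up_left_mem (show d.1 ≤ d0.1 by omega) (show d.2 + 1 ≤ d0.2 by omega)
    hd0.1

/-- Suppose a letter of residue `i + 1` precedes one of residue `i`. By the reading condition the
lowest cell of the later letter lies further right. Then the later letter also has a cell directly
above the lowest cell of the earlier one, against the strip condition. -/
theorem IsChain.ne_add_one (hk : 0 < k) (h : IsChain k n T F w) {a b : ℕ} (hb : b ≤ n)
    (hdist : ∀ x y, a < x → x < y → y ≤ b → w x ≠ w y)
    (hcol : ∀ x y, a < x → x ≤ b → a < y → y ≤ b → ∀ c d, x ∈ T.entry c → y ∈ T.entry d →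
      c.2 = d.2 → c = d)
    (hread : ∀ x y, a < x → x < y → y ≤ b → ∀ c d, IsLowestOccurrence T x c →
      IsLowestOccurrence T y d → ReadBefore x c y d)
    {x y : ℕ} (hax : a < x) (hxy : x < y) (hyb : y ≤ b) : w x ≠ w y + 1 := by
  intro hw
  have hne := add_one_ne hk (w y)
  obtain ⟨z, hz⟩ : ∃ z : ℤ, (z : ZMod (k + 1)) = w y := ⟨_, intCast_val (w y)⟩
  have hz1 : ((z + 1 : ℤ) : ZMod (k + 1)) = w x := by rw [intCast_add_one, hz, hw]
  obtain ⟨⟨e, he⟩, he'⟩ := h.exists_lowest (by omega) (by omega : x ≤ n) hz1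
  obtain ⟨⟨e1, he1⟩, he1'⟩ := h.exists_lowest (by omega) (by omega : y ≤ n) hz
  have he' := he' e he
  have he1' := he1' e1 he1
  have hγx := h.code x (by omega)
  have hγy := h.code y (by omega)
  obtain ⟨x, rfl⟩ := Nat.exists_eq_add_of_le' (show 1 ≤ x by omega)
  obtain ⟨y, rfl⟩ := Nat.exists_eq_add_of_le' (show 1 ≤ y by omega)
  have rx := (h.mem_iff x (by omega) e).1 he.1
  have ry := (h.mem_iff y (by omega) e1).1 he1.1
  have hxy' := T.shapeLE_mono hxy.le
  have hcont : cont e < cont e1 := by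
    rcases hread _ _ hax hxy hyb e e1 he he1 with hr | ⟨hr, hr' | ⟨hr', -⟩⟩
    · have h1 : e.2 ≠ e1.2 := fun h2 => by
        have := hcol _ _ hax (by omega) (by omega) hyb e e1 he.1 he1.1 h2
        rw [this] at hr
        omega
      have h2 : ¬ e1.2 < e.2 := fun h2 => ry.1.2.1
        ((T.shapeLE (y + 1)).up_left_mem hr.le h2 (hxy' rx.1.1))
      simp only [cont]
      omega
    · simp only [cont]
      omega
    · exfalso
      have : e = e1 := Prod.ext hr hr'
      rw [this, ry.2] at rx
      exact hne (hw ▸ rx.2.symm)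
  set t := F (x + 1) (z + 1 + 1) with ht
  have hlt : t < F (y + 1) (z + 1) := by
    rw [he', he1'] at hcont
    have : (k + 1 : ℤ) * t < (k + 1) * F (y + 1) (z + 1) := by linarith
    exact lt_of_mul_lt_mul_left this (by omega)
  -- Between the two letters no residue `i` or `i + 1` occurs, so the value that the later letter
  -- exchanges is still the one left by the earlier letter.
  have hmid : F y (z + 1) = F (x + 1) (z + 1) := by
    refine h.code_eq (by omega) (by omega) (fun u h1 h2 => ?_) fun u h1 h2 => ?_
    · rw [hz1]
      exact hdist _ _ hax h1 (by omega)
    · rw [hz1, hw]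
      intro h3
      exact hdist u (y + 1) (by omega) (by omega) hyb (add_right_cancel h3).symm
  have hlt2 := (h.exch x (by omega)).lt hz1
  have hmin := ((h.exch y (by omega) z).1 hz).2.1
  obtain ⟨d, hd, hdc⟩ := exists_removable hγy (y := z + (k + 1) * t)
    (by rw [hγy.quasi.add_mul]; omega)
    (by rw [show z + (k + 1) * t + 1 = z + 1 + (k + 1) * t by ring, hγy.quasi.add_mul]; omega)
  have hdm : y + 1 ∈ T.entry d := by
    rw [h.mem_iff y (by omega), residue_eq, hdc, intCast_add_mul]
    exact ⟨hd, hz⟩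
  have hdiag := h.diag_eq hxy.le (by omega : y + 1 ≤ n) (x := cont e) fun u h1 h2 => by
    rw [he', intCast_add_mul, hz1]
    exact hdist _ _ hax h1 (by omega)
  rw [isRemovable_iff hγy] at hd
  have r1 := (isRemovable_iff hγx).1 rx.1
  have hb1 : bead (T.shapeLE (y + 1)) (cont d + 1) := (hγy.bead_iff _).2 hd.2.2
  rw [bead, add_sub_cancel_right] at hb1
  have hce : cont d + 1 = cont e := by rw [hdc, he']; ring
  rw [hce, hdiag] at hb1
  have hrow : d.1 = e.1 + 1 := by omega
  have := hcol _ _ (show a < y + 1 by omega) hyb hax (by omega) d e hdm he.1 (by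
    simp only [cont] at hce
    omega)
  rw [this] at hrow
  omega

end Chains

/-! ### The last block of a tableau -/

section Blocks

open SetValuedTableau

variable {k : ℕ} {A : Finset (ZMod (k + 1))} {f g c : ℤ → ℤ} {β γ : YoungDiagram}

/-- The content of the lowest cell holding the letter of residue `i`. -/
def keyOf (k : ℕ) (c : ℤ → ℤ) (i : ZMod (k + 1)) : ℤ := i.val + (k + 1) * c (i.val + 1)

theorem keyOf_eq (hc : Quasi k c) {x : ℤ} {i : ZMod (k + 1)} (hx : (x : ZMod (k + 1)) = i) :
    keyOf k c i = x + (k + 1) * c (x + 1) := by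
  obtain ⟨t, rfl⟩ := intCast_eq_iff.1 ((intCast_val i).trans hx.symm)
  rw [keyOf, show (i.val : ℤ) + (k + 1) * t + 1 = i.val + 1 + (k + 1) * t by ring, hc.add_mul]
  ring

theorem keyOf_injective (k : ℕ) (c : ℤ → ℤ) : Function.Injective (keyOf k c) := by
  intro i j h
  have e : ∀ i : ZMod (k + 1), ((keyOf k c i : ℤ) : ZMod (k + 1)) = i := fun i => by
    rw [keyOf, intCast_add_mul, intCast_val]
  rw [← e i, h, e]

/-- The carried value does not drop at a site of `A`. So sorting the letters by key never puts `i +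
1` before `i`, as `IsChain.exists_isRow` requires. -/
theorem IsRow.keyOf_lt (h : IsRow k A f g c) {i : ZMod (k + 1)} (hi : i + 1 ∈ A) :
    keyOf k c i < keyOf k c (i + 1) := by
  have h1 : (((i.val : ℤ) + 1 : ℤ) : ZMod (k + 1)) = i + 1 := by rw [intCast_add_one, intCast_val]
  rw [keyOf_eq h.quasi (intCast_val i), keyOf_eq h.quasi h1]
  have s := (h.site (i.val + 1)).2 (by rwa [h1])
  have : (k + 1 : ℤ) * c (i.val + 1) ≤ (k + 1) * c (i.val + 1 + 1) :=
    mul_le_mul_of_nonneg_left (by omega) (by omega)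
  omega

/-- Letter cells have no cell of `γ` above them, so among them larger content never means a higher
row, and the reading order is the order of contents. -/
theorem readBefore_of_cont_lt {d e : ℕ × ℕ} (hd : d ∈ letterCells k A β γ)
    (he : e ∈ letterCells k A β γ) (h : cont d < cont e) (a b : ℕ) : ReadBefore a d b e := by
  rw [mem_letterCells] at hd he
  simp only [cont] at h
  by_cases h1 : d.1 < e.1
  · exact absurd (γ.up_left_mem (show d.1 + 1 ≤ e.1 by omega) (show d.2 ≤ e.2 by omega) he.1)
      hd.2.2.2
  · rw [ReadBefore]
    omega

theorem cont_lt_of_readBefore {d e : ℕ × ℕ} (hd : d ∈ letterCells k A β γ)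
    (he : e ∈ letterCells k A β γ) (hne : cont d ≠ cont e) {a b : ℕ} (h : ReadBefore a d b e) :
    cont d < cont e := by
  by_contra hlt
  have h1 := readBefore_of_cont_lt he hd (by omega) b a
  rw [ReadBefore] at h h1
  simp only [cont] at hlt hne
  omega

variable {n : ℕ} {T : SetValuedTableau} {F : ℕ → ℤ → ℤ} {w : ℕ → ZMod (k + 1)}

theorem IsChain.exists_keyOf_lt (hk : 0 < k) (h : IsChain k n T F w) {a : ℕ} (ha : a ≤ n)
    (hdist : ∀ x y, a < x → x < y → y ≤ n → w x ≠ w y)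
    (hcol : ∀ x y, a < x → x ≤ n → a < y → y ≤ n → ∀ c d, x ∈ T.entry c → y ∈ T.entry d →
      c.2 = d.2 → c = d)
    (hread : ∀ x y, a < x → x < y → y ≤ n → ∀ c d, IsLowestOccurrence T x c →
      IsLowestOccurrence T y d → ReadBefore x c y d) :
    ∃ c, IsRow k ((Finset.Ioc a n).image w) (F a) (F n) c ∧
      ∀ x y, a < x → x < y → y ≤ n → keyOf k c (w x) < keyOf k c (w y) := by
  obtain ⟨c, hc, hval⟩ := h.exists_isRow hk ha le_rfl hdist fun x y hx hxy hy =>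
    h.ne_add_one hk le_rfl hdist hcol hread hx hxy hy
  have hlow : ∀ x, a < x → x ≤ n → (∃ d, IsLowestOccurrence T x d) ∧
      ∀ d, IsLowestOccurrence T x d → cont d = keyOf k c (w x) := by
    intro x hax hx
    have hz := intCast_val (w x)
    obtain ⟨h1, h2⟩ := h.exists_lowest (by omega) hx hz
    refine ⟨h1, fun d hd => ?_⟩
    rw [h2 d hd, keyOf, (hval x hax hx _ hz).2, ((hc.site (w x).val).2 (by
      rw [hz]
      exact Finset.mem_image_of_mem _ (Finset.mem_Ioc.2 ⟨hax, hx⟩))).2.2]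
  refine ⟨c, hc, fun x y hax hxy hy => ?_⟩
  obtain ⟨⟨d, hd⟩, hd'⟩ := hlow x hax (by omega)
  obtain ⟨⟨e, he⟩, he'⟩ := hlow y (by omega) hy
  rw [← hd' d hd, ← he' e he]
  refine cont_lt_of_readBefore
    ((h.mem_iff_letterCells le_rfl hdist hc hval hax (by omega) d).1 hd.1).2
    ((h.mem_iff_letterCells le_rfl hdist hc hval (by omega) hy e).1 he.1).2 ?_
    (hread x y hax hxy hy d e hd he)
  rw [hd' d hd, he' e he]
  exact fun heq => hdist x y hax hxy hy (keyOf_injective k c heq)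

/-- Increasing keys make the residues distinct, so they exhaust `A`, and by `IsRow.keyOf_lt` they
satisfy the order condition of `IsChain.exists_isRow`. Uniqueness of the carry identifies the keys
with the contents of the lowest cells. -/
theorem IsChain.of_keyOf_lt (hk : 0 < k) (h : IsChain k n T F w) {a : ℕ} (ha : a ≤ n)
    (hA : a + A.card = n) (hc : IsRow k A (F a) (F n) c)
    (hmem : ∀ x, a < x → x ≤ n → w x ∈ A)
    (hkey : ∀ x y, a < x → x < y → y ≤ n → keyOf k c (w x) < keyOf k c (w y)) :
    A = (Finset.Ioc a n).image w ∧ (∀ x y, a < x → x < y → y ≤ n → w x ≠ w y) ∧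
    (∀ x, a < x → x ≤ n → ∀ d, x ∈ T.entry d ↔
      residue k d = w x ∧ d ∈ letterCells k A (T.shapeLE a) (T.shapeLE n)) ∧
    (∀ x y, a < x → x ≤ n → a < y → y ≤ n → ∀ c d, x ∈ T.entry c → y ∈ T.entry d →
      c.2 = d.2 → c = d) ∧
    (∀ x y, a < x → x < y → y ≤ n → ∀ c d, IsLowestOccurrence T x c →
      IsLowestOccurrence T y d → ReadBefore x c y d) := by
  have hdist : ∀ x y, a < x → x < y → y ≤ n → w x ≠ w y := by
    intro x y h1 h2 h3 heq
    have := hkey x y h1 h2 h3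
    rw [heq] at this
    exact lt_irrefl _ this
  have hinj : Set.InjOn w (Finset.Ioc a n) := by
    intro x hx y hy hxy
    simp only [Finset.coe_Ioc, Set.mem_Ioc] at hx hy
    rcases lt_trichotomy x y with h1 | h1 | h1
    · exact absurd hxy (hdist x y hx.1 h1 hy.2)
    · exact h1
    · exact absurd hxy.symm (hdist y x hy.1 h1 hx.2)
  have hAw : (Finset.Ioc a n).image w = A := by
    apply Finset.eq_of_subset_of_card_le
    · intro i hi
      obtain ⟨x, hx, rfl⟩ := Finset.mem_image.1 hi
      rw [Finset.mem_Ioc] at hx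
      exact hmem x hx.1 hx.2
    · rw [Finset.card_image_of_injOn hinj, Nat.card_Ioc]
      omega
  obtain ⟨c', hc', hval⟩ := h.exists_isRow hk ha le_rfl hdist fun x y h1 h2 h3 heq => by
    have h4 := hkey x y h1 h2 h3
    have h5 := hc.keyOf_lt (i := w y) (heq ▸ hmem x h1 (by omega))
    rw [heq] at h4
    omega
  have hcell := fun x (h1 : a < x) (h2 : x ≤ n) d =>
    h.mem_iff_letterCells le_rfl hdist hc' hval h1 h2 d
  rw [hAw] at hc' hcell
  obtain ⟨rfl, -⟩ := hc.unique hc'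
  have hlow : ∀ x, a < x → x ≤ n → ∀ d, IsLowestOccurrence T x d → cont d = keyOf k c (w x) := by
    intro x hax hx d hd
    have hz := intCast_val (w x)
    rw [(h.exists_lowest (by omega) hx hz).2 d hd, keyOf, (hval x hax hx _ hz).2,
      ((hc.site (w x).val).2 (by rw [hz]; exact hmem x hax hx)).2.2]
  refine ⟨hAw.symm, hdist, hcell, ?_, ?_⟩
  · intro x y hx1 hx2 hy1 hy2 d e hd he hde
    have hβ := h.code a ha
    have hγ := h.code n le_rfl
    have hle := hc.le hβ hγ
    have hρ : withoutLetters k A hle ≤ T.shapeLE n := fun d hd => hle (mem_withoutLetters.1 hd).1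
    have hs := hc.isHorizontalStrip hβ hγ hρ fun d h1 h2 => by
      by_contra h3
      exact h2 (mem_withoutLetters.2 ⟨h1, h3⟩)
    have hd' := ((hcell x hx1 hx2 d).1 hd).2
    have he' := ((hcell y hy1 hy2 e).1 he).2
    exact hs.2 d e (mem_letterCells.1 hd').1 (fun h => (mem_withoutLetters.1 h).2 hd')
      (mem_letterCells.1 he').1 (fun h => (mem_withoutLetters.1 h).2 he') hde
  · intro x y hax hxy hy d e hd he
    refine readBefore_of_cont_lt ((hcell x hax (by omega) d).1 hd.1).2
      ((hcell y (by omega) hy e).1 he.1).2 ?_ x y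
    rw [hlow x hax (by omega) d hd, hlow y (by omega) hy e he]
    exact hkey x y hax hxy hy

/-- The residues of the cells holding letters of a block. -/
def blockResidues (k : ℕ) (T : SetValuedTableau) (S : Finset ℕ) : Finset (ZMod (k + 1)) :=
  (T.shape.cells.filter (fun c => ∃ a ∈ S, a ∈ T.entry c)).image (residue k)

/-- The conditions on a block of letters of an affine set-valued tableau. -/
def BlockCond (k : ℕ) (T : SetValuedTableau) (S : Finset ℕ) (m : ℕ) : Prop :=
  (∀ a ∈ S, ∀ b ∈ S, a < b →
    ∀ c d, IsLowestOccurrence T a c → IsLowestOccurrence T b d → ReadBefore a c b d) ∧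
  (blockResidues k T S).card = m ∧
  (∀ c d, (∃ a ∈ S, a ∈ T.entry c) → (∃ b ∈ S, b ∈ T.entry d) → c.2 = d.2 → c = d)

theorem isAffineSV_iff {α : List ℕ} : IsAffineSV k α T ↔
    IsStandardAffineSV k α.sum T ∧ ∀ x : Fin α.length, BlockCond k T (alphabet α x) α[x] :=
  Iff.rfl

theorem mem_blockResidues {S : Finset ℕ} {i : ZMod (k + 1)} :
    i ∈ blockResidues k T S ↔ ∃ a ∈ S, ∃ c, a ∈ T.entry c ∧ residue k c = i := by
  simp only [blockResidues, Finset.mem_image, Finset.mem_filter, YoungDiagram.mem_cells]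
  constructor
  · rintro ⟨c, ⟨-, a, ha, hc⟩, rfl⟩
    exact ⟨a, ha, c, hc, rfl⟩
  · rintro ⟨a, ha, c, hc, rfl⟩
    exact ⟨c, ⟨(T.nonempty_iff c).1 ⟨a, hc⟩, a, ha, hc⟩, rfl⟩

theorem blockCond_restrict {N m : ℕ} {S : Finset ℕ} (hS : ∀ a ∈ S, a ≤ N) :
    BlockCond k (T.restrict N) S m ↔ BlockCond k T S m := by
  have h1 : ∀ a ∈ S, ∀ c, a ∈ (T.restrict N).entry c ↔ a ∈ T.entry c := fun a ha c => by
    rw [mem_entry_restrict, and_iff_left (hS a ha)]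
  have h2 : ∀ a ∈ S, ∀ c, IsLowestOccurrence (T.restrict N) a c ↔ IsLowestOccurrence T a c :=
    fun a ha c => by simp only [IsLowestOccurrence, h1 a ha]
  have h3 : ∀ c, (∃ a ∈ S, a ∈ (T.restrict N).entry c) ↔ ∃ a ∈ S, a ∈ T.entry c := fun c =>
    exists_congr fun a => and_congr_right fun ha => h1 a ha c
  have h4 : blockResidues k (T.restrict N) S = blockResidues k T S := by
    ext i
    rw [mem_blockResidues, mem_blockResidues]
    exact exists_congr fun a => and_congr_right fun ha => by simp only [h1 a ha]
  simp only [BlockCond, h3, h4]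
  refine and_congr_left fun _ => ?_
  constructor
  · intro h a ha b hb hab c d hc hd
    exact h a ha b hb hab c d ((h2 a ha c).2 hc) ((h2 b hb d).2 hd)
  · intro h a ha b hb hab c d hc hd
    exact h a ha b hb hab c d ((h2 a ha c).1 hc) ((h2 b hb d).1 hd)

theorem IsChain.blockResidues_eq (h : IsChain k n T F w) (hex : ∀ x < n, ∃ c, x + 1 ∈ T.entry c)
    (a : ℕ) : blockResidues k T (Finset.Icc (1 + a) n) = (Finset.Ioc a n).image w := by
  ext i
  rw [mem_blockResidues, Finset.mem_image]
  simp only [Finset.mem_Icc, Finset.mem_Ioc]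
  constructor
  · rintro ⟨x, hx, c, hc, rfl⟩
    obtain ⟨x, rfl⟩ := Nat.exists_eq_add_of_le' (show 1 ≤ x by omega)
    exact ⟨x + 1, ⟨by omega, hx.2⟩, ((h.mem_iff x hx.2 c).1 hc).2.symm⟩
  · rintro ⟨x, hx, rfl⟩
    obtain ⟨x, rfl⟩ := Nat.exists_eq_add_of_le' (show 1 ≤ x by omega)
    obtain ⟨c, hc⟩ := hex x hx.2
    exact ⟨x + 1, ⟨by omega, hx.2⟩, c, hc, ((h.mem_iff x hx.2 c).1 hc).2⟩

theorem IsStandardAffineSV.exists_mem (h : IsStandardAffineSV k n T) :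
    ∀ x < n, ∃ c, x + 1 ∈ T.entry c := by
  intro x hx
  obtain ⟨-, i, ⟨c, hc⟩, hi⟩ := h.2 (x + 1) (by simp; omega)
  exact ⟨c, (hi c).2 hc⟩

/-- This translates the three conditions on a block into one row transition whose letters are listed
by increasing key. -/
theorem IsChain.blockCond_iff (hk : 0 < k) (h : IsChain k n T F w)
    (hex : ∀ x < n, ∃ c, x + 1 ∈ T.entry c) {a m : ℕ} (ha : a + m = n) :
    BlockCond k T (Finset.Icc (1 + a) n) m ↔ ∃ A c, A.card = m ∧ IsRow k A (F a) (F n) c ∧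
      (∀ x, a < x → x ≤ n → w x ∈ A) ∧
      ∀ x y, a < x → x < y → y ≤ n → keyOf k c (w x) < keyOf k c (w y) := by
  rw [BlockCond, h.blockResidues_eq hex]
  simp only [Finset.mem_Icc]
  constructor
  · rintro ⟨h1, h2, h3⟩
    -- There are `m` letters with `m` residues in total, so no residue is repeated.
    have hinj : Set.InjOn w (Finset.Ioc a n) := by
      apply Finset.card_image_iff.1
      rw [h2, Nat.card_Ioc]
      omega
    obtain ⟨c, hc, hkey⟩ := h.exists_keyOf_lt hk (by omega : a ≤ n)
      (fun x y hx hxy hy heq => hxy.ne (hinj (by simp; omega) (by simp; omega) heq))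
      (fun x y hx hx' hy hy' c d hc hd =>
        h3 c d ⟨x, ⟨by omega, hx'⟩, hc⟩ ⟨y, ⟨by omega, hy'⟩, hd⟩)
      (fun x y hx hxy hy => h1 x (by omega) y (by omega) hxy)
    exact ⟨_, c, h2, hc, fun x hx hx' =>
      Finset.mem_image_of_mem _ (Finset.mem_Ioc.2 ⟨hx, hx'⟩), hkey⟩
  · rintro ⟨A, c, hA, hc, hmem, hkey⟩
    obtain ⟨e, -, -, h3, h4⟩ := h.of_keyOf_lt hk (by omega : a ≤ n) (by omega) hc hmem hkey
    refine ⟨fun x hx y hy hxy => h4 x y (by omega) hxy hy.2, e ▸ hA, ?_⟩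
    rintro c d ⟨x, hx, hc⟩ ⟨y, hy, hd⟩
    exact h3 x y (by omega) hx.2 (by omega) hy.2 c d hc hd

end Blocks

/-! ### The recursion for the numbers of tableaux -/

section Extension

open SetValuedTableau

variable {k : ℕ} {A : Finset (ZMod (k + 1))} {f g c : ℤ → ℤ} {β γ : YoungDiagram}
  {T : SetValuedTableau}

/-- A new largest letter respects the row and column conditions because its cells are corners:
nothing lies to the right of them or above them. -/
theorem exists_addLetter {M : ℕ} (hT : ∀ c, T.entry c ⊆ Finset.Icc 1 M) (hle : T.shape ≤ γ)
    (P : ℕ × ℕ → Prop) (hP : ∀ d, P d → IsRemovable γ d) (hnew : ∀ d, d ∈ γ → d ∉ T.shape → P d) :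
    ∃ T' : SetValuedTableau, T'.shape = γ ∧ T'.restrict M = T ∧
      (∀ c, T'.entry c ⊆ Finset.Icc 1 (M + 1)) ∧ ∀ d, M + 1 ∈ T'.entry d ↔ P d := by
  classical
  have hmem : ∀ c a, a ∈ T.entry c → c ∈ T.shape ∧ a ≤ M := fun c a ha =>
    ⟨(T.nonempty_iff c).1 ⟨a, ha⟩, (Finset.mem_Icc.1 (hT c ha)).2⟩
  have hent : ∀ c a, a ∈ T.entry c ∪ (if P c then {M + 1} else ∅) ↔
      a ∈ T.entry c ∨ (P c ∧ a = M + 1) := by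
    intro c a
    split_ifs with h <;> simp [h, or_comm]
  refine ⟨⟨γ, fun c => T.entry c ∪ (if P c then {M + 1} else ∅), fun c => ?_, ?_, ?_⟩, rfl, ?_, ?_,
    fun d => ?_⟩
  · constructor
    · rintro ⟨a, ha⟩
      rcases (hent c a).1 ha with h | ⟨h, -⟩
      · exact hle (hmem c a h).1
      · exact (hP c h).1
    · intro hc
      by_cases h : c ∈ T.shape
      · obtain ⟨a, ha⟩ := (T.nonempty_iff c).2 h
        exact ⟨a, (hent c a).2 (.inl ha)⟩
      · exact ⟨M + 1, (hent c _).2 (.inr ⟨hnew c hc h, rfl⟩)⟩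
  · intro i j j' hj a ha b hb
    have hγ : ∀ b, (b ∈ T.entry (i, j') ∨ (P (i, j') ∧ b = M + 1)) → (i, j') ∈ γ := by
      rintro b (h | ⟨h, -⟩)
      · exact hle (hmem _ _ h).1
      · exact (hP _ h).1
    rcases (hent _ a).1 ha with h | ⟨h, -⟩
    · rcases (hent _ b).1 hb with h' | ⟨-, rfl⟩
      · exact T.row_weak i j j' hj a h b h'
      · exact (hmem _ _ h).2.trans (Nat.le_succ M)
    · exact absurd (γ.up_left_mem le_rfl (show j + 1 ≤ j' by omega) (hγ b ((hent _ b).1 hb)))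
        (hP _ h).2.1
  · intro i i' j hi a ha b hb
    have hγ : ∀ b, (b ∈ T.entry (i', j) ∨ (P (i', j) ∧ b = M + 1)) → (i', j) ∈ γ := by
      rintro b (h | ⟨h, -⟩)
      · exact hle (hmem _ _ h).1
      · exact (hP _ h).1
    rcases (hent _ a).1 ha with h | ⟨h, -⟩
    · rcases (hent _ b).1 hb with h' | ⟨-, rfl⟩
      · exact T.col_strict i i' j hi a h b h'
      · exact Nat.lt_succ_of_le (hmem _ _ h).2
    · exact absurd (γ.up_left_mem (show i + 1 ≤ i' by omega) le_rfl (hγ b ((hent _ b).1 hb)))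
        (hP _ h).2.2
  · apply ext_entry
    funext c
    ext a
    rw [mem_entry_restrict]
    simp only [hent]
    constructor
    · rintro ⟨h | ⟨-, rfl⟩, h'⟩
      · exact h
      · omega
    · exact fun h => ⟨.inl h, (hmem c a h).2⟩
  · intro c a ha
    rcases (hent c a).1 ha with h | ⟨-, rfl⟩
    · exact Finset.Icc_subset_Icc_right (Nat.le_succ M) (hT c h)
    · simp
  · rw [hent]
    constructor
    · rintro (h | ⟨h, -⟩)
      · exact absurd (hmem _ _ h).2 (by omega)
      · exact h
    · exact fun h => .inr ⟨h, rfl⟩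

theorem isStandardAffineSV_iff_restrict {M n : ℕ} (hM : M ≤ n) : IsStandardAffineSV k n T ↔
    IsStandardAffineSV k M (T.restrict M) ∧ (∀ c, T.entry c ⊆ Finset.Icc 1 n) ∧
      ∀ x, M < x → x ≤ n → IsCore (k + 1) (T.shapeLE x) ∧ ∃ i : ZMod (k + 1),
        (∃ c, IsRemovable (T.shapeLE x) c ∧ residue k c = i) ∧
        ∀ c, x ∈ T.entry c ↔ IsRemovable (T.shapeLE x) c ∧ residue k c = i := by
  have h2 : ∀ x ≤ M, ∀ c, x ∈ (T.restrict M).entry c ↔ x ∈ T.entry c := fun x hx c => by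
    rw [mem_entry_restrict, and_iff_left hx]
  constructor
  · rintro ⟨h, h'⟩
    refine ⟨⟨fun c a ha => ?_, fun x hx => ?_⟩, h, fun x h3 h4 => h' x (by simp; omega)⟩
    · rw [mem_entry_restrict] at ha
      have := Finset.mem_Icc.1 (h c ha.1)
      exact Finset.mem_Icc.2 ⟨this.1, ha.2⟩
    · rw [Finset.mem_Icc] at hx
      simp only [shapeLE_restrict T hx.2, h2 x hx.2]
      exact h' x (by simp; omega)
  · rintro ⟨⟨-, h⟩, h', h3⟩
    refine ⟨h', fun x hx => ?_⟩
    rw [Finset.mem_Icc] at hx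
    by_cases hxM : x ≤ M
    · have := h x (by simp; omega)
      simpa only [shapeLE_restrict T hxM, h2 x hxM] using this
    · exact h3 x (by omega) hx.2

theorem restrict_restrict {a b : ℕ} (h : a ≤ b) : (T.restrict b).restrict a = T.restrict a := by
  apply ext_entry
  funext c
  ext x
  simp only [mem_entry_restrict]
  exact ⟨fun ⟨⟨h1, _⟩, h3⟩ => ⟨h1, h3⟩, fun ⟨h1, h3⟩ => ⟨⟨h1, h3.trans h⟩, h3⟩⟩

theorem restrict_eq_self {n : ℕ} (h : ∀ c, T.entry c ⊆ Finset.Icc 1 n) : T.restrict n = T := by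
  apply ext_entry
  funext c
  ext x
  rw [mem_entry_restrict]
  exact ⟨And.left, fun hx => ⟨hx, (Finset.mem_Icc.1 (h c hx)).2⟩⟩

/-- Induction on the size of `A`, peeling off the residue with the largest key: it belongs to the
last letter of the block, which is then added to the tableau of the smaller row. -/
theorem exists_extension (hk : 0 < k) {a : ℕ} (hT : IsStandardAffineSV k a T)
    (hβ : IsCode k T.shape f) (m : ℕ) : ∀ (A : Finset (ZMod (k + 1))) (g c : ℤ → ℤ)
      (γ : YoungDiagram), A.card = m → IsRow k A f g c → IsCode k γ g →
      ∃ T' : SetValuedTableau, T'.shape = γ ∧ T'.restrict a = T ∧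
        IsStandardAffineSV k (a + m) T' ∧ ∃ w : ℕ → ZMod (k + 1),
          (∀ x, a < x → x ≤ a + m → w x ∈ A ∧ ∀ d, x ∈ T'.entry d → residue k d = w x) ∧
          ∀ x y, a < x → x < y → y ≤ a + m → keyOf k c (w x) < keyOf k c (w y) := by
  induction m with
  | zero =>
    intro A g c γ hA hc hγ
    obtain rfl := Finset.card_eq_zero.1 hA
    obtain ⟨-, rfl⟩ := (IsRow.refl hβ.quasi).unique hc
    exact ⟨T, hβ.injective hγ, restrict_eq_self hT.1, hT, 0, fun x h1 h2 => absurd h2 (by omega),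
      fun x y h1 h2 h3 => absurd h3 (by omega)⟩
  | succ m ih =>
    intro A g c γ hA hc hγ
    obtain ⟨i, hiA, himax⟩ := Finset.exists_max_image A (keyOf k c)
      (Finset.card_pos.1 (by omega))
    -- If `i + 1` were in `A`, its key would exceed the maximal one.
    have hi1 : i + 1 ∉ A := fun h => by
      have h1 := hc.keyOf_lt h
      have h2 := himax _ h
      omega
    have hc' : IsRow k (insert i (A.erase i)) f g c := by rwa [Finset.insert_erase hiA]
    obtain ⟨g0, c0, hc0, he, hcc⟩ := hc'.exists_of_insert hk hβ.quasi (Finset.notMem_erase i A)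
      fun h => hi1 (Finset.mem_of_mem_erase h)
    obtain ⟨γ0, hγ0⟩ := hc0.exists_core hβ (hc0.quasi_target hβ.quasi)
    -- The two carries differ only at residue `i + 1`, while the key of `j` looks at residue `j +
    -- 1`.
    have hkey : ∀ j ∈ A.erase i, keyOf k c0 j = keyOf k c j := by
      intro j hj
      rw [keyOf, keyOf, hcc]
      rw [intCast_add_one, intCast_val]
      exact fun h => Finset.ne_of_mem_erase hj (add_right_cancel h)
    obtain ⟨T0, hs0, hr0, hst0, w, hw, hw'⟩ := ih _ _ _ γ0
      (by rw [Finset.card_erase_of_mem hiA]; omega) hc0 hγ0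
    obtain ⟨γ', hγ', hle, hnew, hex⟩ := he.exists_core hk hγ0
    obtain rfl := hγ'.injective hγ
    obtain ⟨T', hs', hr', hent', hmem'⟩ := exists_addLetter hst0.1 (hs0 ▸ hle)
      (fun d => IsRemovable γ' d ∧ residue k d = i) (fun d hd => hd.1) (hs0 ▸ hnew)
    have hshape : T'.shapeLE (a + m + 1) = γ' := by rw [shapeLE_eq_shape hent', hs']
    have hold : ∀ x ≤ a + m, ∀ d, x ∈ T'.entry d ↔ x ∈ T0.entry d := by
      intro x hx d
      rw [← hr', mem_entry_restrict, and_iff_left hx]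
    refine ⟨T', hs', ?_, ?_, Function.update w (a + m + 1) i, ?_, ?_⟩
    · rw [← restrict_restrict (Nat.le_add_right a m), hr', hr0]
    · refine (isStandardAffineSV_iff_restrict (Nat.le_succ (a + m))).2 ⟨hr' ▸ hst0, hent', ?_⟩
      intro x h1 h2
      obtain rfl : x = a + m + 1 := by omega
      rw [hshape]
      exact ⟨hγ.isCore, i, hex, hmem'⟩
    · intro x h1 h2
      by_cases hx : x = a + m + 1
      · subst hx
        rw [Function.update_self]
        exact ⟨hiA, fun d hd => ((hmem' d).1 hd).2⟩
      · rw [Function.update_of_ne hx]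
        obtain ⟨h3, h4⟩ := hw x h1 (by omega)
        exact ⟨Finset.mem_of_mem_erase h3, fun d hd => h4 d ((hold x (by omega) d).1 hd)⟩
    · intro x y h1 h2 h3
      have hx := (hw x h1 (by omega)).1
      rw [Function.update_of_ne (by omega : x ≠ a + m + 1)]
      by_cases hy : y = a + m + 1
      · subst hy
        rw [Function.update_self]
        exact lt_of_le_of_ne (himax _ (Finset.mem_of_mem_erase hx)) fun h =>
          Finset.ne_of_mem_erase hx (keyOf_injective k c h)
      · rw [Function.update_of_ne hy]
        have := hw' x y h1 h2 (by omega)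
        rwa [hkey _ hx, hkey _ (hw y (by omega) (by omega)).1] at this

theorem isAffineSV_append_iff {α : List ℕ} {r : ℕ} : IsAffineSV k (α ++ [r]) T ↔
    IsAffineSV k α (T.restrict α.sum) ∧ IsStandardAffineSV k (α.sum + r) T ∧
      BlockCond k T (Finset.Icc (1 + α.sum) (α.sum + r)) r := by
  have hsum : (α ++ [r]).sum = α.sum + r := by simp
  have halph : ∀ x : ℕ, x < α.length → alphabet (α ++ [r]) x = alphabet α x := by
    intro x hx
    rw [alphabet, alphabet, List.take_append_of_le_length (by omega),
      List.take_append_of_le_length (by omega)]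
  have hle : ∀ x : ℕ, ∀ a ∈ alphabet α x, a ≤ α.sum := by
    intro x a ha
    refine (Finset.mem_Icc.1 ha).2.trans ?_
    have := List.sum_take_add_sum_drop α (x + 1)
    omega
  have hlast : alphabet (α ++ [r]) α.length = Finset.Icc (1 + α.sum) (α.sum + r) := by
    rw [alphabet, List.take_left, List.take_of_length_le (by simp), hsum]
  rw [isAffineSV_iff, isAffineSV_iff, hsum]
  constructor
  · rintro ⟨h1, h2⟩
    refine ⟨⟨((isStandardAffineSV_iff_restrict (Nat.le_add_right _ _)).1 h1).1, fun x => ?_⟩, h1, ?_⟩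
    · have := h2 ⟨x, by simp⟩
      rw [blockCond_restrict (hle x)]
      simpa [halph x x.2] using this
    · have := h2 ⟨α.length, by simp⟩
      simpa [hlast] using this
  · rintro ⟨⟨-, h2⟩, h1, h3⟩
    refine ⟨h1, fun x => ?_⟩
    by_cases hx : (x : ℕ) < α.length
    · have := h2 ⟨x, hx⟩
      rw [blockCond_restrict (hle x)] at this
      simp only [halph x hx]
      convert this using 1
      simp [List.getElem_append_left hx]
    · have hx' : (x : ℕ) = α.length := by
        have := x.2
        simp only [List.length_append, List.length_singleton] at this
        omega
      simp only [hx', hlast]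
      convert h3 using 1
      simp [hx']

end Extension

/-! ### Counting tableaux by their last block -/

section Recursion

open SetValuedTableau

variable {k : ℕ}

theorem IsRow.residues_subset {A : Finset (ZMod (k + 1))} {f g c : ℤ → ℤ} {β γ : YoungDiagram}
    (h : IsRow k A f g c) (hβ : IsCode k β f) (hγ : IsCode k γ g) : residues k γ β ⊆ A := by
  intro i hi
  rw [← intCast_val i] at hi ⊢
  exact ((h.mem_residues_iff hβ hγ _).1 hi).1

theorem IsRow.boundedSize_le {A : Finset (ZMod (k + 1))} {f g c : ℤ → ℤ} {β γ : YoungDiagram}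
    (h : IsRow k A f g c) (hβ : IsCode k β f) (hγ : IsCode k γ g) :
    boundedSize k γ ≤ boundedSize k β + A.card := by
  have hs := h.isHorizontalStrip hβ hγ (h.le hβ hγ) fun d h1 h2 => absurd h1 h2
  rw [h.boundedSize_eq hβ hγ hs]
  exact Nat.add_le_add_left (Finset.card_le_card (h.residues_subset hβ hγ)) _

theorem boundedSize_bot (k : ℕ) : boundedSize k ⊥ = 0 := by simp [boundedSize]

theorem IsStandardAffineSV.boundedSize_le (hk : 0 < k) {n : ℕ} {T : SetValuedTableau}
    (h : IsStandardAffineSV k n T) : boundedSize k T.shape ≤ n := by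
  obtain ⟨F, w, hc⟩ := h.exists_chain hk
  have key : ∀ x ≤ n, boundedSize k (T.shapeLE x) ≤ x := by
    intro x hx
    induction x with
    | zero => rw [shapeLE_zero h.1, boundedSize_bot]
    | succ x ih =>
      have h1 := hc.code x (by omega)
      have h2 := ((hc.exch x hx).isRow hk h1.quasi).boundedSize_le h1 (hc.code _ hx)
      rw [Finset.card_singleton] at h2
      have := ih (by omega)
      omega
  rw [← shapeLE_eq_shape h.1]
  exact key n le_rfl

open Classical in
/-- The number of row transitions of size `r` between two bounded partitions. -/
noncomputable def rowCount (r : ℕ) (lam mu : BddPartition k) : ℕ :=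
  (Finset.univ.filter fun A : Finset (ZMod (k + 1)) =>
    A.card = r ∧ Step k A (code lam) (code mu)).card

theorem mem_partitionsUpTo {n : ℕ} {μ : BddPartition k} :
    μ ∈ partitionsUpTo k n ↔ μ.1.card ≤ n := by
  simp [partitionsUpTo]

/-- A finite set of integers has only one increasing enumeration, so the residue set of a block
determines which letter has which residue. -/
theorem eqOn_of_strictMonoOn_image_eq {α : Type*} {key : α → ℤ} (hkey : Function.Injective key)
    {w w' : ℕ → α} {a m : ℕ} {A : Finset α} (hA : A.card = m)
    (hw : ∀ x, a < x → x ≤ a + m → w x ∈ A) (hw' : ∀ x, a < x → x ≤ a + m → w' x ∈ A)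
    (h : ∀ x y, a < x → x < y → y ≤ a + m → key (w x) < key (w y))
    (h' : ∀ x y, a < x → x < y → y ≤ a + m → key (w' x) < key (w' y)) {x : ℕ} (hx : a < x)
    (hx' : x ≤ a + m) : w x = w' x := by
  have hcard : (A.image key).card = m := by rw [Finset.card_image_of_injective _ hkey, hA]
  have e1 := Finset.orderEmbOfFin_unique hcard (f := fun j : Fin m => key (w (a + 1 + j)))
    (fun j => Finset.mem_image_of_mem _ (hw _ (by omega) (by omega)))
    (fun i j hij => h _ _ (by omega) (by have : (i : ℕ) < j := hij; omega) (by omega))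
  have e2 := Finset.orderEmbOfFin_unique hcard (f := fun j : Fin m => key (w' (a + 1 + j)))
    (fun j => Finset.mem_image_of_mem _ (hw' _ (by omega) (by omega)))
    (fun i j hij => h' _ _ (by omega) (by have : (i : ℕ) < j := hij; omega) (by omega))
  have e := congrFun (e1.trans e2.symm) ⟨x - (a + 1), by omega⟩
  simp only [show a + 1 + (x - (a + 1)) = x by omega] at e
  exact hkey e

/-- The set of affine set-valued tableaux of given shape and weight. -/
def tableaux (k : ℕ) (μ : BddPartition k) (α : List ℕ) : Set SetValuedTableau :=
  {T | T.shape = coreOf k μ ∧ IsAffineSV k α T}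

theorem svKostka_eq (μ : BddPartition k) (α : List ℕ) :
    svKostka k μ α = (tableaux k μ α).ncard := rfl

theorem exists_row_of_mem_tableaux (hk : 0 < k) {μ : BddPartition k} {α : List ℕ} {r : ℕ}
    {T : SetValuedTableau} (hT : T ∈ tableaux k μ (α ++ [r])) :
    ∃ lam ∈ partitionsUpTo k α.sum, T.restrict α.sum ∈ tableaux k lam α ∧
      ∃ (c : ℤ → ℤ) (w : ℕ → ZMod (k + 1)),
        (blockResidues k T (Finset.Icc (1 + α.sum) (α.sum + r))).card = r ∧
        IsRow k (blockResidues k T (Finset.Icc (1 + α.sum) (α.sum + r))) (code lam) (code μ) c ∧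
        (∀ x, α.sum < x → x ≤ α.sum + r →
          w x ∈ blockResidues k T (Finset.Icc (1 + α.sum) (α.sum + r))) ∧
        (∀ x y, α.sum < x → x < y → y ≤ α.sum + r → keyOf k c (w x) < keyOf k c (w y)) ∧
        ∀ x, α.sum < x → x ≤ α.sum + r → ∀ d, x ∈ T.entry d ↔ residue k d = w x ∧
          d ∈ letterCells k (blockResidues k T (Finset.Icc (1 + α.sum) (α.sum + r)))
            (coreOf k lam) (coreOf k μ) := by
  obtain ⟨hs, hT⟩ := hT
  obtain ⟨h1, h2, h3⟩ := isAffineSV_append_iff.1 hT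
  obtain ⟨F, w, hc⟩ := h2.exists_chain hk
  have hcard := h3.2.1
  obtain ⟨A, c, hA, hrow, hmem, hkey⟩ := (hc.blockCond_iff hk h2.exists_mem rfl).1 h3
  obtain ⟨e, -, hcell, -⟩ := hc.of_keyOf_lt hk (Nat.le_add_right _ _) (by rw [hA]) hrow hmem hkey
  rw [← hc.blockResidues_eq h2.exists_mem] at e
  subst e
  have hcode := hc.code α.sum (Nat.le_add_right _ _)
  obtain ⟨lam, hlam⟩ := exists_coreOf_eq hcode.isCore
  have e1 : F α.sum = code lam := hcode.unique (hlam ▸ isCode_code lam)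
  have hsh : T.shapeLE (α.sum + r) = coreOf k μ := by rw [shapeLE_eq_shape h2.1, hs]
  have e2 : F (α.sum + r) = code μ := (hc.code _ le_rfl).unique (hsh ▸ isCode_code μ)
  rw [e1, e2] at hrow
  rw [← hlam, hsh] at hcell
  refine ⟨lam, ?_, ⟨hlam.symm, h1⟩, c, w, hcard, hrow, hmem, hkey, hcell⟩
  rw [mem_partitionsUpTo, ← boundedSize_coreOf, hlam]
  exact h1.1.boundedSize_le hk

/-- The shapes and the residue set determine the carry, hence the keys, hence the order and the
cells of the letters of the last block. -/
theorem restrict_blockResidues_injOn (hk : 0 < k) (μ : BddPartition k) (α : List ℕ) (r : ℕ) :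
    Set.InjOn (fun T : SetValuedTableau =>
      (T.restrict α.sum, blockResidues k T (Finset.Icc (1 + α.sum) (α.sum + r))))
      (tableaux k μ (α ++ [r])) := by
  intro T1 hT1 T2 hT2 heq
  simp only [Prod.mk.injEq] at heq
  obtain ⟨hr, hres⟩ := heq
  have n1 := (isAffineSV_append_iff.1 hT1.2).2.1.1
  have n2 := (isAffineSV_append_iff.1 hT2.2).2.1.1
  obtain ⟨lam, -, ⟨hs1, -⟩, c, w, hcard, hrow, hmem, hkey, hcell⟩ := exists_row_of_mem_tableaux hk hT1
  obtain ⟨lam', -, ⟨hs2, -⟩, c', w', hcard', hrow', hmem', hkey', hcell'⟩ :=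
    exists_row_of_mem_tableaux hk hT2
  rw [hr] at hs1
  obtain rfl := coreOf_injective k (hs1.symm.trans hs2)
  rw [← hres] at hrow' hmem' hcell'
  obtain ⟨rfl, -⟩ := hrow.unique hrow'
  apply ext_entry
  funext d
  ext x
  by_cases hx : x ≤ α.sum
  · have h1 := mem_entry_restrict (T := T1) (N := α.sum) (a := x) (c := d)
    have h2 := mem_entry_restrict (T := T2) (N := α.sum) (a := x) (c := d)
    rw [and_iff_left hx] at h1 h2
    rw [← h1, ← h2, hr]
  · by_cases hx' : x ≤ α.sum + r
    · rw [hcell x (by omega) hx', hcell' x (by omega) hx',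
        eqOn_of_strictMonoOn_image_eq (keyOf_injective k c) hcard hmem hmem' hkey hkey'
          (by omega) hx']
    · exact ⟨fun h => absurd (Finset.mem_Icc.1 (n1 d h)).2 hx',
        fun h => absurd (Finset.mem_Icc.1 (n2 d h)).2 hx'⟩

theorem exists_mem_tableaux (hk : 0 < k) {lam μ : BddPartition k} {α : List ℕ} {r : ℕ}
    {T : SetValuedTableau} (hT : T ∈ tableaux k lam α) {A : Finset (ZMod (k + 1))}
    (hA : A.card = r) (h : Step k A (code lam) (code μ)) :
    ∃ T' ∈ tableaux k μ (α ++ [r]), T'.restrict α.sum = T ∧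
      blockResidues k T' (Finset.Icc (1 + α.sum) (α.sum + r)) = A := by
  obtain ⟨hs, hT⟩ := hT
  obtain ⟨c, hrow⟩ := h
  have hcode : IsCode k T.shape (code lam) := hs ▸ isCode_code lam
  obtain ⟨T', hs', hr', hst, w, hw, hkey⟩ := exists_extension hk hT.1
    hcode r A (code μ) c _ hA hrow (isCode_code μ)
  obtain ⟨F, w', hc⟩ := hst.exists_chain hk
  have hww : ∀ x, α.sum < x → x ≤ α.sum + r → w' x = w x := by
    intro x h1 h2
    obtain ⟨x, rfl⟩ := Nat.exists_eq_add_of_le' (show 1 ≤ x by omega)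
    obtain ⟨d, hd⟩ := hst.exists_mem x (by omega)
    rw [← (hw _ h1 h2).2 d hd, ((hc.mem_iff x (by omega) d).1 hd).2]
  have hsh : T'.shapeLE (α.sum + r) = coreOf k μ := by rw [shapeLE_eq_shape hst.1, hs']
  have hsh0 : T'.shapeLE α.sum = coreOf k lam := by
    rw [← hs, ← hr']
    rfl
  have e1 : F α.sum = code lam :=
    (hc.code _ (Nat.le_add_right _ _)).unique (hsh0 ▸ isCode_code lam)
  have e2 : F (α.sum + r) = code μ := (hc.code _ le_rfl).unique (hsh ▸ isCode_code μ)
  rw [← e1, ← e2] at hrow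
  have hmem' : ∀ x, α.sum < x → x ≤ α.sum + r → w' x ∈ A := fun x h1 h2 => by
    rw [hww x h1 h2]
    exact (hw x h1 h2).1
  have hkey' : ∀ x y, α.sum < x → x < y → y ≤ α.sum + r → keyOf k c (w' x) < keyOf k c (w' y) :=
    fun x y h1 h2 h3 => by
      rw [hww x h1 (by omega), hww y (by omega) h3]
      exact hkey x y h1 h2 h3
  have hblock := (hc.blockCond_iff hk hst.exists_mem rfl).2 ⟨A, c, hA, hrow, hmem', hkey'⟩
  refine ⟨T', ⟨hs', isAffineSV_append_iff.2 ⟨hr' ▸ hT, hst, hblock⟩⟩, hr', ?_⟩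
  rw [hc.blockResidues_eq hst.exists_mem]
  exact (hc.of_keyOf_lt hk (Nat.le_add_right _ _) (by rw [hA]) hrow hmem' hkey').1.symm

open Classical in
-- Removing the last block while keeping its residue set is a bijection onto pairs of a smaller
-- tableau and a row transition, sorted by the intermediate shape.
theorem svKostka_append_aux (hk : 0 < k) (μ : BddPartition k) (α : List ℕ) (r : ℕ)
    (hfin : ∀ lam, (tableaux k lam α).Finite) : (tableaux k μ (α ++ [r])).Finite ∧
      svKostka k μ (α ++ [r]) =
        ∑ lam ∈ partitionsUpTo k α.sum, svKostka k lam α * rowCount r lam μ := by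
  set Φ := fun T : SetValuedTableau =>
    (T.restrict α.sum, blockResidues k T (Finset.Icc (1 + α.sum) (α.sum + r))) with hΦ
  have hinj := restrict_blockResidues_injOn hk μ α r
  set D := (partitionsUpTo k α.sum).biUnion fun lam => (hfin lam).toFinset ×ˢ
    Finset.univ.filter fun A : Finset (ZMod (k + 1)) =>
      A.card = r ∧ Step k A (code lam) (code μ) with hD
  have himage : Φ '' tableaux k μ (α ++ [r]) = D := by
    ext ⟨T, A⟩
    simp only [hD, Set.mem_image, Finset.coe_biUnion, Set.mem_iUnion, Finset.mem_coe,
      Finset.mem_product, Set.Finite.mem_toFinset, Finset.mem_filter, Finset.mem_univ, true_and,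
      exists_prop, hΦ, Prod.mk.injEq]
    constructor
    · rintro ⟨T', hT', rfl, rfl⟩
      obtain ⟨lam, h1, h2, c, -, h3, h4, -⟩ := exists_row_of_mem_tableaux hk hT'
      exact ⟨lam, h1, h2, h3, c, h4⟩
    · rintro ⟨lam, -, h2, h3, h4⟩
      obtain ⟨T', h5, h6, h7⟩ := exists_mem_tableaux hk h2 h3 h4
      exact ⟨T', h5, h6, h7⟩
  refine ⟨Set.Finite.of_finite_image (himage ▸ D.finite_toSet) hinj, ?_⟩
  rw [svKostka_eq, ← hinj.ncard_image, himage, Set.ncard_coe_finset, hD,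
    Finset.card_biUnion]
  · refine Finset.sum_congr rfl fun lam _ => ?_
    rw [Finset.card_product, svKostka_eq, Set.ncard_eq_toFinset_card _ (hfin lam)]
    rfl
  · intro lam _ lam' _ hne
    rw [Function.onFun, Finset.disjoint_left]
    rintro ⟨T, A⟩ h1 h2
    simp only [Finset.mem_product, Set.Finite.mem_toFinset] at h1 h2
    exact hne (coreOf_injective k (h1.1.1.symm.trans h2.1.1))

/-- The empty partition. -/
def emptyPartition (k : ℕ) : BddPartition k := rowPartition 0 (Nat.zero_le k)

theorem emptyPartition_val (k : ℕ) : (emptyPartition k).1 = ⊥ := by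
  apply YoungDiagram.ext
  rfl

theorem coreOf_emptyPartition (k : ℕ) : coreOf k (emptyPartition k) = ⊥ := by
  obtain ⟨μ, hμ⟩ := exists_coreOf_eq (k := k) (isCore_bot (k + 1))
  have h : μ = emptyPartition k := by
    apply Subtype.ext
    rw [emptyPartition_val]
    apply ext_rowLen
    intro i
    rw [← (coreOf_spec k μ).2 i, hμ]
    have h0 : (⊥ : YoungDiagram).rowLen i = 0 := by
      rw [YoungDiagram.rowLen_eq_card]
      simp [YoungDiagram.row]
    rw [h0]
    simp [boundedRow, YoungDiagram.row]
  rw [← h, hμ]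

open Classical in
theorem tableaux_nil (μ : BddPartition k) : (tableaux k μ []).Finite ∧
    svKostka k μ [] = if μ = emptyPartition k then 1 else 0 := by
  have hent : ∀ T ∈ tableaux k μ [], (∀ c, T.entry c = ∅) ∧ μ = emptyPartition k := by
    rintro T ⟨h1, ⟨h2, -⟩, -⟩
    have h3 : ∀ c, T.entry c = ∅ := by
      intro c
      have := h2 c
      rw [Finset.Icc_eq_empty (by simp)] at this
      exact Finset.subset_empty.1 this
    refine ⟨h3, coreOf_injective k ?_⟩
    rw [coreOf_emptyPartition, ← h1]
    ext c
    simp [← T.nonempty_iff, h3]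
  have hsub : (tableaux k μ []).Subsingleton := by
    intro T hT T' hT'
    apply ext_entry
    funext c
    rw [(hent T hT).1, (hent T' hT').1]
  refine ⟨hsub.finite, ?_⟩
  rw [svKostka_eq]
  split_ifs with h
  · rw [Set.ncard_eq_one]
    refine ⟨⟨⊥, fun _ => ∅, by simp, by simp, by simp⟩, hsub.eq_singleton_of_mem ⟨?_, ⟨?_, ?_⟩, ?_⟩⟩
    · rw [h, coreOf_emptyPartition]
    · simp
    · intro x hx
      simp at hx
    · intro x
      exact x.elim0
  · rw [Set.ncard_eq_zero hsub.finite]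
    by_contra hne
    obtain ⟨T, hT⟩ := Set.nonempty_iff_ne_empty.2 hne
    exact h (hent T hT).2

theorem tableaux_finite (hk : 0 < k) (μ : BddPartition k) (α : List ℕ) :
    (tableaux k μ α).Finite := by
  induction α using List.reverseRecOn generalizing μ with
  | nil => exact (tableaux_nil μ).1
  | append_singleton α r ih => exact (svKostka_append_aux hk μ α r ih).1

theorem svKostka_append (hk : 0 < k) (μ : BddPartition k) (α : List ℕ) (r : ℕ) :
    svKostka k μ (α ++ [r]) =
      ∑ lam ∈ partitionsUpTo k α.sum, svKostka k lam α * rowCount r lam μ :=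
  (svKostka_append_aux hk μ α r fun lam => tableaux_finite hk lam α).2

end Recursion

/-! ### Triangularity -/

section Triangularity

variable {k : ℕ}

theorem IsRow.isHorizontalStrip_self {A : Finset (ZMod (k + 1))} {f g c : ℤ → ℤ}
    {β γ : YoungDiagram} (h : IsRow k A f g c) (hβ : IsCode k β f) (hγ : IsCode k γ g) :
    IsHorizontalStrip γ β :=
  h.isHorizontalStrip hβ hγ (h.le hβ hγ) fun _ h1 h2 => absurd h1 h2

theorem IsHorizontalStrip.rowLen_succ_le {β γ : YoungDiagram} (h : IsHorizontalStrip γ β) (i : ℕ) :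
    γ.rowLen (i + 1) ≤ β.rowLen i := by
  by_contra! hlt
  have h1 : (i + 1, β.rowLen i) ∈ γ := YoungDiagram.mem_iff_lt_rowLen.2 hlt
  have h2 : (i, β.rowLen i) ∈ γ := γ.up_left_mem (Nat.le_succ i) le_rfl h1
  have h3 : (i, β.rowLen i) ∉ β := fun h => lt_irrefl _ (YoungDiagram.mem_iff_lt_rowLen.1 h)
  have h4 : (i + 1, β.rowLen i) ∉ β := fun h => h3 (β.up_left_mem (Nat.le_succ i) le_rfl h)
  simpa using h.2 _ _ h1 h4 h2 h3 rfl

theorem rowLen_bot (i : ℕ) : (⊥ : YoungDiagram).rowLen i = 0 := by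
  rw [YoungDiagram.rowLen_eq_card]
  simp [YoungDiagram.row]

theorem le_of_rowLen_le {μ ν : YoungDiagram} (h : ∀ i, μ.rowLen i ≤ ν.rowLen i) : μ ≤ ν := by
  rintro ⟨i, j⟩ hc
  exact YoungDiagram.mem_iff_lt_rowLen.2 ((YoungDiagram.mem_iff_lt_rowLen.1 hc).trans_le (h i))

section RowOfPartitions

variable {A : Finset (ZMod (k + 1))} {lam mu : BddPartition k} {c : ℤ → ℤ} {r : ℕ}

theorem exists_isRow_of_rowCount_ne_zero (h : rowCount r lam mu ≠ 0) :
    ∃ A c, A.card = r ∧ IsRow k A (code lam) (code mu) c := by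
  classical
  obtain ⟨A, hA⟩ := Finset.card_ne_zero.1 h
  rw [Finset.mem_filter] at hA
  obtain ⟨-, h1, c, h2⟩ := hA
  exact ⟨A, c, h1, h2⟩

theorem IsRow.card_le (h : IsRow k A (code lam) (code mu) c) :
    mu.1.card ≤ lam.1.card + A.card := by
  rw [← boundedSize_coreOf, ← boundedSize_coreOf]
  exact h.boundedSize_le (isCode_code lam) (isCode_code mu)

theorem IsRow.val_le (h : IsRow k A (code lam) (code mu) c) : lam.1 ≤ mu.1 := by
  apply le_of_rowLen_le
  intro i
  rw [← (coreOf_spec k lam).2, ← (coreOf_spec k mu).2, boundedRow_of_strip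
    (h.isHorizontalStrip_self (isCode_code lam) (isCode_code mu)) (coreOf_spec k mu).1]
  exact Nat.le_add_right _ _

theorem IsRow.rowLen_coreOf_succ_le (h : IsRow k A (code lam) (code mu) c) (i : ℕ) :
    (coreOf k mu).rowLen (i + 1) ≤ (coreOf k lam).rowLen i :=
  (h.isHorizontalStrip_self (isCode_code lam) (isCode_code mu)).rowLen_succ_le i

end RowOfPartitions

theorem exists_of_svKostka_append_ne_zero (hk : 0 < k) {mu : BddPartition k} {α : List ℕ} {r : ℕ}
    (h : svKostka k mu (α ++ [r]) ≠ 0) :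
    ∃ lam, svKostka k lam α ≠ 0 ∧ rowCount r lam mu ≠ 0 := by
  rw [svKostka_append hk] at h
  obtain ⟨lam, -, hlam⟩ := Finset.exists_ne_zero_of_sum_ne_zero h
  exact ⟨lam, left_ne_zero_of_mul hlam, right_ne_zero_of_mul hlam⟩

theorem card_le_of_svKostka_ne_zero (hk : 0 < k) {mu : BddPartition k} {α : List ℕ}
    (h : svKostka k mu α ≠ 0) : mu.1.card ≤ α.sum := by
  obtain ⟨T, h1, h2⟩ := Set.nonempty_of_ncard_ne_zero h
  rw [← boundedSize_coreOf, ← h1]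
  exact h2.1.boundedSize_le hk

/-- Each block is a horizontal strip and so adds at most one row to the core. -/
theorem rowLen_of_svKostka_ne_zero (hk : 0 < k) {mu : BddPartition k} {α : List ℕ}
    (h : svKostka k mu α ≠ 0) : (coreOf k mu).rowLen α.length = 0 := by
  induction α using List.reverseRecOn generalizing mu with
  | nil =>
    rw [(tableaux_nil mu).2] at h
    have hmu : mu = emptyPartition k := by
      by_contra hne
      rw [if_neg hne] at h
      exact h rfl
    rw [hmu, coreOf_emptyPartition]
    exact rowLen_bot _
  | append_singleton α r ih =>
    obtain ⟨lam, h1, h2⟩ := exists_of_svKostka_append_ne_zero hk h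
    obtain ⟨A, c, -, hc⟩ := exists_isRow_of_rowCount_ne_zero h2
    have := hc.rowLen_coreOf_succ_le α.length
    rw [ih h1] at this
    rw [List.length_append, List.length_singleton]
    omega

/-- A new top row of `r` cells moves the bead at `-R` across the `r` gaps that follow it. The carry
holds the value `f (-R)` over these sites, leaves `-1` at each of them, and then sets it down. -/
theorem exists_isRow_topRow {β : YoungDiagram} {f : ℤ → ℤ} (hβ : IsCode k β f) {R r : ℕ}
    (hr : r ≤ k) (h0 : β.rowLen R = 0) (hR : ∀ i < R, r ≤ β.rowLen i) :
    ∃ A g c, A.card = r ∧ IsRow k A f g c ∧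
      ∀ j < r, ((-R + j : ℤ) : ZMod (k + 1)) ∈ A ∧ 0 ≤ c (-R + j) ∧ f (-R + j + 1) < 0 := by
  have hbead : ∀ x : ℤ, x ≤ -R → bead β x := by
    intro x hx
    have h1 := bead_rowLen_sub β (-x).toNat
    have h2 := β.rowLen_anti R (-x).toNat (by omega)
    rw [h0, Nat.le_zero] at h2
    rw [h2, show ((0 : ℕ) : ℤ) - (-x).toNat = x by omega] at h1
    exact h1
  have hnot : ∀ x : ℤ, -R < x → x ≤ -R + r → ¬ bead β x := by
    intro x h1 h2 hb
    have h3 := hb.eq_rowLen_sub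
    by_cases hi : diag β x < R
    · have := hR _ hi
      omega
    · have h4 := β.rowLen_anti R (diag β x) (by omega)
      omega
  have hf0 : 0 ≤ f (-R) := (hβ.bead_iff _).1 (hbead _ le_rfl)
  -- Position `-R + j` is a gap, but `k + 1` lower there is a bead since `j ≤ k`.
  have hf1 : ∀ j : ℕ, 1 ≤ j → j ≤ r → f (-R + j) = -1 := by
    intro j h1 h2
    have h3 := mt (hβ.bead_iff (-R + j)).2 (hnot _ (by omega) (by omega))
    have h4 := (hβ.bead_iff _).1 (hbead (-R + j - (k + 1)) (by omega))
    rw [hβ.quasi.sub] at h4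
    omega
  set A : Finset (ZMod (k + 1)) :=
    (Finset.range r).image fun j : ℕ => ((-R + j : ℤ) : ZMod (k + 1)) with hA
  have hinj : ∀ i j : ℕ, i < k + 1 → j < k + 1 →
      ((-R + i : ℤ) : ZMod (k + 1)) = ((-R + j : ℤ) : ZMod (k + 1)) → i = j := by
    intro i j hi hj he
    push_cast at he
    have := (ZMod.natCast_eq_natCast_iff' _ _ _).1 (add_left_cancel he)
    rwa [Nat.mod_eq_of_lt hi, Nat.mod_eq_of_lt hj] at this
  have hmem : ∀ j < k + 1, ((-R + j : ℤ) : ZMod (k + 1)) ∈ A ↔ j < r := by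
    intro j hj
    rw [hA, Finset.mem_image]
    constructor
    · rintro ⟨i, hi, hij⟩
      rw [Finset.mem_range] at hi
      rwa [← hinj i j (by omega) hj hij]
    · exact fun h => ⟨j, Finset.mem_range.2 h, rfl⟩
  -- One period of the carry `u` and of the new code `v`, starting at `-R`.
  set u : ℕ → ℤ := fun j => if j ≤ r then f (-R) else f (-R + j) with hu
  set v : ℕ → ℤ := fun j => if j < r then -1 else if j = r then f (-R) else f (-R + j) with hv
  have hu0 : u (k + 1) = u 0 - 1 := by
    have := hβ.quasi (-R)
    simp only [hu, Nat.zero_le, if_true, Nat.cast_add, Nat.cast_one]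
    rw [if_neg (by omega), this]
  have hshift : Quasi k fun x => extend k u (x + R) := fun x => by
    have := extend_quasi (k := k) u (x + R)
    rw [show x + R + ((k : ℤ) + 1) = x + (k + 1) + R by ring] at this
    exact this
  refine ⟨A, fun x => extend k v (x + R), fun x => extend k u (x + R), ?_, ⟨hshift, fun x => ?_⟩,
    fun j hj => ⟨(hmem j (by omega)).2 hj, ?_, ?_⟩⟩
  · rw [hA, Finset.card_image_of_injOn, Finset.card_range]
    intro i hi j hj hij
    simp only [Finset.coe_range, Set.mem_Iio] at hi hj
    exact hinj i j (by omega) (by omega) hij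
  · obtain ⟨j, q, hj, hx⟩ := exists_eq_add_mul k (x + R)
    obtain rfl : x = -R + j + (k + 1) * q := by linarith
    have e1 : -(R : ℤ) + j + (k + 1) * q + 1 + R = j + (k + 1) * q + 1 := by ring
    have e2 : -(R : ℤ) + j + (k + 1) * q + 1 = -R + (j + 1 : ℕ) + (k + 1) * q := by
      push_cast; ring
    simp only [hx, e1]
    rw [extend_apply _ hj, extend_apply _ hj, extend_apply_succ hu0 hj, e2, hβ.quasi.add_mul,
      intCast_add_mul, hmem j hj]
    apply Site.sub
    simp only [hu, hv]
    constructor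
    · intro hjr
      rw [if_neg (by omega : ¬ j < r), if_neg (by omega : ¬ j + 1 ≤ r)]
      refine ⟨?_, rfl⟩
      by_cases h : j = r
      · simp [h]
      · rw [if_neg h, if_neg (by omega)]
    · intro hjr
      rw [if_pos hjr, if_pos hjr.le, if_pos (by omega : j + 1 ≤ r), hf1 (j + 1) (by omega) hjr]
      omega
  · have := extend_apply (k := k) u (show j < k + 1 by omega) 0
    simp only [mul_zero, add_zero, sub_zero] at this
    beta_reduce
    rw [show -(R : ℤ) + j + R = j by ring, this]
    simp only [hu]
    rw [if_pos hj.le]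
    exact hf0
  · have := hf1 (j + 1) (by omega) hj
    push_cast at this
    rw [add_assoc, this]
    omega

theorem exists_rowLen_le {μ : YoungDiagram} {l : ℕ} (h : μ.rowLen l = 0) : μ.colLen 0 ≤ l := by
  by_contra! hlt
  have := YoungDiagram.mem_iff_lt_rowLen.1 (YoungDiagram.mem_iff_lt_colLen.2 hlt)
  omega

/-- The transition of `exists_isRow_topRow` lengthens row `R` of the bounded partition by at least
`r`, while the size may grow by at most `r`, so the result is `lam`. As the size grows by exactly
`r`, any such transition uses precisely the residues of the strip. -/
theorem rowCount_topRow {lam' lam : BddPartition k} {R r : ℕ} (h0 : (coreOf k lam').rowLen R = 0)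
    (hlam : ∀ i, lam.1.rowLen i = if i = R then r else lam'.1.rowLen i) :
    rowCount r lam' lam = 1 := by
  classical
  have hβ := isCode_code lam'
  have hlamR : lam.1.rowLen R = r := by rw [hlam, if_pos rfl]
  have hlam'R : lam'.1.rowLen R = 0 := by
    rw [← (coreOf_spec k lam').2]
    exact Nat.le_zero.1 (h0 ▸ boundedRow_le_rowLen k _ R)
  have hr : r ≤ k := hlamR ▸ (lam.1.rowLen_anti 0 R (Nat.zero_le R)).trans lam.2
  have hR : ∀ i < R, r ≤ (coreOf k lam').rowLen i := by
    intro i hi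
    have h1 := lam.1.rowLen_anti i R hi.le
    rw [hlamR, hlam, if_neg hi.ne, ← (coreOf_spec k lam').2] at h1
    exact h1.trans (boundedRow_le_rowLen k _ i)
  have hbound : ∀ i, ∃ N, i < N ∧ R < N ∧ lam'.1.colLen 0 ≤ N ∧ lam.1.colLen 0 ≤ N := fun i =>
    ⟨i + 1 + (R + 1) + lam'.1.colLen 0 + lam.1.colLen 0, by omega, by omega, by omega, by omega⟩
  have hsum : ∀ N, R < N → ∑ i ∈ Finset.range N, lam.1.rowLen i =
      ∑ i ∈ Finset.range N, lam'.1.rowLen i + r := by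
    intro N hN
    have h1 : ∀ i ∈ Finset.range N, lam.1.rowLen i = lam'.1.rowLen i + if i = R then r else 0 := by
      intro i _
      rw [hlam]
      split_ifs with h
      · rw [h, hlam'R, zero_add]
      · rfl
    rw [Finset.sum_congr rfl h1, Finset.sum_add_distrib, Finset.sum_ite_eq',
      if_pos (Finset.mem_range.2 hN)]
  have hcard : lam.1.card = lam'.1.card + r := by
    obtain ⟨N, -, h1, h2, h3⟩ := hbound 0
    rw [card_eq_sum_rowLen _ N h2, card_eq_sum_rowLen _ N h3, hsum N h1]
  obtain ⟨A, g, c, hA, hrow, hj⟩ := exists_isRow_topRow hβ hr h0 hR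
  obtain ⟨γ, hγ⟩ := hrow.exists_core hβ (hrow.quasi_target hβ.quasi)
  have hstrip := hrow.isHorizontalStrip_self hβ hγ
  have hinc := boundedRow_of_strip hstrip hγ.isCore
  have hRr : r ≤ boundedRow k γ R := by
    rw [hinc R]
    refine le_trans ?_ (Nat.le_add_left _ _)
    have himg : (Finset.range r).image (fun j => (R, j)) ⊆
        ((γ.cells \ (coreOf k lam').cells).filter
          fun c => bead (coreOf k lam') (cont c - k) ∧ c.1 = R) := by
      intro d hd
      obtain ⟨j, hjr, rfl⟩ := Finset.mem_image.1 hd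
      rw [Finset.mem_range] at hjr
      have hcont : cont (R, j) = -R + j := by simp only [cont]; ring
      obtain ⟨h1, h2, h3⟩ := hj j hjr
      have h4 := hrow.diag_eq hβ hγ (-R + j)
      rw [if_pos ⟨h1, h3, h2⟩] at h4
      have h5 : (R, j) ∉ coreOf k lam' := fun h => by
        have := YoungDiagram.mem_iff_lt_rowLen.1 h
        omega
      have h6 : diag (coreOf k lam') (-R + j) = R := by
        refine le_antisymm ?_ ?_
        · rw [mem_iff_lt_diag_cont, hcont] at h5
          exact not_lt.1 h5
        · by_contra! hlt
          have h7 := mt lt_diag.2 (lt_irrefl (diag (coreOf k lam') (-R + j)))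
          have := hR _ hlt
          omega
      rw [h6] at h4
      simp only [Finset.mem_filter, Finset.mem_sdiff, YoungDiagram.mem_cells, and_true]
      refine ⟨⟨?_, h5⟩, ?_⟩
      · rw [mem_iff_lt_diag_cont, hcont]
        simp only
        omega
      -- The position `k` below is at most `-R`, where every place is a bead, so this new cell
      -- counts for the bounded row.
      · rw [hcont]
        have h8 := bead_rowLen_sub (coreOf k lam') (R + k - j)
        have h9 := (coreOf k lam').rowLen_anti R (R + k - j) (by omega)
        rw [h0, Nat.le_zero] at h9
        rw [h9] at h8
        convert h8 using 1
        omega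
    have := Finset.card_le_card himg
    rwa [Finset.card_image_of_injective _ (fun a b h => (Prod.mk.inj h).2), Finset.card_range]
      at this
  obtain ⟨mu, rfl⟩ := exists_coreOf_eq hγ.isCore
  have hg : g = code mu := hγ.unique (isCode_code mu)
  subst hg
  have hmu : mu = lam := by
    have hle : ∀ i, lam.1.rowLen i ≤ mu.1.rowLen i := by
      intro i
      rw [← (coreOf_spec k mu).2, hlam]
      split_ifs with h
      · exact h ▸ hRr
      · rw [hinc i, (coreOf_spec k lam').2]
        exact Nat.le_add_right _ _
    have hsz := hrow.card_le
    rw [hA, ← hcard] at hsz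
    apply Subtype.ext
    apply YoungDiagram.ext
    exact (Finset.eq_of_subset_of_card_le (YoungDiagram.cells_subset_iff.2 (le_of_rowLen_le hle))
      hsz).symm
  subst hmu
  refine Finset.card_eq_one.2 ⟨residues k (coreOf k mu) (coreOf k lam'), ?_⟩
  have huniq : ∀ (B : Finset (ZMod (k + 1))) (d : ℤ → ℤ), B.card = r →
      IsRow k B (code lam') (code mu) d → B = residues k (coreOf k mu) (coreOf k lam') := by
    intro B d hB hd
    have h1 := hd.boundedSize_eq hβ hγ hstrip
    rw [boundedSize_coreOf, boundedSize_coreOf, hcard] at h1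
    exact (Finset.eq_of_subset_of_card_le (hd.residues_subset hβ hγ) (by omega)).symm
  ext B
  simp only [Finset.mem_filter, Finset.mem_univ, true_and, Finset.mem_singleton]
  constructor
  · rintro ⟨h1, d, h2⟩
    exact huniq B d h1 h2
  · rintro rfl
    rw [← huniq A c hA hrow]
    exact ⟨hA, c, hrow⟩

/-- The sum of the row indices of the cells. -/
def rowIndexSum (μ : YoungDiagram) : ℕ := ∑ c ∈ μ.cells, c.1

/-- The first `l` rows of a partition. -/
def truncate (μ : YoungDiagram) (l : ℕ) : YoungDiagram where
  cells := μ.cells.filter fun c => c.1 < l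
  isLowerSet := by
    rintro ⟨i, j⟩ ⟨i', j'⟩ ⟨hi, hj⟩ h
    simp only [Finset.coe_filter, Set.mem_ofPred_eq, YoungDiagram.mem_cells] at h ⊢
    simp only at hi hj
    exact ⟨μ.up_left_mem hi hj h.1, by omega⟩

theorem rowLen_truncate (μ : YoungDiagram) (l i : ℕ) :
    (truncate μ l).rowLen i = if i < l then μ.rowLen i else 0 := by
  apply eq_of_forall_lt_iff
  intro j
  rw [← YoungDiagram.mem_iff_lt_rowLen, ← YoungDiagram.mem_cells]
  simp only [truncate, Finset.mem_filter, YoungDiagram.mem_cells]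
  split_ifs with h
  · rw [YoungDiagram.mem_iff_lt_rowLen, and_iff_left h]
  · simp [h]

theorem filter_not_lt_eq_row {μ : YoungDiagram} {l : ℕ} (h : μ.rowLen (l + 1) = 0) :
    (μ.cells.filter fun c => ¬ c.1 < l) = μ.row l := by
  ext ⟨i, j⟩
  rw [YoungDiagram.mem_row_iff, Finset.mem_filter, YoungDiagram.mem_cells]
  refine and_congr_right fun hc => ?_
  have h1 := YoungDiagram.mem_iff_lt_rowLen.1 hc
  constructor
  · intro h2
    by_contra h3
    have h4 := μ.rowLen_anti (l + 1) i (by simp only at h2 h3; omega)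
    omega
  · rintro h2
    simp only at h2
    omega

theorem card_truncate {μ : YoungDiagram} {l : ℕ} (h : μ.rowLen (l + 1) = 0) :
    μ.card = (truncate μ l).card + μ.rowLen l := by
  rw [YoungDiagram.rowLen_eq_card, ← filter_not_lt_eq_row h]
  exact (Finset.card_filter_add_card_filter_not _).symm

theorem rowIndexSum_truncate {μ : YoungDiagram} {l : ℕ} (h : μ.rowLen (l + 1) = 0) :
    rowIndexSum μ = rowIndexSum (truncate μ l) + l * μ.rowLen l := by
  rw [YoungDiagram.rowLen_eq_card, ← filter_not_lt_eq_row h, rowIndexSum,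
    ← Finset.sum_filter_add_sum_filter_not μ.cells fun c => c.1 < l]
  congr 1
  rw [mul_comm, ← smul_eq_mul, ← Finset.sum_const]
  refine Finset.sum_congr rfl fun c hc => ?_
  rw [filter_not_lt_eq_row h] at hc
  exact (YoungDiagram.mem_row_iff.1 hc).2

/-- All added cells lie in rows up to `l`; the bound is attained only if they all lie in row `l`. -/
theorem rowIndexSum_le {μ ν : YoungDiagram} (hle : μ ≤ ν) {l : ℕ} (h : ν.rowLen (l + 1) = 0) :
    rowIndexSum ν ≤ rowIndexSum μ + l * (ν.card - μ.card) ∧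
      (rowIndexSum ν = rowIndexSum μ + l * (ν.card - μ.card) → ∀ c ∈ ν, c ∉ μ → c.1 = l) := by
  have hsub := YoungDiagram.cells_subset_iff.2 hle
  have hl : ∀ c ∈ ν.cells \ μ.cells, c.1 ≤ l := by
    rintro ⟨i, j⟩ hc
    rw [Finset.mem_sdiff, YoungDiagram.mem_cells] at hc
    have h1 := YoungDiagram.mem_iff_lt_rowLen.1 hc.1
    by_contra! h3
    have h4 := ν.rowLen_anti (l + 1) i h3
    omega
  have hcard : ∑ c ∈ ν.cells \ μ.cells, l = l * (ν.card - μ.card) := by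
    rw [Finset.sum_const, Finset.card_sdiff_of_subset hsub, smul_eq_mul, mul_comm]
  have hsum : rowIndexSum ν = rowIndexSum μ + ∑ c ∈ ν.cells \ μ.cells, c.1 := by
    rw [rowIndexSum, rowIndexSum, add_comm, Finset.sum_sdiff hsub]
  rw [hsum, ← hcard]
  refine ⟨Nat.add_le_add_left (Finset.sum_le_sum hl) _, fun heq c h1 h2 => ?_⟩
  exact (Finset.sum_eq_sum_iff_of_le hl).1 (Nat.add_left_cancel heq) c
    (Finset.mem_sdiff.2 ⟨(YoungDiagram.mem_cells _).2 h1, h2⟩)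

theorem sum_map_range_rowLen {μ : YoungDiagram} {l : ℕ} (h : μ.rowLen l = 0) :
    ((List.range l).map μ.rowLen).sum = μ.card := by
  rw [card_eq_sum_rowLen μ l (exists_rowLen_le h), Finset.sum_range, ← List.sum_ofFn]
  congr 1
  apply List.ext_getElem <;> simp

/-- After `l` blocks there are at most `l` rows, so the next block adds its cells in rows up to `l`.
When the degree equals the size of the weight, the row index sum is thus at most that of `lam`, with
equality only if every block forms a new top row. That succession is unique, and each of its steps
counts once by `rowCount_topRow`. -/
theorem svKostka_map_range (hk : 0 < k) (l : ℕ) : ∀ lam : BddPartition k, lam.1.rowLen l = 0 →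
    (∀ nu, svKostka k nu ((List.range l).map lam.1.rowLen) ≠ 0 → nu.1.card = lam.1.card →
      rowIndexSum nu.1 ≤ rowIndexSum lam.1 ∧
        (rowIndexSum nu.1 = rowIndexSum lam.1 → nu = lam)) ∧
      svKostka k lam ((List.range l).map lam.1.rowLen) = 1 := by
  induction l with
  | zero =>
    intro lam h
    have hlam : lam = emptyPartition k := by
      apply Subtype.ext
      apply ext_rowLen
      intro i
      rw [emptyPartition_val, rowLen_bot]
      exact Nat.le_zero.1 ((lam.1.rowLen_anti 0 i (Nat.zero_le i)).trans h.le)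
    have hnil := fun nu : BddPartition k => (tableaux_nil nu).2
    simp only [List.range_zero, List.map_nil]
    refine ⟨fun nu h1 _ => ?_, by rw [hnil, if_pos hlam]⟩
    have : nu = lam := by
      by_contra hne
      rw [hnil, ← hlam, if_neg hne] at h1
      exact h1 rfl
    exact ⟨by rw [this], fun _ => this⟩
  | succ l ih =>
    intro lam h
    set r := lam.1.rowLen l with hr
    set lam' : BddPartition k := ⟨truncate lam.1 l, by
      rw [rowLen_truncate]
      split_ifs
      · exact lam.2
      · exact Nat.zero_le k⟩ with hlam'
    have hrow : ∀ i, lam'.1.rowLen i = if i < l then lam.1.rowLen i else 0 := rowLen_truncate _ _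
    have hrl : lam'.1.rowLen l = 0 := by rw [hrow, if_neg (lt_irrefl l)]
    obtain ⟨ih1, ih2⟩ := ih lam' hrl
    set α := (List.range l).map lam'.1.rowLen with hα
    have hα' : (List.range (l + 1)).map lam.1.rowLen = α ++ [r] := by
      rw [List.range_succ, List.map_append, hα]
      congr 1
      refine List.map_congr_left fun i hi => ?_
      rw [hrow, if_pos (List.mem_range.1 hi)]
    have hαlen : α.length = l := by simp [hα]
    have hαsum : α.sum = lam'.1.card := sum_map_range_rowLen hrl
    have hcard : lam.1.card = lam'.1.card + r := card_truncate h
    have hidx : rowIndexSum lam.1 = rowIndexSum lam'.1 + l * r := rowIndexSum_truncate h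
    have hstep : ∀ nu' nu : BddPartition k, svKostka k nu' α ≠ 0 → rowCount r nu' nu ≠ 0 →
        nu.1.card = lam.1.card → nu.1.rowLen (l + 1) = 0 ∧ nu'.1 ≤ nu.1 ∧
          nu.1.card - nu'.1.card = r ∧ rowIndexSum nu'.1 ≤ rowIndexSum lam'.1 ∧
          (rowIndexSum nu'.1 = rowIndexSum lam'.1 → nu' = lam') := by
      intro nu' nu h1 h2 h3
      obtain ⟨A, c, hA, hc⟩ := exists_isRow_of_rowCount_ne_zero h2
      have h4 := hc.card_le
      have h5 := card_le_of_svKostka_ne_zero hk h1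
      have h6 := hc.rowLen_coreOf_succ_le l
      have h7 := rowLen_of_svKostka_ne_zero hk h1
      rw [hαlen] at h7
      have h8 := ih1 nu' h1 (by omega)
      refine ⟨?_, hc.val_le, by omega, h8⟩
      rw [← (coreOf_spec k nu).2]
      exact Nat.le_zero.1 ((boundedRow_le_rowLen k _ _).trans (h6.trans h7.le))
    rw [hα']
    refine ⟨fun nu h1 h2 => ?_, ?_⟩
    · obtain ⟨nu', h3, h4⟩ := exists_of_svKostka_append_ne_zero hk h1
      obtain ⟨h5, h6, h7, h8, h9⟩ := hstep nu' nu h3 h4 h2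
      obtain ⟨h10, h11⟩ := rowIndexSum_le h6 h5
      rw [h7] at h10 h11
      refine ⟨by omega, fun heq => ?_⟩
      obtain rfl := h9 (by omega)
      have h12 := h11 (by omega)
      have h13 : truncate nu.1 l = truncate lam.1 l := by
        apply YoungDiagram.ext
        ext c
        change c ∈ nu.1.cells.filter _ ↔ c ∈ lam.1.cells.filter _
        have h14 : c ∈ lam'.1 ↔ c ∈ lam.1.cells.filter fun c => c.1 < l := Iff.rfl
        rw [← h14, Finset.mem_filter, YoungDiagram.mem_cells]
        constructor
        · rintro ⟨h15, h16⟩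
          by_contra h17
          exact h16.ne (h12 c h15 h17)
        · exact fun h15 => ⟨h6 h15, (Finset.mem_filter.1 (h14.1 h15)).2⟩
      have h18 := card_truncate h5
      have h19 := card_truncate h
      rw [h13] at h18
      apply Subtype.ext
      apply ext_rowLen
      intro i
      rcases lt_trichotomy i l with hi | rfl | hi
      · have e1 := rowLen_truncate nu.1 l i
        have e2 := rowLen_truncate lam.1 l i
        rw [if_pos hi] at e1 e2
        rw [← e1, ← e2, h13]
      · omega
      · have e1 := nu.1.rowLen_anti (l + 1) i hi
        have e2 := lam.1.rowLen_anti (l + 1) i hi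
        omega
    · have hmem : lam' ∈ partitionsUpTo k α.sum := mem_partitionsUpTo.2 hαsum.ge
      have htop : rowCount r lam' lam = 1 := by
        refine rowCount_topRow (R := l) ?_ fun i => ?_
        · rw [← hαlen]
          exact rowLen_of_svKostka_ne_zero hk (by rw [ih2]; exact one_ne_zero)
        · rw [hrow]
          rcases lt_trichotomy i l with hi | rfl | hi
          · rw [if_neg hi.ne, if_pos hi]
          · rw [if_pos rfl]
          · rw [if_neg hi.ne', if_neg (by omega)]
            have := lam.1.rowLen_anti (l + 1) i hi
            omega
      rw [svKostka_append hk, Finset.sum_eq_single_of_mem lam' hmem, ih2, htop]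
      intro nu' _ hne
      by_contra h1
      obtain ⟨h5, h6, h7, h8, h9⟩ := hstep nu' lam (left_ne_zero_of_mul h1)
        (right_ne_zero_of_mul h1) rfl
      have h10 := (rowIndexSum_le h6 h5).1
      rw [h7] at h10
      exact hne (h9 (by omega))

theorem svKostka_rowLens_self (hk : 0 < k) (lam : BddPartition k) :
    svKostka k lam lam.1.rowLens = 1 :=
  (svKostka_map_range hk _ lam (rowLen_eq_zero le_rfl)).2

theorem sum_rowLens (μ : YoungDiagram) : μ.rowLens.sum = μ.card :=
  sum_map_range_rowLen (rowLen_eq_zero le_rfl)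

theorem svKostka_rowLens_ne_zero (hk : 0 < k) {lam nu : BddPartition k}
    (h : svKostka k nu lam.1.rowLens ≠ 0) (hne : nu ≠ lam) :
    toLex (nu.1.card, rowIndexSum nu.1) < toLex (lam.1.card, rowIndexSum lam.1) := by
  have h1 := card_le_of_svKostka_ne_zero hk h
  rw [sum_rowLens] at h1
  rw [Prod.Lex.toLex_lt_toLex]
  rcases h1.lt_or_eq with h2 | h2
  · exact .inl h2
  · have h3 := (svKostka_map_range hk _ lam (rowLen_eq_zero le_rfl)).1 nu h h2
    exact .inr ⟨h2, lt_of_le_of_ne h3.1 fun h4 => hne (h3.2 h4)⟩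

end Triangularity

/-! ### Commuting row operators and the symmetry of the tableau numbers -/

section RowOperators

variable {k : ℕ}

/-- The operator on formal combinations of bounded partitions given by the row transitions. -/
noncomputable def rowOp (k r : ℕ) : (BddPartition k →₀ ℤ) →ₗ[ℤ] (BddPartition k →₀ ℤ) :=
  Finsupp.linearCombination ℤ fun lam => ∑ mu ∈ partitionsUpTo k (lam.1.card + r),
    Finsupp.single mu (rowCount r lam mu : ℤ)

theorem rowCount_eq_zero {r : ℕ} {lam mu : BddPartition k}
    (h : mu ∉ partitionsUpTo k (lam.1.card + r)) : rowCount r lam mu = 0 := by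
  by_contra hne
  obtain ⟨A, c, rfl, hc⟩ := exists_isRow_of_rowCount_ne_zero hne
  exact h (mem_partitionsUpTo.2 hc.card_le)

theorem rowOp_single_apply (r : ℕ) (lam mu : BddPartition k) :
    rowOp k r (Finsupp.single lam 1) mu = rowCount r lam mu := by
  classical
  rw [rowOp, Finsupp.linearCombination_single, one_smul, Finsupp.finsetSum_apply]
  simp only [Finsupp.single_apply]
  rw [Finset.sum_ite_eq']
  split_ifs with h
  · rfl
  · rw [rowCount_eq_zero h, Nat.cast_zero]

theorem rowOp_apply (r : ℕ) (v : BddPartition k →₀ ℤ) (mu : BddPartition k) :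
    rowOp k r v mu = v.sum fun lam a => a * rowCount r lam mu := by
  induction v using Finsupp.induction_linear with
  | zero => simp
  | add v w hv hw =>
    rw [map_add, Finsupp.add_apply, hv, hw, Finsupp.sum_add_index'] <;> simp [add_mul]
  | single lam a =>
    rw [← mul_one a, ← smul_eq_mul, ← Finsupp.smul_single, map_smul, Finsupp.smul_apply,
      rowOp_single_apply, Finsupp.smul_single, Finsupp.sum_single_index (by simp)]
    simp

open Classical in
-- The intermediate function is the code of a core, hence of a unique bounded partition, and is
-- determined by the first residue set; this is a matrix product.
theorem card_pairs_eq_sum (r s : ℕ) (lam mu : BddPartition k) :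
    (Finset.univ.filter fun p : Finset (ZMod (k + 1)) × Finset (ZMod (k + 1)) =>
      (p.1.card = r ∧ p.2.card = s) ∧
        ∃ h, Step k p.1 (code lam) h ∧ Step k p.2 h (code mu)).card =
    ∑ nu ∈ partitionsUpTo k (lam.1.card + r), rowCount r lam nu * rowCount s nu mu := by
  have e : (Finset.univ.filter fun p : Finset (ZMod (k + 1)) × Finset (ZMod (k + 1)) =>
      (p.1.card = r ∧ p.2.card = s) ∧ ∃ h, Step k p.1 (code lam) h ∧ Step k p.2 h (code mu)) =
      (partitionsUpTo k (lam.1.card + r)).biUnion fun nu =>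
        (Finset.univ.filter fun A : Finset (ZMod (k + 1)) =>
          A.card = r ∧ Step k A (code lam) (code nu)) ×ˢ
        (Finset.univ.filter fun A : Finset (ZMod (k + 1)) =>
          A.card = s ∧ Step k A (code nu) (code mu)) := by
    ext ⟨A, B⟩
    simp only [Finset.mem_filter, Finset.mem_univ, true_and, Finset.mem_biUnion,
      Finset.mem_product]
    constructor
    · rintro ⟨⟨h1, h2⟩, h, ⟨c, hc⟩, h4⟩
      have hβ := isCode_code lam
      obtain ⟨γ, hγ⟩ := hc.exists_core hβ (hc.quasi_target hβ.quasi)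
      obtain ⟨nu, rfl⟩ := exists_coreOf_eq hγ.isCore
      obtain rfl := hγ.unique (isCode_code nu)
      exact ⟨nu, mem_partitionsUpTo.2 (h1 ▸ hc.card_le), ⟨h1, c, hc⟩, h2, h4⟩
    · rintro ⟨nu, -, ⟨h1, h3⟩, h2, h4⟩
      exact ⟨⟨h1, h2⟩, code nu, h3, h4⟩
  rw [e, Finset.card_biUnion]
  · exact Finset.sum_congr rfl fun nu _ => Finset.card_product _ _
  · intro nu _ nu' _ hne
    rw [Function.onFun, Finset.disjoint_left]
    rintro ⟨A, B⟩ h1 h2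
    simp only [Finset.mem_product, Finset.mem_filter, Finset.mem_univ, true_and] at h1 h2
    obtain ⟨⟨-, c, hc⟩, -⟩ := h1
    obtain ⟨⟨-, c', hc'⟩, -⟩ := h2
    exact hne (code_injective (hc.unique hc').2)

theorem rowOp_comm (r s : ℕ) (v : BddPartition k →₀ ℤ) :
    rowOp k r (rowOp k s v) = rowOp k s (rowOp k r v) := by
  have key : ∀ r s (lam mu : BddPartition k), rowOp k r (rowOp k s (Finsupp.single lam 1)) mu =
      ((∑ nu ∈ partitionsUpTo k (lam.1.card + s), rowCount s lam nu * rowCount r nu mu : ℕ) : ℤ) := by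
    intro r s lam mu
    rw [rowOp_apply, Finsupp.sum, Nat.cast_sum]
    refine (Finset.sum_subset ?_ ?_).trans (Finset.sum_congr rfl fun nu _ => ?_)
    · intro nu hnu
      by_contra h
      rw [Finsupp.mem_support_iff, rowOp_single_apply, rowCount_eq_zero h] at hnu
      exact hnu rfl
    · intro nu _ hnu
      rw [Finsupp.notMem_support_iff.1 hnu, zero_mul]
    · rw [rowOp_single_apply, Nat.cast_mul]
  have : rowOp k r ∘ₗ rowOp k s = rowOp k s ∘ₗ rowOp k r := by
    refine Finsupp.lhom_ext' fun lam => LinearMap.ext_ring (Finsupp.ext fun mu => ?_)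
    simp only [LinearMap.comp_apply, Finsupp.lsingle_apply]
    rw [key, key, ← card_pairs_eq_sum, ← card_pairs_eq_sum,
      card_pairs_comm (isCode_code lam).quasi (isCode_code mu).quasi]
  exact LinearMap.congr_fun this v

/-- The generating vector of the numbers of tableaux of weight `α`. -/
noncomputable def weightVec (k : ℕ) (α : List ℕ) : BddPartition k →₀ ℤ :=
  α.foldl (fun v r => rowOp k r v) (Finsupp.single (emptyPartition k) 1)

theorem weightVec_append (α : List ℕ) (r : ℕ) :
    weightVec k (α ++ [r]) = rowOp k r (weightVec k α) := by
  simp [weightVec]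

/-- Commutation of the row operators makes the number of tableaux independent of the order of the
weight. -/
theorem weightVec_perm {α α' : List ℕ} (h : α.Perm α') : weightVec k α = weightVec k α' := by
  have : RightCommutative fun (v : BddPartition k →₀ ℤ) r => rowOp k r v :=
    ⟨fun v r s => rowOp_comm s r v⟩
  exact h.foldl_eq _

theorem weightVec_apply (hk : 0 < k) (α : List ℕ) (mu : BddPartition k) :
    weightVec k α mu = svKostka k mu α := by
  classical
  induction α using List.reverseRecOn generalizing mu with
  | nil =>
    rw [(tableaux_nil mu).2, weightVec, List.foldl_nil, Finsupp.single_apply]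
    simp [eq_comm]
  | append_singleton α r ih =>
    rw [weightVec_append, rowOp_apply, Finsupp.sum, svKostka_append hk, Nat.cast_sum]
    refine (Finset.sum_subset ?_ ?_).trans (Finset.sum_congr rfl fun nu _ => ?_)
    · intro nu hnu
      rw [Finsupp.mem_support_iff, ih, Nat.cast_ne_zero] at hnu
      exact mem_partitionsUpTo.2 (card_le_of_svKostka_ne_zero hk hnu)
    · intro nu _ hnu
      rw [Finsupp.notMem_support_iff.1 hnu, zero_mul]
    · rw [ih, Nat.cast_mul]

theorem rowOp_zero (v : BddPartition k →₀ ℤ) : rowOp k 0 v = v := by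
  have : rowOp k 0 = LinearMap.id := by
    refine Finsupp.lhom_ext' fun lam => LinearMap.ext_ring (Finsupp.ext fun mu => ?_)
    classical
    simp only [LinearMap.comp_apply, Finsupp.lsingle_apply, LinearMap.id_apply]
    rw [rowOp_single_apply, Finsupp.single_apply]
    split_ifs with h
    · subst h
      rw [Nat.cast_eq_one]
      refine Finset.card_eq_one.2 ⟨∅, ?_⟩
      ext A
      simp only [Finset.mem_filter, Finset.mem_univ, true_and, Finset.card_eq_zero,
        Finset.mem_singleton, and_iff_left_iff_imp]
      rintro rfl
      exact ⟨_, IsRow.refl (isCode_code lam).quasi⟩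
    · rw [Nat.cast_eq_zero]
      by_contra hne
      obtain ⟨A, c, hA, hc⟩ := exists_isRow_of_rowCount_ne_zero hne
      obtain rfl := Finset.card_eq_zero.1 hA
      exact h (code_injective ((IsRow.refl (isCode_code lam).quasi).unique hc).2)
  rw [this, LinearMap.id_apply]

theorem rowLen_rowPartition {r : ℕ} (hr : r ≤ k) (i : ℕ) :
    (rowPartition r hr).1.rowLen i = if i = 0 then r else 0 := by
  split_ifs with h
  · rw [h]
    exact rowLen_rowDiagram r
  · by_contra hne
    have h1 : (i, 0) ∈ (rowDiagram r).cells :=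
      (YoungDiagram.mem_cells _).2 (YoungDiagram.mem_iff_lt_rowLen.2 (Nat.pos_of_ne_zero hne))
    simp only [rowDiagram, Finset.mem_product, Finset.mem_range] at h1
    omega

theorem card_rowPartition {r : ℕ} (hr : r ≤ k) : (rowPartition r hr).1.card = r := by
  change (Finset.range 1 ×ˢ Finset.range r).card = r
  simp

/-- The empty core has no corners, so every letter adds cells and the size is exactly `r`; a
horizontal strip on the empty shape has one row. -/
theorem rowOp_emptyPartition {r : ℕ} (hr : r ≤ k) :
    rowOp k r (Finsupp.single (emptyPartition k) 1) = Finsupp.single (rowPartition r hr) 1 := by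
  classical
  ext mu
  rw [rowOp_single_apply, Finsupp.single_apply]
  have hempty : ∀ i, (emptyPartition k).1.rowLen i = 0 := fun i => by
    rw [emptyPartition_val, rowLen_bot]
  split_ifs with h
  · subst h
    rw [Nat.cast_eq_one]
    refine rowCount_topRow (R := 0) ?_ fun i => ?_
    · rw [coreOf_emptyPartition, rowLen_bot]
    · rw [rowLen_rowPartition, hempty]
  · rw [Nat.cast_eq_zero]
    by_contra hne
    obtain ⟨A, c, hA, hc⟩ := exists_isRow_of_rowCount_ne_zero hne
    have hβ := isCode_code (emptyPartition k)
    have hγ := isCode_code mu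
    have h1 : mu.1.rowLen 1 = 0 := by
      have h2 := hc.rowLen_coreOf_succ_le 0
      rw [coreOf_emptyPartition, rowLen_bot] at h2
      rw [← (coreOf_spec k mu).2]
      exact Nat.le_zero.1 ((boundedRow_le_rowLen k _ _).trans h2)
    have h3 := hc.boundedSize_eq hβ hγ (hc.isHorizontalStrip_self hβ hγ)
    obtain ⟨ρ, -, h4⟩ := hc.exists_isAffineSVStrip hβ hγ
    have h5 : residues k (coreOf k (emptyPartition k)) ρ = ∅ := by
      rw [coreOf_emptyPartition]
      simp [residues]
    rw [h5, Finset.union_empty] at h4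
    rw [h4, hA, boundedSize_coreOf, coreOf_emptyPartition, boundedSize_bot, zero_add] at h3
    have h6 := card_eq_sum_rowLen mu.1 1 (exists_rowLen_le h1)
    rw [Finset.sum_range_one, h3] at h6
    apply h
    apply Subtype.ext
    apply ext_rowLen
    intro i
    rw [rowLen_rowPartition]
    split_ifs with hi
    · rw [hi, h6]
    · have := mu.1.rowLen_anti 1 i (by omega)
      omega

end RowOperators

/-! ### Unitriangular maps -/

section LinearAlgebra

/-- An index of maximal rank in the support of a vector keeps its coefficient, which gives
injectivity; well-founded induction on the rank reaches every basis vector. -/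
theorem bijective_of_unitriangular {ι κ : Type*} [LinearOrder κ] [WellFoundedLT κ] (m : ι → κ)
    (P : (ι →₀ ℤ) →ₗ[ℤ] (ι →₀ ℤ)) (h1 : ∀ i, P (Finsupp.single i 1) i = 1)
    (h2 : ∀ i j, P (Finsupp.single i 1) j ≠ 0 → j ≠ i → m j < m i) : Function.Bijective P := by
  classical
  constructor
  · rw [injective_iff_map_eq_zero]
    intro v hv
    by_contra hne
    obtain ⟨i, hi, hmax⟩ := Finset.exists_max_image v.support m (Finsupp.support_nonempty_iff.2 hne)
    have h3 : P v i = v.sum fun j a => a * P (Finsupp.single j 1) i := by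
      conv_lhs => rw [← Finsupp.sum_single v]
      rw [Finsupp.sum, map_sum, Finsupp.finsetSum_apply]
      refine Finset.sum_congr rfl fun j _ => ?_
      rw [← mul_one (v j), ← smul_eq_mul, ← Finsupp.smul_single, map_smul, Finsupp.smul_apply,
        smul_eq_mul, smul_eq_mul, mul_one]
    rw [hv, Finsupp.zero_apply, Finsupp.sum, Finset.sum_eq_single_of_mem i hi, h1, mul_one] at h3
    · exact Finsupp.mem_support_iff.1 hi h3.symm
    · intro j hj hji
      by_contra h4
      exact absurd (h2 j i (right_ne_zero_of_mul h4) hji.symm) (not_lt.2 (hmax j hj))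
  · have key : ∀ i, Finsupp.single i (1 : ℤ) ∈ LinearMap.range P := by
      intro i
      induction hx : m i using WellFoundedLT.induction generalizing i with
      | ind x ih =>
        subst hx
        have h3 : Finsupp.single i (1 : ℤ) = P (Finsupp.single i 1) -
            ∑ j ∈ (P (Finsupp.single i 1)).support.erase i,
              P (Finsupp.single i 1) j • Finsupp.single j (1 : ℤ) := by
          have h4 := Finsupp.sum_single (P (Finsupp.single i 1))
          have hi : i ∈ (P (Finsupp.single i 1)).support := by
            rw [Finsupp.mem_support_iff, h1]
            exact one_ne_zero
          rw [Finsupp.sum, ← Finset.add_sum_erase _ _ hi, h1] at h4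
          simp only [Finsupp.smul_single, smul_eq_mul, mul_one]
          exact eq_sub_of_add_eq h4
        rw [h3]
        refine Submodule.sub_mem _ ⟨_, rfl⟩ (Submodule.sum_mem _ fun j hj => ?_)
        rw [Finset.mem_erase, Finsupp.mem_support_iff] at hj
        exact Submodule.smul_mem _ _ (ih _ (h2 i j hj.2 hj.1) j rfl)
    intro v
    rw [← LinearMap.mem_range, ← Finsupp.sum_single v]
    refine Submodule.sum_mem _ fun i _ => ?_
    rw [← mul_one (v i), ← smul_eq_mul, ← Finsupp.smul_single]
    exact Submodule.smul_mem _ _ (key i)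

end LinearAlgebra

/-! ### The system defining the k-K-Schur functions and multiplication by rows -/

section Family

variable {k : ℕ}

/-- The linear map sending a bounded partition to the vector of its tableaux. -/
noncomputable def kostkaMap (k : ℕ) : (BddPartition k →₀ ℤ) →ₗ[ℤ] (BddPartition k →₀ ℤ) :=
  Finsupp.linearCombination ℤ fun lam => weightVec k lam.1.rowLens

theorem kostkaMap_single (lam : BddPartition k) :
    kostkaMap k (Finsupp.single lam 1) = weightVec k lam.1.rowLens := by
  simp [kostkaMap]

theorem kostkaMap_bijective (hk : 0 < k) : Function.Bijective (kostkaMap k) := by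
  refine bijective_of_unitriangular
    (fun mu : BddPartition k => toLex (mu.1.card, rowIndexSum mu.1)) _ (fun lam => ?_) ?_
  · rw [kostkaMap_single, weightVec_apply hk, svKostka_rowLens_self hk, Nat.cast_one]
  · intro lam mu h1 h2
    rw [kostkaMap_single, weightVec_apply hk, Nat.cast_ne_zero] at h1
    exact svKostka_rowLens_ne_zero hk h1 h2

/-- The product of signed complete symmetric functions. -/
noncomputable def signedH (α : List ℕ) : SymFun := (α.map fun r => (-1) ^ r * hSym r).prod

theorem signedH_eq (α : List ℕ) : signedH α = (-1) ^ α.sum * (α.map hSym).prod := by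
  induction α with
  | nil => simp [signedH]
  | cons r α ih =>
    rw [signedH, List.map_cons, List.prod_cons, ← signedH, ih, List.map_cons, List.prod_cons,
      List.sum_cons, pow_add]
    ring

theorem neg_one_pow_mul_self {R : Type*} [CommRing R] (n : ℕ) : ((-1) ^ n * (-1) ^ n : R) = 1 := by
  rw [← mul_pow, neg_one_mul, neg_neg, one_pow]

/-- The linear extension of a signed family of symmetric functions. -/
noncomputable def signedMap (g : BddPartition k → SymFun) : (BddPartition k →₀ ℤ) →ₗ[ℤ] SymFun :=
  Finsupp.linearCombination ℤ fun mu => (-1) ^ mu.1.card * g mu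

theorem signedMap_single (g : BddPartition k → SymFun) (mu : BddPartition k) :
    signedMap g (Finsupp.single mu 1) = (-1) ^ mu.1.card * g mu := by
  simp [signedMap]

theorem signedMap_weightVec (hk : 0 < k) (g : BddPartition k → SymFun) {α : List ℕ} {n : ℕ}
    (hα : α.sum = n) : signedMap g (weightVec k α) = ∑ nu ∈ partitionsUpTo k n,
      ((-1 : ℤ) ^ nu.1.card * (svKostka k nu α : ℤ)) • g nu := by
  rw [signedMap, Finsupp.linearCombination_apply, Finsupp.sum]
  refine (Finset.sum_subset ?_ ?_).trans (Finset.sum_congr rfl fun nu _ => ?_)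
  · intro nu hnu
    rw [Finsupp.mem_support_iff, weightVec_apply hk, Nat.cast_ne_zero] at hnu
    exact mem_partitionsUpTo.2 (hα ▸ card_le_of_svKostka_ne_zero hk hnu)
  · intro nu _ hnu
    rw [Finsupp.notMem_support_iff.1 hnu]
    exact zero_smul ℤ _
  · rw [weightVec_apply hk, zsmul_eq_mul, zsmul_eq_mul]
    push_cast
    ring

/-- Absorbing the sign of each degree into `g_μ` and `h_r` turns the system into the statement that
a linear map has prescribed values on the weight vectors. -/
theorem isKKSchurFamily_iff (hk : 0 < k) (g : BddPartition k → SymFun) :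
    IsKKSchurFamily k g ↔
      ∀ lam : BddPartition k, signedMap g (weightVec k lam.1.rowLens) = signedH lam.1.rowLens := by
  refine forall_congr' fun lam => ?_
  rw [signedMap_weightVec hk g (sum_rowLens lam.1), signedH_eq, sum_rowLens]
  have e : ∑ nu ∈ partitionsUpTo k lam.1.card,
      ((-1 : ℤ) ^ (lam.1.card + nu.1.card) * (svKostka k nu lam.1.rowLens : ℤ)) • g nu =
      (-1) ^ lam.1.card * ∑ nu ∈ partitionsUpTo k lam.1.card,
      ((-1 : ℤ) ^ nu.1.card * (svKostka k nu lam.1.rowLens : ℤ)) • g nu := by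
    rw [Finset.mul_sum]
    refine Finset.sum_congr rfl fun nu _ => ?_
    rw [zsmul_eq_mul, zsmul_eq_mul, pow_add]
    push_cast
    ring
  have hsq := neg_one_pow_mul_self (R := SymFun) lam.1.card
  rw [e, hPart]
  constructor
  · intro h
    rw [h, ← mul_assoc, hsq, one_mul]
  · intro h
    rw [h, ← mul_assoc, hsq, one_mul]

/-- Since `kostkaMap` is bijective, the system says that `signedMap g` is one particular linear map,
and a family is determined by its signed map on basis vectors. -/
theorem existsUnique_isKKSchurFamily (hk : 0 < k) :
    ∃! g : BddPartition k → SymFun, IsKKSchurFamily k g := by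
  set e := LinearEquiv.ofBijective (kostkaMap k) (kostkaMap_bijective hk) with he
  set H : (BddPartition k →₀ ℤ) →ₗ[ℤ] SymFun :=
    Finsupp.linearCombination ℤ fun lam => signedH lam.1.rowLens with hH
  have hsq := neg_one_pow_mul_self (R := SymFun)
  have key : ∀ g : BddPartition k → SymFun, IsKKSchurFamily k g ↔
      signedMap g = H ∘ₗ e.symm.toLinearMap := by
    intro g
    rw [isKKSchurFamily_iff hk]
    have h1 : signedMap g = H ∘ₗ e.symm.toLinearMap ↔ signedMap g ∘ₗ kostkaMap k = H := by
      constructor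
      · intro h
        rw [h]
        refine LinearMap.ext fun v => ?_
        have h2 : e.symm (kostkaMap k v) = v := e.symm_apply_apply v
        rw [LinearMap.comp_apply, LinearMap.comp_apply, LinearEquiv.coe_coe, h2]
      · intro h
        rw [← h]
        refine LinearMap.ext fun v => ?_
        have h2 : kostkaMap k (e.symm v) = v := e.apply_symm_apply v
        simp [h2]
    rw [h1]
    constructor
    · intro h
      refine Finsupp.lhom_ext' fun lam => LinearMap.ext_ring ?_
      simp only [LinearMap.comp_apply, Finsupp.lsingle_apply, kostkaMap_single, h lam, hH,
        Finsupp.linearCombination_single, one_smul]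
    · intro h lam
      rw [← kostkaMap_single, ← LinearMap.comp_apply, h, hH, Finsupp.linearCombination_single,
        one_smul]
  refine ⟨fun mu => (-1) ^ mu.1.card * H (e.symm (Finsupp.single mu 1)), ?_, fun g hg => ?_⟩
  · simp only [key]
    refine Finsupp.lhom_ext' fun mu => LinearMap.ext_ring ?_
    simp only [LinearMap.comp_apply, Finsupp.lsingle_apply, signedMap_single, ← mul_assoc, hsq,
      one_mul, LinearEquiv.coe_coe]
  · funext mu
    have h1 := LinearMap.congr_fun ((key g).1 hg) (Finsupp.single mu 1)
    rw [signedMap_single, LinearMap.comp_apply, LinearEquiv.coe_coe] at h1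
    rw [← h1, ← mul_assoc, hsq, one_mul]

theorem hSym_zero : hSym 0 = 1 := by
  classical
  apply Subtype.ext
  change completeSeries 0 = 1
  ext d
  rw [MvPowerSeries.coeff_one]
  change (if d.degree = 0 then (1 : ℤ) else 0) = _
  simp [Finsupp.degree_eq_zero_iff]

/-- On the weight vector of a partition, the row operator appends `r` to the weight. By symmetry the
weight may be sorted into a partition again, where the system gives the product with `h_r`. Weight
vectors of bounded partitions span. -/
theorem signedMap_rowOp (hk : 0 < k) {g : BddPartition k → SymFun} (hg : IsKKSchurFamily k g)
    {r : ℕ} (hr : r ≤ k) (v : BddPartition k →₀ ℤ) :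
    signedMap g (rowOp k r v) = (-1) ^ r * hSym r * signedMap g v := by
  rw [isKKSchurFamily_iff hk] at hg
  -- For `r = 0` the sorted list would not be the row lengths of a diagram, as these are positive.
  rcases Nat.eq_zero_or_pos r with rfl | h0
  · rw [rowOp_zero, hSym_zero, pow_zero, one_mul, one_mul]
  have key : signedMap g ∘ₗ rowOp k r ∘ₗ kostkaMap k =
      LinearMap.mulLeft ℤ ((-1) ^ r * hSym r) ∘ₗ signedMap g ∘ₗ kostkaMap k := by
    refine Finsupp.lhom_ext' fun lam => LinearMap.ext_ring ?_
    simp only [LinearMap.comp_apply, Finsupp.lsingle_apply, kostkaMap_single,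
      LinearMap.mulLeft_apply]
    set w := lam.1.rowLens.orderedInsert (· ≥ ·) r with hw
    have hperm : w.Perm (r :: lam.1.rowLens) := List.perm_orderedInsert _ r _
    have hsorted : w.SortedGE := (lam.1.rowLens_sorted.pairwise.orderedInsert r _).sortedGE
    have hpos : ∀ x ∈ w, 0 < x := by
      intro x hx
      rcases List.mem_cons.1 (hperm.mem_iff.1 hx) with rfl | h
      · exact h0
      · exact lam.1.pos_of_mem_rowLens x h
    have hrows := YoungDiagram.rowLens_ofRowLens_eq_self (hw := hsorted) hpos
    have hle : (YoungDiagram.ofRowLens w hsorted).rowLen 0 ≤ k := by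
      rcases Nat.eq_zero_or_pos ((YoungDiagram.ofRowLens w hsorted).rowLen 0) with h1 | h1
      · rw [h1]
        exact Nat.zero_le k
      · have h2 : 0 < (YoungDiagram.ofRowLens w hsorted).colLen 0 :=
          YoungDiagram.mem_iff_lt_colLen.1 (YoungDiagram.mem_iff_lt_rowLen.2 h1)
        have h3 : (YoungDiagram.ofRowLens w hsorted).rowLen 0 ∈ w := by
          have h3 : (YoungDiagram.ofRowLens w hsorted).rowLen 0 ∈
              (YoungDiagram.ofRowLens w hsorted).rowLens := by
            rw [YoungDiagram.rowLens, List.mem_map]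
            exact ⟨0, List.mem_range.2 h2, rfl⟩
          rwa [hrows] at h3
        rcases List.mem_cons.1 (hperm.mem_iff.1 h3) with h | h
        · rw [h]
          exact hr
        · rw [YoungDiagram.rowLens, List.mem_map] at h
          obtain ⟨i, -, hi⟩ := h
          rw [← hi]
          exact (lam.1.rowLen_anti 0 i (Nat.zero_le i)).trans lam.2
    have h4 := hg ⟨YoungDiagram.ofRowLens w hsorted, hle⟩
    simp only [hrows] at h4
    have h5 : signedH w = (-1) ^ r * hSym r * signedH lam.1.rowLens := by
      rw [signedH, (hperm.map _).prod_eq, List.map_cons, List.prod_cons, signedH]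
    rw [← weightVec_append, hg lam, ← h5, ← h4]
    congr 1
    exact weightVec_perm (List.perm_append_singleton r _ |>.trans hperm.symm)
  obtain ⟨u, rfl⟩ := (kostkaMap_bijective hk).2 v
  exact LinearMap.congr_fun key u

theorem rowLens_emptyPartition (k : ℕ) : (emptyPartition k).1.rowLens = [] := by
  rw [← List.length_eq_zero_iff, YoungDiagram.length_rowLens]
  refine Nat.le_zero.1 (exists_rowLen_le ?_)
  rw [emptyPartition_val, rowLen_bot]

/-- Up to the common sign this says `g_r = h_r`. -/
theorem signedMap_rowPartition (hk : 0 < k) {g : BddPartition k → SymFun}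
    (hg : IsKKSchurFamily k g) {r : ℕ} (hr : r ≤ k) :
    signedMap g (Finsupp.single (rowPartition r hr) 1) = (-1) ^ r * hSym r := by
  have h1 : signedMap g (Finsupp.single (emptyPartition k) 1) = 1 := by
    have := (isKKSchurFamily_iff hk g).1 hg (emptyPartition k)
    rw [rowLens_emptyPartition] at this
    simpa [weightVec, signedH] using this
  rw [← rowOp_emptyPartition hr, signedMap_rowOp hk hg hr, h1, mul_one]

theorem row_mul (hk : 0 < k) {g : BddPartition k → SymFun} (hg : IsKKSchurFamily k g)
    (lam : BddPartition k) {r : ℕ} (hr : r ≤ k) :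
    g (rowPartition r hr) * g lam = ∑ mu ∈ partitionsUpTo k (lam.1.card + r),
      rowCount r lam mu • ((-1 : ℤ) ^ (lam.1.card + r + mu.1.card) • g mu) := by
  have h1 := signedMap_rowOp hk hg hr (Finsupp.single lam 1)
  rw [← signedMap_rowPartition hk hg hr, signedMap_single, signedMap_single, card_rowPartition,
    rowOp, Finsupp.linearCombination_single, one_smul, map_sum] at h1
  have hsq := neg_one_pow_mul_self (R := SymFun)
  have h2 : g (rowPartition r hr) * g lam = (-1) ^ (lam.1.card + r) *
      ((-1) ^ r * g (rowPartition r hr) * ((-1) ^ lam.1.card * g lam)) := by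
    have e1 := hsq r
    have e2 := hsq lam.1.card
    rw [pow_add]
    linear_combination (-(g (rowPartition r hr) * g lam)) *
      (((-1) ^ r * (-1) ^ r : SymFun) * e2 + e1)
  rw [h2, ← h1, Finset.mul_sum]
  refine Finset.sum_congr rfl fun mu _ => ?_
  have e3 : Finsupp.single mu (rowCount r lam mu : ℤ) =
      (rowCount r lam mu : ℤ) • Finsupp.single mu 1 := by simp
  rw [e3, map_smul, signedMap_single, zsmul_eq_mul, nsmul_eq_mul, zsmul_eq_mul, pow_add _ (lam.1.card + r)]
  push_cast
  ring

end Family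

/-! ### Row transitions read as affine set-valued strips -/

section Pieri

variable {k : ℕ}

/-- The residues of the letters of an affine set-valued strip. -/
noncomputable def stripResidues (k : ℕ) (lam : BddPartition k) (p : BddPartition k × YoungDiagram) :
    Finset (ZMod (k + 1)) :=
  residues k (coreOf k p.1) (coreOf k lam) ∪ residues k (coreOf k lam) p.2

open Classical in
-- Replacing `ρ` by the set of residues of the strip is a bijection from the pairs `(μ, ρ)` to the
-- pairs of `μ` and a row transition, by `IsAffineSVStrip.step` and `IsRow.exists_isAffineSVStrip`.
theorem finsum_pieriSet {M : Type*} [AddCommMonoid M] (lam : BddPartition k) {r : ℕ} (hr : r ≤ k)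
    (G : BddPartition k → M) : (pieriSet k lam r).Finite ∧
      ∑ᶠ p ∈ pieriSet k lam r, G p.1 =
        ∑ mu ∈ partitionsUpTo k (lam.1.card + r), rowCount r lam mu • G mu := by
  set Ψ := fun p : BddPartition k × YoungDiagram => (p.1, stripResidues k lam p) with hΨ
  have hstep : ∀ p ∈ pieriSet k lam r, (stripResidues k lam p).card = r ∧
      Step k (stripResidues k lam p) (code lam) (code p.1) ∧ ∀ d, d ∈ p.2 ↔
        d ∈ coreOf k lam ∧ d ∉ letterCells k (stripResidues k lam p) (coreOf k lam) (coreOf k p.1) :=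
    fun p hp => IsAffineSVStrip.step hr (isCode_code lam) (isCode_code p.1) hp
  have hinj : Set.InjOn Ψ (pieriSet k lam r) := by
    rintro ⟨mu, ρ⟩ hp ⟨mu', ρ'⟩ hp' heq
    simp only [hΨ, Prod.mk.injEq] at heq
    obtain ⟨rfl, heq⟩ := heq
    have h1 := (hstep _ hp).2.2
    have h2 := (hstep _ hp').2.2
    rw [← heq] at h2
    have : ρ = ρ' := by
      apply YoungDiagram.ext
      ext d
      rw [YoungDiagram.mem_cells, YoungDiagram.mem_cells]
      exact (h1 d).trans (h2 d).symm
    rw [this]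
  set D := (partitionsUpTo k (lam.1.card + r)).sigma fun mu =>
    Finset.univ.filter fun A : Finset (ZMod (k + 1)) =>
      A.card = r ∧ Step k A (code lam) (code mu) with hD
  set D' : Finset (BddPartition k × Finset (ZMod (k + 1))) := D.image fun q => (q.1, q.2) with hD'
  have himage : Ψ '' pieriSet k lam r = D' := by
    ext ⟨mu, A⟩
    simp only [hD', hD, Set.mem_image, Finset.coe_image, Finset.mem_coe, Finset.mem_sigma,
      Finset.mem_filter, Finset.mem_univ, true_and, Sigma.exists, Prod.mk.injEq, hΨ]
    constructor
    · rintro ⟨p, hp, rfl, rfl⟩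
      obtain ⟨h1, ⟨c, hc⟩, -⟩ := hstep p hp
      have := hc.card_le
      rw [h1] at this
      exact ⟨p.1, _, ⟨mem_partitionsUpTo.2 this, h1, c, hc⟩, rfl, rfl⟩
    · rintro ⟨mu, A, ⟨-, h1, c, hc⟩, rfl, rfl⟩
      obtain ⟨ρ, h2, h3⟩ := hc.exists_isAffineSVStrip (isCode_code lam) (isCode_code mu)
      rw [h1] at h2
      exact ⟨(mu, ρ), h2, rfl, h3⟩
  refine ⟨Set.Finite.of_finite_image (himage ▸ D'.finite_toSet) hinj, ?_⟩
  have h1 : ∑ᶠ p ∈ pieriSet k lam r, G p.1 = ∑ᶠ q ∈ Ψ '' pieriSet k lam r, G q.1 :=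
    (finsum_mem_image (f := fun q : BddPartition k × Finset (ZMod (k + 1)) => G q.1) hinj).symm
  rw [h1, himage, finsum_mem_coe_finset, hD', Finset.sum_image, hD, Finset.sum_sigma]
  · refine Finset.sum_congr rfl fun mu _ => ?_
    exact Finset.sum_const (G mu)
  · rintro ⟨mu, A⟩ _ ⟨mu', A'⟩ _ heq
    simp only [Prod.mk.injEq] at heq
    obtain ⟨rfl, rfl⟩ := heq
    rfl

theorem negOnePow_sub_card (a r m : ℕ) :
    (Int.negOnePow ((a : ℤ) + r - m) : ℤ) = (-1) ^ (a + r + m) := by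
  rw [Int.negOnePow_sub, ← Nat.cast_add, Int.negOnePow_def, Int.negOnePow_def, pow_add _ (a + r) m]
  simp only [zpow_natCast, Units.val_mul, Units.val_pow_eq_pow_val, Units.val_neg, Units.val_one]

end Pieri

end KKSchur

theorem mainTheorem4 (k : ℕ) (hk : 0 < k) :
    (∃! g : KKSchur.BddPartition k → KKSchur.SymFun, KKSchur.IsKKSchurFamily k g) ∧
    ∀ (lam : KKSchur.BddPartition k) (r : ℕ) (hr : r ≤ k),
      (KKSchur.pieriSet k lam r).Finite ∧
      KKSchur.kkSchur k (KKSchur.rowPartition r hr) * KKSchur.kkSchur k lam =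
        ∑ᶠ p ∈ KKSchur.pieriSet k lam r,
          (Int.negOnePow ((lam.1.card : ℤ) + r - p.1.1.card) : ℤ) • KKSchur.kkSchur k p.1 := by
  refine ⟨KKSchur.existsUnique_isKKSchurFamily hk, fun lam r hr => ?_⟩
  have hg : KKSchur.IsKKSchurFamily k (KKSchur.kkSchur k) :=
    Classical.epsilon_spec (KKSchur.existsUnique_isKKSchurFamily hk).exists
  obtain ⟨h1, h2⟩ := KKSchur.finsum_pieriSet lam hr fun mu =>
    ((-1 : ℤ) ^ (lam.1.card + r + mu.1.card)) • KKSchur.kkSchur k mu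
  refine ⟨h1, ?_⟩
  simp only [KKSchur.negOnePow_sub_card]
  rw [KKSchur.row_mul hk hg lam hr, h2]
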